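/- There is a deterministic algorithm and an absolute constant $K$ such that the following holds. The input consists of an integer $n\ge 1$, a matrix $A=(a_{ik})\in\mathbb{R}^{n\times n}$ and real numbers $C$ and $\epsilon>0$ such that $|a_{ik}|\le C$ for all $i,k$, and such that $\sum_k a_{ik}^2\le n$ for every row $i$ and $\sum_i a_{ik}^2\le n$ for every column $k$. On each such input the algorithm halts after at most $K\max(1,C/\epsilon)^K n^2$ steps, and either - outputs a claim that every singular value of $A$ is at most $\epsilon n$, and this claim is then correct, or - outputs sets $S,T\subseteq\{1,\dots,n\}$ such that $$\Bigl|\sum_{i\in S,\,k\in T}a_{ik}\Bigr|\ge\frac{\epsilon^8}{100}n^2$$ (so that $A$ has a singular value that is at least $\frac{\epsilon^8}{100}n$). The model of computation is a real random access machine: a finite program, independent of the input, works with arrays of exact real numbers and arrays of machine words (natural numbers). Field operations and comparisons of real numbers, arithmetic operations and comparisons of words, conversion of a word to a real number, and accesses to the memory or to the entries of $A$ cost one step each. There is no conversion from real numbers to words, and all words and addresses used in the computation are bounded by $K\max(1,C/\epsilon)^K n^2$. -/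

import Mathlib

/-!
A real random access machine.

The machine has two kinds of memory: machine words (natural numbers, used for counting and
addressing) and exact real numbers.  Each kind of memory is organised in arrays with numerical
names; a program mentions only finitely many of them.  A program is a finite piece of text, it does
not depend on the input, and the only constants occurring in it are natural numbers.  Every
arithmetic operation, comparison, memory access and input access costs one step.  There is no
operation that turns a real number into a word; the only access to real numbers is through exact
field operations and comparisons.  Words are bounded: a run with word bound `W` is illegal, and has
no result, as soon as a word larger than `W` is computed.  Division by zero and reading an entry
outside of the input matrix are illegal as well.
-/

namespace RealRAM

/-- The input: a real square matrix together with two real parameters. -/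
structure Input where
  /-- the number of rows and columns -/
  n : ℕ
  /-- the matrix -/
  A : Matrix (Fin n) (Fin n) ℝ
  /-- the bound on the absolute values of the entries -/
  C : ℝ
  /-- the accuracy -/
  ε : ℝ

/-- Random access to the input matrix by word indices (counted from `0`).  The value `0` outside of
the range is never used, since such an access is illegal. -/
def Input.entry (x : Input) (i k : ℕ) : ℝ :=
  if h : i < x.n ∧ k < x.n then x.A ⟨i, h.1⟩ ⟨k, h.2⟩ else 0

/-- The content of the memory: `word a i` and `real a i` are the cells with index `i` of the word
array and of the real array with name `a`. -/
structure Store where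
  word : ℕ → ℕ → ℕ
  real : ℕ → ℕ → ℝ

/-- The initial memory: all cells are zero. -/
def Store.init : Store := ⟨fun _ _ => 0, fun _ _ => 0⟩

/-- Write the word `v` to the cell with index `i` of the word array `a`. -/
def Store.setWord (s : Store) (a i v : ℕ) : Store :=
  { s with word := Function.update s.word a (Function.update (s.word a) i v) }

/-- Write the real number `v` to the cell with index `i` of the real array `a`. -/
def Store.setReal (s : Store) (a i : ℕ) (v : ℝ) : Store :=
  { s with real := Function.update s.real a (Function.update (s.real a) i v) }

/-- Word expressions. -/
inductive WExp where
  /-- a constant -/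
  | const (c : ℕ)
  /-- the number of rows of the input matrix -/
  | size
  /-- the content of a cell of the word array `a` -/
  | cell (a : ℕ) (i : WExp)
  | add (e f : WExp)
  /-- subtraction, with result `0` if the second argument is larger -/
  | sub (e f : WExp)
  | mul (e f : WExp)
  /-- the quotient of division with remainder -/
  | div (e f : WExp)
  /-- the remainder of division with remainder -/
  | mod (e f : WExp)

/-- Real expressions. -/
inductive RExp where
  /-- a word, regarded as a real number -/
  | cast (e : WExp)
  /-- an entry of the input matrix -/
  | entry (i k : WExp)
  /-- the input parameter `C` -/
  | bound
  /-- the input parameter `ε` -/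
  | accuracy
  /-- the content of a cell of the real array `a` -/
  | cell (a : ℕ) (i : WExp)
  | add (e f : RExp)
  | sub (e f : RExp)
  | mul (e f : RExp)
  | div (e f : RExp)

/-- Tests. -/
inductive Test where
  | wordLE (e f : WExp)
  | realLE (e f : RExp)
  | not (b : Test)
  | and (b c : Test)

/-- Programs. -/
inductive Prog where
  | skip
  /-- assign the value of `e` to the cell with index `i` of the word array `a` -/
  | setWord (a : ℕ) (i : WExp) (e : WExp)
  /-- assign the value of `e` to the cell with index `i` of the real array `a` -/
  | setReal (a : ℕ) (i : WExp) (e : RExp)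
  | seq (p q : Prog)
  | ite (b : Test) (p q : Prog)
  | while (b : Test) (p : Prog)

/-- The value of a word expression. -/
def WExp.eval (x : Input) (s : Store) : WExp → ℕ
  | const c => c
  | size => x.n
  | cell a i => s.word a (i.eval x s)
  | add e f => e.eval x s + f.eval x s
  | sub e f => e.eval x s - f.eval x s
  | mul e f => e.eval x s * f.eval x s
  | div e f => e.eval x s / f.eval x s
  | mod e f => e.eval x s % f.eval x s

/-- The evaluation of a word expression is legal for the word bound `W`: all words that occur are
at most `W`, and there is no division by zero. -/
def WExp.Legal (x : Input) (W : ℕ) (s : Store) : WExp → Prop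
  | const c => c ≤ W
  | size => x.n ≤ W
  | cell a i => i.Legal x W s ∧ s.word a (i.eval x s) ≤ W
  | add e f => e.Legal x W s ∧ f.Legal x W s ∧ e.eval x s + f.eval x s ≤ W
  | sub e f => e.Legal x W s ∧ f.Legal x W s
  | mul e f => e.Legal x W s ∧ f.Legal x W s ∧ e.eval x s * f.eval x s ≤ W
  | div e f => e.Legal x W s ∧ f.Legal x W s ∧ f.eval x s ≠ 0
  | mod e f => e.Legal x W s ∧ f.Legal x W s ∧ f.eval x s ≠ 0

/-- The number of steps for the evaluation of a word expression. -/
def WExp.cost : WExp → ℕ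
  | const _ => 1
  | size => 1
  | cell _ i => i.cost + 1
  | add e f => e.cost + f.cost + 1
  | sub e f => e.cost + f.cost + 1
  | mul e f => e.cost + f.cost + 1
  | div e f => e.cost + f.cost + 1
  | mod e f => e.cost + f.cost + 1

/-- The value of a real expression. -/
noncomputable def RExp.eval (x : Input) (s : Store) : RExp → ℝ
  | cast e => (e.eval x s : ℝ)
  | entry i k => x.entry (i.eval x s) (k.eval x s)
  | bound => x.C
  | accuracy => x.ε
  | cell a i => s.real a (i.eval x s)
  | add e f => e.eval x s + f.eval x s
  | sub e f => e.eval x s - f.eval x s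
  | mul e f => e.eval x s * f.eval x s
  | div e f => e.eval x s / f.eval x s

/-- The evaluation of a real expression is legal for the word bound `W`. -/
def RExp.Legal (x : Input) (W : ℕ) (s : Store) : RExp → Prop
  | cast e => e.Legal x W s
  | entry i k => i.Legal x W s ∧ k.Legal x W s ∧ i.eval x s < x.n ∧ k.eval x s < x.n
  | bound => True
  | accuracy => True
  | cell _ i => i.Legal x W s
  | add e f => e.Legal x W s ∧ f.Legal x W s
  | sub e f => e.Legal x W s ∧ f.Legal x W s
  | mul e f => e.Legal x W s ∧ f.Legal x W s
  | div e f => e.Legal x W s ∧ f.Legal x W s ∧ f.eval x s ≠ 0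

/-- The number of steps for the evaluation of a real expression. -/
def RExp.cost : RExp → ℕ
  | cast e => e.cost + 1
  | entry i k => i.cost + k.cost + 1
  | bound => 1
  | accuracy => 1
  | cell _ i => i.cost + 1
  | add e f => e.cost + f.cost + 1
  | sub e f => e.cost + f.cost + 1
  | mul e f => e.cost + f.cost + 1
  | div e f => e.cost + f.cost + 1

/-- The test succeeds. -/
def Test.Holds (x : Input) (s : Store) : Test → Prop
  | wordLE e f => e.eval x s ≤ f.eval x s
  | realLE e f => e.eval x s ≤ f.eval x s
  | not b => ¬ b.Holds x s
  | and b c => b.Holds x s ∧ c.Holds x s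

/-- The evaluation of a test is legal for the word bound `W`. -/
def Test.Legal (x : Input) (W : ℕ) (s : Store) : Test → Prop
  | wordLE e f => e.Legal x W s ∧ f.Legal x W s
  | realLE e f => e.Legal x W s ∧ f.Legal x W s
  | not b => b.Legal x W s
  | and b c => b.Legal x W s ∧ c.Legal x W s

/-- The number of steps for the evaluation of a test. -/
def Test.cost : Test → ℕ
  | wordLE e f => e.cost + f.cost + 1
  | realLE e f => e.cost + f.cost + 1
  | not b => b.cost + 1
  | and b c => b.cost + c.cost + 1

/-- `Exec x W p s t s'`: on the input `x`, with word bound `W`, the program `p`, started with the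
memory `s`, halts after exactly `t` steps with the memory `s'`, and all of this is legal.  At most
one rule applies in each situation, so `t` and `s'` are determined by `x`, `p` and `s`. -/
inductive Exec (x : Input) (W : ℕ) : Prog → Store → ℕ → Store → Prop
  | skip (s : Store) : Exec x W .skip s 1 s
  | setWord (a : ℕ) (i e : WExp) (s : Store) (hi : i.Legal x W s) (he : e.Legal x W s) :
      Exec x W (.setWord a i e) s (i.cost + e.cost + 1) (s.setWord a (i.eval x s) (e.eval x s))
  | setReal (a : ℕ) (i : WExp) (e : RExp) (s : Store) (hi : i.Legal x W s) (he : e.Legal x W s) :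
      Exec x W (.setReal a i e) s (i.cost + e.cost + 1) (s.setReal a (i.eval x s) (e.eval x s))
  | seq {p q : Prog} {s s' s'' : Store} {t t' : ℕ}
      (hp : Exec x W p s t s') (hq : Exec x W q s' t' s'') :
      Exec x W (.seq p q) s (t + t') s''
  | iteTrue {b : Test} {p q : Prog} {s s' : Store} {t : ℕ}
      (hl : b.Legal x W s) (hb : b.Holds x s) (hp : Exec x W p s t s') :
      Exec x W (.ite b p q) s (b.cost + t) s'
  | iteFalse {b : Test} {p q : Prog} {s s' : Store} {t : ℕ}
      (hl : b.Legal x W s) (hb : ¬ b.Holds x s) (hq : Exec x W q s t s') :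
      Exec x W (.ite b p q) s (b.cost + t) s'
  | whileTrue {b : Test} {p : Prog} {s s' s'' : Store} {t t' : ℕ}
      (hl : b.Legal x W s) (hb : b.Holds x s) (hp : Exec x W p s t s')
      (hw : Exec x W (.while b p) s' t' s'') :
      Exec x W (.while b p) s (b.cost + t + t') s''
  | whileFalse {b : Test} {p : Prog} {s : Store}
      (hl : b.Legal x W s) (hb : ¬ b.Holds x s) :
      Exec x W (.while b p) s b.cost s

/-- Started with empty memory on the input `x`, the program `p` halts with the memory `s`, after at
most `B` steps and using only words (in particular, only addresses) that are at most `B`. -/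
def HaltsWithin (p : Prog) (x : Input) (B : ℝ) (s : Store) : Prop :=
  ∃ W t : ℕ, (W : ℝ) ≤ B ∧ (t : ℝ) ≤ B ∧ Exec x W p Store.init t s

/-- The output flag, found in the first cell of the word array `0`: the program claims that all
singular values are small. -/
def Store.Certifies (s : Store) : Prop := s.word 0 0 = 1

/-- The set of indices that is marked by ones in the first `n` cells of the word array `a`. -/
def Store.outputSet (s : Store) (a n : ℕ) : Finset (Fin n) :=
  Finset.univ.filter fun i => s.word a i = 1

end RealRAM

/-!
The rows of `A` are read one after the other, and the quadratic form `‖A y‖²` of the rows seen so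
far is summarized by a sketch: `L` weighted vectors, where `L` is of order `(C / ε)²`. A new row
makes `L + 1` vectors, which are compressed to `L` again, as follows. In each of `L` rounds, power
iteration yields a vector `b` that maximizes the Rayleigh quotient up to a factor `2` and is almost
an eigenvector of the operator `T` of the form; splitting off its component turns it into the
direction `T b`. The `L` directions are almost orthogonal. What remains has a form bounded by its
maximal Rayleigh quotient `D`, and is dropped together with a part of size `D` of each of the
directions. So an error of order `D` in the form is paid for by a loss of order `L D` in the trace.
As the rows have total trace at most `n² C²`, the accumulated error in the form is of order
`n² C² / L`, which is small compared to `(ε n)²`.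

A best vector `v` of the final sketch then either certifies that `‖A‖ ≤ ε n`, or `‖A v‖` is at least
of order `ε n ‖v‖`. In the latter case a large cut is found from the signs of the entries of
`A Aᵀ A v`, because the rows and columns of `A` have norm at most `√n`.
-/

section LogConvex

variable {K : Type*} [Field K] [LinearOrder K] [IsStrictOrderedRing K] {μ : ℕ → K}

theorem pos_of_sq_le_mul (h0 : 0 < μ 0) (h1 : 0 < μ 1)
    (hμ : ∀ q, μ (q + 1) ^ 2 ≤ μ q * μ (q + 2)) (q : ℕ) : 0 < μ q := by
  suffices h : 0 < μ q ∧ 0 < μ (q + 1) from h.1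
  induction q with
  | zero => exact ⟨h0, h1⟩
  | succ q ih => exact ⟨ih.2, (pos_iff_pos_of_mul_pos ((pow_pos ih.2 2).trans_le (hμ q))).1 ih.1⟩

variable (hpos : ∀ q, 0 < μ q) (hμ : ∀ q, μ (q + 1) ^ 2 ≤ μ q * μ (q + 2))
include hpos hμ

theorem monotone_ratio : Monotone fun q => μ (q + 1) / μ q := by
  refine monotone_nat_of_le_succ fun q => ?_
  rw [div_le_div_iff₀ (hpos q) (hpos (q + 1)), ← sq, mul_comm]
  exact hμ q

theorem le_mul_ratio_pow (n : ℕ) {q : ℕ} (hq : q ≤ n) : μ q ≤ μ 0 * (μ (n + 1) / μ n) ^ q := by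
  induction q with
  | zero => simp
  | succ q ih =>
    have hle : μ (q + 1) / μ q ≤ μ (n + 1) / μ n :=
      monotone_ratio hpos hμ ((Nat.le_succ q).trans hq)
    calc μ (q + 1) ≤ μ (n + 1) / μ n * μ q := (div_le_iff₀ (hpos q)).1 hle
      _ ≤ μ (n + 1) / μ n * (μ 0 * (μ (n + 1) / μ n) ^ q) :=
        mul_le_mul_of_nonneg_left (ih (by omega)) (div_pos (hpos _) (hpos _)).le
      _ = μ 0 * (μ (n + 1) / μ n) ^ (q + 1) := by ring

theorem mul_ratio_pow_le (q : ℕ) : μ 0 * (μ 1 / μ 0) ^ q ≤ μ q := by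
  induction q with
  | zero => simp
  | succ q ih =>
    have hle : μ 1 / μ 0 ≤ μ (q + 1) / μ q := monotone_ratio hpos hμ (Nat.zero_le q)
    calc μ 0 * (μ 1 / μ 0) ^ (q + 1) = μ 1 / μ 0 * (μ 0 * (μ 1 / μ 0) ^ q) := by ring
      _ ≤ μ 1 / μ 0 * μ q := mul_le_mul_of_nonneg_left ih (div_pos (hpos _) (hpos _)).le
      _ ≤ μ (q + 1) := (le_div_iff₀ (hpos q)).1 hle

end LogConvex

theorem two_le_one_add_one_div_pow {N : ℕ} (hN : 0 < N) : 2 ≤ (1 + 1 / (N : ℝ)) ^ N := by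
  have h := one_add_mul_le_pow (a := 1 / (N : ℝ)) ((by norm_num : (-2 : ℝ) ≤ 0).trans
    (by positivity)) N
  rwa [mul_one_div_cancel (by positivity), one_add_one_eq_two] at h

section PositiveOperator

open scoped InnerProductSpace

variable {E : Type*} [NormedAddCommGroup E] [InnerProductSpace ℝ E]

theorem sq_real_inner_le (x y : E) : ⟪x, y⟫_ℝ ^ 2 ≤ ‖x‖ ^ 2 * ‖y‖ ^ 2 := by
  rw [← mul_pow, ← sq_abs]
  exact pow_le_pow_left₀ (abs_nonneg _) (abs_real_inner_le_norm x y) 2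

/-- The moment `⟪y, T ^ q y⟫` of order `q` of the operator `T` at `y`; for a positive operator
these are the moments of a measure, and in particular a log-convex sequence. -/
noncomputable def moment (T : E →ₗ[ℝ] E) (y : E) (q : ℕ) : ℝ := ⟪y, (T ^ q) y⟫_ℝ

variable {T : E →ₗ[ℝ] E} {x : E}

theorem moment_zero (T : E →ₗ[ℝ] E) (x : E) : moment T x 0 = ‖x‖ ^ 2 := by
  simp [moment]

theorem moment_one (T : E →ₗ[ℝ] E) (x : E) : moment T x 1 = ⟪x, T x⟫_ℝ := by
  simp [moment]

theorem inner_pow_apply_pow_apply (hT : T.IsSymmetric) (x y : E) (p q : ℕ) :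
    ⟪(T ^ p) x, (T ^ q) y⟫_ℝ = ⟪x, (T ^ (p + q)) y⟫_ℝ := by
  rw [hT.pow p, pow_add, Module.End.mul_apply]

theorem moment_two_mul (hT : T.IsSymmetric) (x : E) (q : ℕ) :
    moment T x (2 * q) = ‖(T ^ q) x‖ ^ 2 := by
  rw [← real_inner_self_eq_norm_sq, inner_pow_apply_pow_apply hT, moment, two_mul]

theorem moment_two_mul_add_one (hT : T.IsSymmetric) (x : E) (q : ℕ) :
    moment T x (2 * q + 1) = ⟪(T ^ q) x, T ((T ^ q) x)⟫_ℝ := by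
  rw [← Module.End.mul_apply, ← pow_succ', inner_pow_apply_pow_apply hT, moment, two_mul, add_assoc]

theorem sq_inner_apply_le (hT : T.IsPositive) (x y : E) :
    ⟪x, T y⟫_ℝ ^ 2 ≤ ⟪x, T x⟫_ℝ * ⟪y, T y⟫_ℝ := by
  refine LinearMap.BilinForm.apply_sq_le_of_symm ((innerₗ E).compl₂ T)
    (fun z => hT.inner_nonneg_right z) ⟨fun z w => ?_⟩ x y
  simp only [LinearMap.compl₂_apply, innerₗ_apply_apply, RingHom.id_apply]
  rw [← hT.isSymmetric, real_inner_comm]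

theorem apply_eq_zero_of_inner_eq_zero (hT : T.IsPositive) (hx : ⟪x, T x⟫_ℝ = 0) : T x = 0 := by
  have h := sq_inner_apply_le hT (T x) x
  rw [hx, mul_zero] at h
  exact inner_self_eq_zero.1 (pow_eq_zero_iff two_ne_zero |>.1 (h.antisymm (sq_nonneg _)))

theorem moment_sq_le (hT : T.IsPositive) (x : E) (q : ℕ) :
    moment T x (q + 1) ^ 2 ≤ moment T x q * moment T x (q + 2) := by
  obtain ⟨p, rfl | rfl⟩ := Nat.even_or_odd' q
  · rw [show 2 * p + 2 = 2 * (p + 1) by ring, moment_two_mul hT.isSymmetric,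
      moment_two_mul hT.isSymmetric, moment_two_mul_add_one hT.isSymmetric, pow_succ' _ p]
    exact sq_real_inner_le _ _
  · rw [show 2 * p + 1 + 2 = 2 * (p + 1) + 1 by ring, moment_two_mul_add_one hT.isSymmetric,
      moment_two_mul_add_one hT.isSymmetric]
    have hmid : moment T x (2 * p + 1 + 1) = ⟪(T ^ p) x, T ((T ^ (p + 1)) x)⟫_ℝ := by
      rw [← Module.End.mul_apply, ← pow_succ', inner_pow_apply_pow_apply hT.isSymmetric, moment]
      congr 3
      ring
    rw [hmid]
    exact sq_inner_apply_le hT _ _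

theorem moment_pos (hT : T.IsPositive) (hx : 0 < ⟪x, T x⟫_ℝ) (q : ℕ) : 0 < moment T x q := by
  refine pos_of_sq_le_mul ?_ (by rwa [moment_one]) (moment_sq_le hT x) q
  have : x ≠ 0 := by rintro rfl; simp at hx
  rw [moment_zero]
  positivity

theorem moment_nonneg (hT : T.IsPositive) (x : E) (q : ℕ) : 0 ≤ moment T x q := by
  obtain ⟨p, rfl | rfl⟩ := Nat.even_or_odd' q
  · rw [moment_two_mul hT.isSymmetric]; positivity
  · rw [moment_two_mul_add_one hT.isSymmetric]; exact hT.inner_nonneg_right _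

theorem moment_succ_eq_zero (hT : T.IsPositive) (hx : ⟪x, T x⟫_ℝ = 0) (q : ℕ) :
    moment T x (q + 1) = 0 := by
  rw [moment, pow_succ, Module.End.mul_apply, apply_eq_zero_of_inner_eq_zero hT hx, map_zero,
    inner_zero_right]

theorem mul_moment_le_pow (hT : T.IsPositive) {a r : ℝ} (ha : 0 ≤ a) (hr : 0 ≤ r)
    (hx : a * (‖x‖ ^ 2) ^ 2 ≤ ⟪x, T x⟫_ℝ) {q : ℕ} (h : moment T x (q + 1) ≤ r * moment T x q) :
    a * moment T x q ≤ r ^ (q + 1) := by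
  rcases (hT.inner_nonneg_right x).eq_or_lt' with h0 | hpos
  · rcases mul_eq_zero.1 ((hx.trans_eq h0).antisymm (by positivity)) with rfl | hx0
    · simpa using pow_nonneg hr (q + 1)
    · have : x = 0 := by simpa using hx0
      simpa [this, moment] using pow_nonneg hr (q + 1)
  have hμ := moment_pos hT hpos
  set ρ := moment T x (q + 1) / moment T x q
  have hρ0 : 0 ≤ ρ := (div_pos (hμ _) (hμ _)).le
  have hfirst : a * moment T x 0 ≤ ρ := by
    refine le_trans ?_ (monotone_ratio hμ (moment_sq_le hT x) (Nat.zero_le q))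
    rw [le_div_iff₀ (hμ 0), moment_zero, zero_add, moment_one, mul_assoc, ← sq]
    exact hx
  calc a * moment T x q ≤ a * (moment T x 0 * ρ ^ q) :=
        mul_le_mul_of_nonneg_left (le_mul_ratio_pow hμ (moment_sq_le hT x) q le_rfl) ha
    _ = a * moment T x 0 * ρ ^ q := by ring
    _ ≤ ρ * ρ ^ q := mul_le_mul_of_nonneg_right hfirst (by positivity)
    _ = ρ ^ (q + 1) := by ring
    _ ≤ r ^ (q + 1) := pow_le_pow_left₀ hρ0 ((div_le_iff₀ (hμ q)).2 h) _

/-- The angle between `x` and `T x` is small: its tangent is at most `1 / √η`. -/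
def Aligned (η : ℝ) (T : E →ₗ[ℝ] E) (x : E) : Prop :=
  η * (‖T x‖ ^ 2 * ‖x‖ ^ 2) ≤ (η + 1) * ⟪x, T x⟫_ℝ ^ 2

theorem ratio_mul_lt_of_not_aligned (hT : T.IsPositive) (hx : 0 < ⟪x, T x⟫_ℝ) {η : ℝ} (hη : 0 < η)
    {q : ℕ} (h : ¬Aligned η T ((T ^ q) x)) :
    moment T x (2 * q + 1) / moment T x (2 * q) * (1 + 1 / η) <
      moment T x (2 * (q + 1) + 1) / moment T x (2 * (q + 1)) := by
  have hμ := moment_pos hT hx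
  rw [Aligned, not_le, ← moment_two_mul_add_one hT.isSymmetric, ← moment_two_mul hT.isSymmetric,
    ← Module.End.mul_apply, ← pow_succ', ← moment_two_mul hT.isSymmetric] at h
  calc _ < moment T x (2 * (q + 1)) / moment T x (2 * q + 1) := by
        rw [show 1 + 1 / η = (η + 1) / η by field_simp, div_mul_div_comm,
          div_lt_div_iff₀ (mul_pos (hμ _) hη) (hμ _)]
        linarith
    _ ≤ _ := monotone_ratio hμ (moment_sq_le hT x) (show 2 * q + 1 ≤ 2 * (q + 1) by omega)

/-- If no iterate were aligned, the Rayleigh quotients would double on the way from the `N`-th to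
the `2 * N`-th one. -/
theorem exists_aligned_iterate (hT : T.IsPositive) (hx : 0 < ⟪x, T x⟫_ℝ) {η : ℝ} (hη : 0 < η)
    {N : ℕ} (hN : 2 ≤ (1 + 1 / η) ^ N)
    (hbound : ∀ y, ⟪y, T y⟫_ℝ ≤ 2 * (moment T x (2 * N + 1) / moment T x (2 * N)) * ‖y‖ ^ 2) :
    ∃ q, N ≤ q ∧ q < 2 * N ∧ Aligned η T ((T ^ q) x) := by
  by_contra! hnot
  have hμ := moment_pos hT hx
  have hgrow : ∀ j ≤ N, 1 ≤ j → moment T x (2 * N + 1) / moment T x (2 * N) * (1 + 1 / η) ^ j <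
      moment T x (2 * (N + j) + 1) / moment T x (2 * (N + j)) := by
    intro j hj hj1
    induction j, hj1 using Nat.le_induction with
    | base => simpa using ratio_mul_lt_of_not_aligned hT hx hη (hnot N le_rfl (by omega))
    | succ j hj1 ih =>
      refine lt_trans ?_ (ratio_mul_lt_of_not_aligned hT hx hη (hnot (N + j) (by omega) (by omega)))
      rw [pow_succ, ← mul_assoc]
      exact mul_lt_mul_of_pos_right (ih (by omega)) (by positivity)
  have hN1 : 1 ≤ N := by
    by_contra! h
    norm_num [Nat.lt_one_iff.1 h] at hN
  have hlast := hgrow N le_rfl hN1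
  have hle := hbound ((T ^ (N + N)) x)
  rw [← moment_two_mul_add_one hT.isSymmetric, ← moment_two_mul hT.isSymmetric,
    ← div_le_iff₀ (hμ _)] at hle
  have hge := mul_le_mul_of_nonneg_left hN (div_pos (hμ (2 * N + 1)) (hμ (2 * N))).le
  linarith

/-- The vectors `T ^ q y` with `y ∈ Y` and `q < N`. -/
def iterates (T : E →ₗ[ℝ] E) (Y : Set E) (N : ℕ) : Set E :=
  {z | ∃ y ∈ Y, ∃ q < N, z = (T ^ q) y}

theorem iterates_zero (T : E →ₗ[ℝ] E) (Y : Set E) : iterates T Y 0 = ∅ := by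
  simp [iterates]

theorem iterates_singleton_succ (T : E →ₗ[ℝ] E) (y : E) (N : ℕ) :
    iterates T {y} (N + 1) = insert ((T ^ N) y) (iterates T {y} N) := by
  ext z
  simp only [iterates, Set.mem_singleton_iff, exists_eq_left, Set.mem_ofPred_eq, Set.mem_insert_iff,
    Nat.exists_lt_succ_right, or_comm]

theorem iterates_insert (T : E →ₗ[ℝ] E) (y : E) (Y : Set E) (N : ℕ) :
    iterates T (insert y Y) N = iterates T {y} N ∪ iterates T Y N := by
  ext z
  simp [iterates]

/-- The vector `x`, with Rayleigh quotient `num / den`, has the largest Rayleigh quotient among the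
aligned vectors in `Z`.  The vector `x = 0`, with `num = 0` and `den = 1`, is allowed as well. -/
structure IsBest (η : ℝ) (T : E →ₗ[ℝ] E) (Z : Set E) (x : E) (num den : ℝ) : Prop where
  num_eq : num = ⟪x, T x⟫_ℝ
  den_pos : 0 < den
  eq_zero_or : x = 0 ∨ 0 < num ∧ den = ‖x‖ ^ 2 ∧ Aligned η T x
  le : ∀ z ∈ Z, Aligned η T z → ⟪z, T z⟫_ℝ * den ≤ num * ‖z‖ ^ 2

namespace IsBest

variable {η num den : ℝ} {Z : Set E} {z : E}

theorem empty (η : ℝ) (T : E →ₗ[ℝ] E) : IsBest η T ∅ 0 0 1 where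
  num_eq := by simp
  den_pos := one_pos
  eq_zero_or := .inl rfl
  le := by simp

theorem num_nonneg (h : IsBest η T Z x num den) : 0 ≤ num := by
  rcases h.eq_zero_or with hx | ⟨hnum, -⟩
  · rw [h.num_eq, hx, inner_zero_left]
  · exact hnum.le

theorem num_mul_norm_sq (h : IsBest η T Z x num den) : num * ‖x‖ ^ 2 = ⟪x, T x⟫_ℝ * den := by
  rcases h.eq_zero_or with hx | ⟨-, hden, -⟩
  · simp [hx]
  · rw [hden, h.num_eq]

theorem insert_of_lt (h : IsBest η T Z x num den) (hal : Aligned η T z)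
    (hlt : num * ‖z‖ ^ 2 < ⟪z, T z⟫_ℝ * den) :
    IsBest η T (insert z Z) z ⟪z, T z⟫_ℝ (‖z‖ ^ 2) := by
  have hpos : 0 < ⟪z, T z⟫_ℝ := pos_of_mul_pos_left
    ((mul_nonneg h.num_nonneg (by positivity)).trans_lt hlt) h.den_pos.le
  have hz : z ≠ 0 := by rintro rfl; simp at hpos
  refine ⟨rfl, by positivity, .inr ⟨hpos, rfl, hal⟩, ?_⟩
  rintro w (rfl | hw) hwal
  · exact le_rfl
  · have hle := h.le w hw hwal
    refine le_of_mul_le_mul_right ?_ h.den_pos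
    calc ⟪w, T w⟫_ℝ * ‖z‖ ^ 2 * den = ⟪w, T w⟫_ℝ * den * ‖z‖ ^ 2 := by ring
      _ ≤ num * ‖w‖ ^ 2 * ‖z‖ ^ 2 := by gcongr
      _ = num * ‖z‖ ^ 2 * ‖w‖ ^ 2 := by ring
      _ ≤ ⟪z, T z⟫_ℝ * den * ‖w‖ ^ 2 := by gcongr
      _ = ⟪z, T z⟫_ℝ * ‖w‖ ^ 2 * den := by ring

theorem insert_of_not_lt (h : IsBest η T Z x num den)
    (hz : Aligned η T z → ⟪z, T z⟫_ℝ * den ≤ num * ‖z‖ ^ 2) :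
    IsBest η T (insert z Z) x num den :=
  { h with le := by rintro w (rfl | hw); exacts [hz, h.le w hw] }

end IsBest

end PositiveOperator

section Gram

open Finset
open scoped InnerProductSpace

variable {ι E : Type*} [NormedAddCommGroup E] [InnerProductSpace ℝ E]

/-- The quadratic form `∑ k ∈ s, c k * ⟪v k, ·⟫ ^ 2` of a family of weighted vectors. -/
noncomputable def gramForm (s : Finset ι) (c : ι → ℝ) (v : ι → E) (y : E) : ℝ :=
  ∑ k ∈ s, c k * ⟪v k, y⟫_ℝ ^ 2

/-- The trace of the quadratic form `gramForm s c v`. -/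
noncomputable def gramTrace (s : Finset ι) (c : ι → ℝ) (v : ι → E) : ℝ :=
  ∑ k ∈ s, c k * ‖v k‖ ^ 2

/-- The operator that represents the quadratic form `gramForm s c v`. -/
noncomputable def gramOp (s : Finset ι) (c : ι → ℝ) (v : ι → E) : E →ₗ[ℝ] E :=
  ∑ k ∈ s, c k • (innerₛₗ ℝ (v k)).smulRight (v k)

variable {s : Finset ι} {c : ι → ℝ} {v : ι → E}

theorem gramOp_apply (s : Finset ι) (c : ι → ℝ) (v : ι → E) (y : E) :
    gramOp s c v y = ∑ k ∈ s, (c k * ⟪v k, y⟫_ℝ) • v k := by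
  simp [gramOp, smul_smul]

theorem inner_gramOp (s : Finset ι) (c : ι → ℝ) (v : ι → E) (x y : E) :
    ⟪x, gramOp s c v y⟫_ℝ = ∑ k ∈ s, c k * ⟪v k, x⟫_ℝ * ⟪v k, y⟫_ℝ := by
  rw [gramOp_apply, inner_sum]
  refine sum_congr rfl fun k _ => ?_
  rw [inner_smul_right, real_inner_comm (v k) x]
  ring

theorem inner_gramOp_self (s : Finset ι) (c : ι → ℝ) (v : ι → E) (x : E) :
    ⟪x, gramOp s c v x⟫_ℝ = gramForm s c v x := by
  rw [inner_gramOp]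
  exact sum_congr rfl fun k _ => by ring

theorem gramForm_congr {c' : ι → ℝ} {v' : ι → E} (hc : ∀ k ∈ s, c' k = c k)
    (hv : ∀ k ∈ s, v' k = v k) (y : E) : gramForm s c' v' y = gramForm s c v y :=
  sum_congr rfl fun k hk => by rw [hc k hk, hv k hk]

omit [InnerProductSpace ℝ E] in
theorem gramTrace_congr {c' : ι → ℝ} {v' : ι → E} (hc : ∀ k ∈ s, c' k = c k)
    (hv : ∀ k ∈ s, v' k = v k) : gramTrace s c' v' = gramTrace s c v :=
  sum_congr rfl fun k hk => by rw [hc k hk, hv k hk]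

theorem gramForm_nonneg (hc : ∀ k ∈ s, 0 ≤ c k) (y : E) : 0 ≤ gramForm s c v y :=
  sum_nonneg fun k hk => mul_nonneg (hc k hk) (sq_nonneg _)

omit [InnerProductSpace ℝ E] in
theorem gramTrace_nonneg (hc : ∀ k ∈ s, 0 ≤ c k) : 0 ≤ gramTrace s c v :=
  sum_nonneg fun k hk => mul_nonneg (hc k hk) (sq_nonneg _)

theorem gramOp_isPositive (hc : ∀ k ∈ s, 0 ≤ c k) : (gramOp s c v).IsPositive := by
  refine ⟨fun x y => ?_, fun x => ?_⟩
  · rw [real_inner_comm, inner_gramOp, inner_gramOp]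
    exact sum_congr rfl fun k _ => by ring
  · rw [real_inner_comm, inner_gramOp_self]
    exact gramForm_nonneg hc x

theorem coeff_mul_moment_le (hc : ∀ k ∈ s, 0 ≤ c k) {k : ι} (hk : k ∈ s) {r : ℝ} (hr : 0 ≤ r)
    {q : ℕ} (h : moment (gramOp s c v) (v k) (q + 1) ≤ r * moment (gramOp s c v) (v k) q) :
    c k * moment (gramOp s c v) (v k) q ≤ r ^ (q + 1) := by
  refine mul_moment_le_pow (gramOp_isPositive hc) (hc k hk) hr ?_ h
  rw [inner_gramOp_self, ← real_inner_self_eq_norm_sq]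
  exact single_le_sum (f := fun l => c l * ⟪v l, v k⟫_ℝ ^ 2)
    (fun l hl => mul_nonneg (hc l hl) (sq_nonneg _)) hk

theorem moment_odd_le (hc : ∀ k ∈ s, 0 ≤ c k) (y : E) (q : ℕ) :
    moment (gramOp s c v) y (2 * q + 1) ≤
      ‖y‖ ^ 2 * ∑ k ∈ s, c k * moment (gramOp s c v) (v k) (2 * q) := by
  have hT := (gramOp_isPositive (v := v) hc).isSymmetric
  rw [moment_two_mul_add_one hT, inner_gramOp_self, gramForm, mul_sum]
  refine sum_le_sum fun k hk => ?_
  rw [← hT.pow q, moment_two_mul hT]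
  calc c k * ⟪(gramOp s c v ^ q) (v k), y⟫_ℝ ^ 2
      ≤ c k * (‖(gramOp s c v ^ q) (v k)‖ ^ 2 * ‖y‖ ^ 2) :=
        mul_le_mul_of_nonneg_left (sq_real_inner_le _ _) (hc k hk)
    _ = _ := by ring

/-- By log-convexity, `(⟪y, T y⟫ / ‖y‖ ^ 2) ^ (2 * q + 1)` is bounded by the moment of order
`2 * q + 1`, and the vectors `v k` together dominate that moment. -/
theorem gramForm_le_of_moment_le (hc : ∀ k ∈ s, 0 ≤ c k) {q : ℕ} (hs : #s ≤ 2 ^ (2 * q + 1))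
    {r : ℝ} (hr : 0 ≤ r)
    (h : ∀ k ∈ s, moment (gramOp s c v) (v k) (2 * q + 1) ≤
      r * moment (gramOp s c v) (v k) (2 * q)) (y : E) :
    gramForm s c v y ≤ 2 * r * ‖y‖ ^ 2 := by
  have hT := gramOp_isPositive (v := v) hc
  rw [← inner_gramOp_self]
  rcases (hT.inner_nonneg_right y).eq_or_lt' with h0 | hpos
  · rw [h0]; positivity
  have hμ := moment_pos hT hpos
  have hsum : ∑ k ∈ s, c k * moment (gramOp s c v) (v k) (2 * q) ≤ (2 * r) ^ (2 * q + 1) :=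
    calc _ ≤ ∑ _k ∈ s, r ^ (2 * q + 1) :=
          sum_le_sum fun k hk => coeff_mul_moment_le hc hk hr (h k hk)
      _ = #s * r ^ (2 * q + 1) := by rw [sum_const, nsmul_eq_mul]
      _ ≤ 2 ^ (2 * q + 1) * r ^ (2 * q + 1) := by gcongr; exact_mod_cast hs
      _ = (2 * r) ^ (2 * q + 1) := (mul_pow ..).symm
  have hpow : (moment (gramOp s c v) y 1 / moment (gramOp s c v) y 0) ^ (2 * q + 1) ≤
      (2 * r) ^ (2 * q + 1) := by
    refine le_of_mul_le_mul_left ?_ (hμ 0)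
    calc _ ≤ moment (gramOp s c v) y (2 * q + 1) := mul_ratio_pow_le hμ (moment_sq_le hT y) _
      _ ≤ _ := moment_odd_le hc y q
      _ ≤ _ := by rw [moment_zero]; exact mul_le_mul_of_nonneg_left hsum (by positivity)
  have hratio := (pow_le_pow_iff_left₀ (div_pos (hμ 1) (hμ 0)).le (by positivity) (by omega)).1 hpow
  rwa [div_le_iff₀ (hμ 0), moment_zero, moment_one] at hratio

theorem exists_gramForm_le_ratio (hc : ∀ k ∈ s, 0 ≤ c k) {q : ℕ} (hs : #s ≤ 2 ^ (2 * q + 1))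
    (hs0 : s.Nonempty) :
    ∃ i ∈ s, ∀ y, gramForm s c v y ≤ 2 * (moment (gramOp s c v) (v i) (2 * q + 1) /
      moment (gramOp s c v) (v i) (2 * q)) * ‖y‖ ^ 2 := by
  have hT := gramOp_isPositive (v := v) hc
  obtain ⟨i, hi, hmax⟩ := exists_max_image s
    (fun k => moment (gramOp s c v) (v k) (2 * q + 1) / moment (gramOp s c v) (v k) (2 * q)) hs0
  have hr := div_nonneg (moment_nonneg hT (v i) (2 * q + 1)) (moment_nonneg hT (v i) (2 * q))
  refine ⟨i, hi, gramForm_le_of_moment_le hc hs hr fun k hk => ?_⟩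
  rcases (hT.inner_nonneg_right (v k)).eq_or_lt' with h0 | hpos
  · rw [moment_succ_eq_zero hT h0]
    exact mul_nonneg hr (moment_nonneg hT _ _)
  · exact (div_le_iff₀ (moment_pos hT hpos _)).1 (hmax k hk)

theorem IsBest.gramForm_le (hc : ∀ k ∈ s, 0 ≤ c k) {η : ℝ} (hη : 0 < η) {N : ℕ}
    (hN : 2 ≤ (1 + 1 / η) ^ N) (hs : #s ≤ 2 ^ (2 * N + 1)) {x : E} {num den : ℝ}
    (h : IsBest η (gramOp s c v) (iterates (gramOp s c v) (v '' s) (2 * N)) x num den) (y : E) :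
    gramForm s c v y * den ≤ 2 * num * ‖y‖ ^ 2 := by
  have hT := gramOp_isPositive (v := v) hc
  have hnum := h.num_nonneg
  have hden := h.den_pos
  rcases s.eq_empty_or_nonempty with rfl | hs0
  · simpa [gramForm] using by positivity
  obtain ⟨i, hi, hbound⟩ := exists_gramForm_le_ratio (v := v) hc hs hs0
  set r := moment (gramOp s c v) (v i) (2 * N + 1) / moment (gramOp s c v) (v i) (2 * N)
  suffices hr : r * den ≤ num by
    calc gramForm s c v y * den ≤ 2 * r * ‖y‖ ^ 2 * den := by gcongr; exact hbound y
      _ = 2 * (r * den) * ‖y‖ ^ 2 := by ring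
      _ ≤ 2 * num * ‖y‖ ^ 2 := by gcongr
  rcases (hT.inner_nonneg_right (v i)).eq_or_lt' with h0 | hpos
  · simpa [r, moment_succ_eq_zero hT h0] using hnum
  obtain ⟨q, hNq, hq, hal⟩ := exists_aligned_iterate hT hpos hη hN fun z => by
    rw [inner_gramOp_self]
    exact hbound z
  have hle := h.le _ ⟨v i, ⟨i, hi, rfl⟩, q, hq, rfl⟩ hal
  have hμ := moment_pos hT hpos
  rw [← moment_two_mul_add_one hT.isSymmetric, ← moment_two_mul hT.isSymmetric] at hle
  have hmono : r ≤ _ := monotone_ratio hμ (moment_sq_le hT (v i)) (show 2 * N ≤ 2 * q by omega)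
  refine le_trans (mul_le_mul_of_nonneg_right hmono hden.le) ?_
  rwa [div_mul_eq_mul_div, div_le_iff₀ (hμ _)]

end Gram

section Deflation

open Finset
open scoped InnerProductSpace

variable {ι E : Type*} [NormedAddCommGroup E] [InnerProductSpace ℝ E]

theorem sq_inner_mul_norm_sq_le_of_orthogonal {x z : E} (hz : ⟪x, z⟫_ℝ = 0) (u : E) :
    ⟪u, z⟫_ℝ ^ 2 * ‖x‖ ^ 2 ≤ (‖u‖ ^ 2 * ‖x‖ ^ 2 - ⟪x, u⟫_ℝ ^ 2) * ‖z‖ ^ 2 := by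
  rcases eq_or_ne x 0 with rfl | hx
  · simp
  have hcs := sq_real_inner_le (‖x‖ ^ 2 • u - ⟪x, u⟫_ℝ • x) z
  rw [norm_sub_sq_real, norm_smul, norm_smul, inner_sub_left, real_inner_smul_left,
    real_inner_smul_left, hz, real_inner_smul_left, real_inner_smul_right, real_inner_comm x u,
    Real.norm_eq_abs, Real.norm_eq_abs, mul_pow, mul_pow, sq_abs, sq_abs] at hcs
  refine le_of_mul_le_mul_right ?_ (show 0 < ‖x‖ ^ 2 by positivity)
  linarith

theorem Aligned.sq_inner_le {η : ℝ} (hη : 0 ≤ η) {T : E →ₗ[ℝ] E} {x z : E} (h : Aligned η T x)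
    (hz : ⟪x, z⟫_ℝ = 0) : η * ⟪T x, z⟫_ℝ ^ 2 ≤ ‖T x‖ ^ 2 * ‖z‖ ^ 2 := by
  rcases eq_or_ne x 0 with rfl | hx
  · simp
  refine le_of_mul_le_mul_right ?_ (show 0 < ‖x‖ ^ 2 by positivity)
  have hangle : η * (‖T x‖ ^ 2 * ‖x‖ ^ 2 - ⟪x, T x⟫_ℝ ^ 2) ≤ ‖T x‖ ^ 2 * ‖x‖ ^ 2 := by
    rw [Aligned] at h
    linarith [sq_real_inner_le x (T x)]
  calc η * ⟪T x, z⟫_ℝ ^ 2 * ‖x‖ ^ 2 = η * (⟪T x, z⟫_ℝ ^ 2 * ‖x‖ ^ 2) := by ring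
    _ ≤ η * ((‖T x‖ ^ 2 * ‖x‖ ^ 2 - ⟪x, T x⟫_ℝ ^ 2) * ‖z‖ ^ 2) :=
      mul_le_mul_of_nonneg_left (sq_inner_mul_norm_sq_le_of_orthogonal hz _) hη
    _ = η * (‖T x‖ ^ 2 * ‖x‖ ^ 2 - ⟪x, T x⟫_ℝ ^ 2) * ‖z‖ ^ 2 := by ring
    _ ≤ ‖T x‖ ^ 2 * ‖x‖ ^ 2 * ‖z‖ ^ 2 := by gcongr
    _ = ‖T x‖ ^ 2 * ‖z‖ ^ 2 * ‖x‖ ^ 2 := by ring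

/-- Deflation of the vector `z` along `x`: for the vectors of a Gram operator `T`, this splits the
form `⟪x, T x⟫⁻¹ * ⟪T x, ·⟫ ^ 2` off.  For `⟪x, T x⟫ = 0` it leaves `z` unchanged. -/
noncomputable def deflate (T : E →ₗ[ℝ] E) (x z : E) : E := z - (⟪z, x⟫_ℝ * (⟪x, T x⟫_ℝ)⁻¹) • T x

variable {s : Finset ι} {c : ι → ℝ} {v : ι → E}

theorem sum_bilin_deflate (s : Finset ι) (c : ι → ℝ) (v : ι → E) {B : LinearMap.BilinForm ℝ E}
    (hB : B.IsSymm) (x : E) {u : E} (hu : u = gramOp s c v x) :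
    ∑ k ∈ s, c k * B (deflate (gramOp s c v) x (v k)) (deflate (gramOp s c v) x (v k)) +
      (⟪x, u⟫_ℝ)⁻¹ * B u u = ∑ k ∈ s, c k * B (v k) (v k) := by
  have hxu : ∑ k ∈ s, c k * ⟪v k, x⟫_ℝ ^ 2 = ⟪x, u⟫_ℝ := by rw [hu, inner_gramOp_self, gramForm]
  have huu : ∑ k ∈ s, c k * ⟪v k, x⟫_ℝ * B (v k) u = B u u := by
    nth_rewrite 2 [hu]
    simp [gramOp_apply, map_sum, LinearMap.sum_apply]
  set r : ℝ := (⟪x, u⟫_ℝ)⁻¹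
  have hexpand : ∑ k ∈ s, c k * B (deflate (gramOp s c v) x (v k))
      (deflate (gramOp s c v) x (v k)) =
        ∑ k ∈ s, c k * B (v k) (v k) - 2 * r * B u u + r ^ 2 * B u u * ⟪x, u⟫_ℝ := by
    rw [← hxu, ← huu, mul_sum, mul_sum s, ← sum_sub_distrib, ← sum_add_distrib, huu]
    refine sum_congr rfl fun k _ => ?_
    simp only [deflate, ← hu, map_sub, map_smul, LinearMap.sub_apply, LinearMap.smul_apply,
      smul_eq_mul, hB.eq u (v k), r]
    ring
  rw [hexpand]
  by_cases h0 : ⟪x, u⟫_ℝ = 0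
  · simp [r, h0]
  · simp only [r]
    field_simp
    ring

theorem gramForm_deflate (s : Finset ι) (c : ι → ℝ) (v : ι → E) (x y : E) :
    gramForm s c (fun k => deflate (gramOp s c v) x (v k)) y +
      (⟪x, gramOp s c v x⟫_ℝ)⁻¹ * ⟪gramOp s c v x, y⟫_ℝ ^ 2 = gramForm s c v y := by
  have h := sum_bilin_deflate s c v (B := LinearMap.BilinForm.linMulLin (innerₗ E y) (innerₗ E y))
    ⟨fun z w => by simp [mul_comm]⟩ x rfl
  simpa only [gramForm, LinearMap.BilinForm.linMulLin_apply, innerₗ_apply_apply, ← sq,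
    real_inner_comm _ y] using h

theorem gramTrace_deflate (s : Finset ι) (c : ι → ℝ) (v : ι → E) (x : E) :
    gramTrace s c (fun k => deflate (gramOp s c v) x (v k)) +
      (⟪x, gramOp s c v x⟫_ℝ)⁻¹ * ‖gramOp s c v x‖ ^ 2 = gramTrace s c v := by
  have h := sum_bilin_deflate s c v (B := innerₗ E) ⟨fun z w => by simp [real_inner_comm]⟩ x rfl
  simpa only [gramTrace, innerₗ_apply_apply, real_inner_self_eq_norm_sq] using h

theorem inner_deflate_eq_zero {T : E →ₗ[ℝ] E} {x : E} (hx : ⟪x, T x⟫_ℝ ≠ 0) (z : E) :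
    ⟪x, deflate T x z⟫_ℝ = 0 := by
  rw [deflate, inner_sub_right, real_inner_smul_right, real_inner_comm, mul_assoc,
    inv_mul_cancel₀ hx, mul_one, sub_self]

theorem gramOp_mem_span (s : Finset ι) (c : ι → ℝ) (v : ι → E) (x : E) :
    gramOp s c v x ∈ Submodule.span ℝ (v '' s) := by
  rw [gramOp_apply]
  exact Submodule.sum_smul_mem _ _ fun k hk => Submodule.subset_span ⟨k, hk, rfl⟩

theorem span_deflate_le (s : Finset ι) (c : ι → ℝ) (v : ι → E) (x : E) :
    Submodule.span ℝ ((fun k => deflate (gramOp s c v) x (v k)) '' s) ≤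
      Submodule.span ℝ (v '' s) := by
  rw [Submodule.span_le]
  rintro _ ⟨k, hk, rfl⟩
  exact Submodule.sub_mem _ (Submodule.subset_span ⟨k, hk, rfl⟩)
    (Submodule.smul_mem _ _ (gramOp_mem_span s c v x))

theorem IsBest.sq_inner_le_of_mem_span_deflate {η : ℝ} (hη : 0 ≤ η) {Z : Set E} {x z : E}
    {num den : ℝ} (h : IsBest η (gramOp s c v) Z x num den)
    (hz : z ∈ Submodule.span ℝ ((fun k => deflate (gramOp s c v) x (v k)) '' s)) :
    η * ⟪gramOp s c v x, z⟫_ℝ ^ 2 ≤ ‖gramOp s c v x‖ ^ 2 * ‖z‖ ^ 2 := by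
  rcases h.eq_zero_or with rfl | ⟨hnum, -, hal⟩
  · simp
  have horth : Submodule.span ℝ ((fun k => deflate (gramOp s c v) x (v k)) '' s) ≤
      (ℝ ∙ x)ᗮ := by
    rw [Submodule.span_le]
    rintro _ ⟨k, -, rfl⟩
    exact Submodule.mem_orthogonal_singleton_iff_inner_right.2
      (inner_deflate_eq_zero (h.num_eq ▸ hnum.ne') _)
  exact hal.sq_inner_le hη (Submodule.mem_orthogonal_singleton_iff_inner_right.1 (horth hz))

theorem IsBest.div_le {η : ℝ} {T : E →ₗ[ℝ] E} {Z : Set E} {x : E} {num den : ℝ}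
    (h : IsBest η T Z x num den) : num / den ≤ num⁻¹ * ‖T x‖ ^ 2 := by
  rcases h.eq_zero_or with rfl | ⟨hnum, hden, -⟩
  · simp [h.num_eq]
  rw [div_le_iff₀ h.den_pos, hden, mul_assoc, ← div_eq_inv_mul, le_div_iff₀ hnum, ← sq, h.num_eq,
    mul_comm (‖T x‖ ^ 2)]
  exact sq_real_inner_le x (T x)

/-- The situation after `j` rounds of deflation: the forms `e t * ⟪u t, ·⟫ ^ 2`, `t < j`, have been
split off from the form of the vectors `v₀`, with weights `c`, and the vectors `v` are left.  The
fields `aligned` and `near` say that the `u t` are almost orthogonal to what is left and to each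
other; by `small`, none of the forms split off is small compared to what is left. -/
structure Deflated (η : ℝ) (s : Finset ι) (c : ι → ℝ) (v₀ : ι → E) (j : ℕ) (v : ι → E)
    (u : ℕ → E) (e : ℕ → ℝ) : Prop where
  form (y : E) : gramForm s c v y + gramForm (range j) e u y = gramForm s c v₀ y
  trace : gramTrace s c v + gramTrace (range j) e u = gramTrace s c v₀
  coeff_nonneg : ∀ t < j, 0 ≤ e t
  aligned : ∀ t < j, ∀ z ∈ Submodule.span ℝ (v '' s), η * ⟪u t, z⟫_ℝ ^ 2 ≤ ‖u t‖ ^ 2 * ‖z‖ ^ 2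
  near : ∀ t < j, ∀ i < t, η * ⟪u i, u t⟫_ℝ ^ 2 ≤ ‖u i‖ ^ 2 * ‖u t‖ ^ 2
  small : ∀ t < j, ∀ y, gramForm s c v y ≤ 2 * (e t * ‖u t‖ ^ 2) * ‖y‖ ^ 2

namespace Deflated

variable {η : ℝ} {v₀ : ι → E} {j : ℕ} {u : ℕ → E} {e : ℕ → ℝ}

theorem zero (η : ℝ) (s : Finset ι) (c : ι → ℝ) (v₀ : ι → E) (u : ℕ → E) (e : ℕ → ℝ) :
    Deflated η s c v₀ 0 v₀ u e where
  form y := by simp [gramForm]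
  trace := by simp [gramTrace]
  coeff_nonneg := by simp
  aligned := by simp
  near := by simp
  small := by simp

theorem congr (h : Deflated η s c v₀ j v u e) {v' : ι → E} {u' : ℕ → E} {e' : ℕ → ℝ}
    (hv : ∀ k ∈ s, v' k = v k) (hu : ∀ t < j, u' t = u t) (he : ∀ t < j, e' t = e t) :
    Deflated η s c v₀ j v' u' e' where
  form y := by
    rw [gramForm_congr (fun _ _ => rfl) hv, ← h.form y]
    congr 1
    exact gramForm_congr (fun t ht => he t (mem_range.1 ht)) (fun t ht => hu t (mem_range.1 ht)) y
  trace := by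
    rw [gramTrace_congr (fun _ _ => rfl) hv, ← h.trace]
    congr 1
    exact gramTrace_congr (fun t ht => he t (mem_range.1 ht)) fun t ht => hu t (mem_range.1 ht)
  coeff_nonneg t ht := he t ht ▸ h.coeff_nonneg t ht
  aligned t ht z hz := hu t ht ▸ h.aligned t ht z (Set.image_congr hv ▸ hz)
  near t ht i hi := hu t ht ▸ hu i (hi.trans ht) ▸ h.near t ht i hi
  small t ht y := by
    rw [gramForm_congr (fun _ _ => rfl) hv, hu t ht, he t ht]
    exact h.small t ht y

theorem succ (hη : 0 ≤ η) (h : Deflated η s c v₀ j v u e) {Z : Set E} {x : E} {num den : ℝ}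
    (hb : IsBest η (gramOp s c v) Z x num den)
    (hle : ∀ y, gramForm s c v y * den ≤ 2 * num * ‖y‖ ^ 2)
    (hu : u j = gramOp s c v x) (he : e j = num⁻¹) :
    Deflated η s c v₀ (j + 1) (fun k => deflate (gramOp s c v) x (v k)) u e := by
  have he0 : 0 ≤ e j := he ▸ inv_nonneg.2 hb.num_nonneg
  have hform (y : E) : gramForm s c (fun k => deflate (gramOp s c v) x (v k)) y +
      e j * ⟪u j, y⟫_ℝ ^ 2 = gramForm s c v y := by
    rw [← gramForm_deflate s c v x y, hu, he, hb.num_eq]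
  have hmono (y : E) : gramForm s c (fun k => deflate (gramOp s c v) x (v k)) y ≤
      gramForm s c v y :=
    (hform y).symm ▸ le_add_of_nonneg_right (mul_nonneg he0 (sq_nonneg _))
  refine ⟨fun y => ?_, ?_, fun t ht => ?_, fun t ht z hz => ?_, fun t ht i hi => ?_,
    fun t ht y => (hmono y).trans ?_⟩
  · rw [gramForm.eq_1 (range _), sum_range_succ, ← h.form y, ← hform y, gramForm.eq_1 (range _)]
    ring
  · rw [gramTrace.eq_1 (range _), sum_range_succ, ← h.trace, ← gramTrace_deflate s c v x,
      gramTrace.eq_1 (range _), hu, he, hb.num_eq]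
    ring
  · rcases Nat.lt_succ_iff_lt_or_eq.1 ht with ht | rfl
    exacts [h.coeff_nonneg t ht, he0]
  · rcases Nat.lt_succ_iff_lt_or_eq.1 ht with ht | rfl
    · exact h.aligned t ht z (span_deflate_le s c v x hz)
    · exact hu ▸ hb.sq_inner_le_of_mem_span_deflate hη hz
  · rcases Nat.lt_succ_iff_lt_or_eq.1 ht with ht | rfl
    · exact h.near t ht i hi
    · exact hu ▸ h.aligned i hi _ (gramOp_mem_span s c v x)
  · rcases Nat.lt_succ_iff_lt_or_eq.1 ht with ht | rfl
    · exact h.small t ht y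
    · calc gramForm s c v y ≤ 2 * num * ‖y‖ ^ 2 / den := (le_div_iff₀ hb.den_pos).2 (hle y)
        _ = 2 * (num / den) * ‖y‖ ^ 2 := by ring
        _ ≤ 2 * (e t * ‖u t‖ ^ 2) * ‖y‖ ^ 2 := by
          rw [he, hu]
          gcongr
          exact hb.div_le

theorem div_le (h : Deflated η s c v₀ j v u e) {Z : Set E} {x : E} {num den : ℝ}
    (hb : IsBest η (gramOp s c v) Z x num den) {t : ℕ} (ht : t < j) :
    num / den ≤ 2 * (e t * ‖u t‖ ^ 2) := by
  rcases hb.eq_zero_or with hx | ⟨-, hden, -⟩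
  · rw [hb.num_eq, hx, inner_zero_left, zero_div]
    have := h.coeff_nonneg t ht
    positivity
  · rw [div_le_iff₀ hb.den_pos, hb.num_eq, inner_gramOp_self, hden]
    exact h.small t ht x

end Deflated

theorem card_mul_norm_sq_sum_smul_le {s : Finset ι} {z : ι → E} (hz : ∀ i ∈ s, ‖z i‖ ≤ 1)
    (hzz : ∀ i ∈ s, ∀ t ∈ s, i ≠ t → #s * |⟪z i, z t⟫_ℝ| ≤ 1) (a : ι → ℝ) :
    #s * ‖∑ t ∈ s, a t • z t‖ ^ 2 ≤ #s * (2 * ∑ t ∈ s, a t ^ 2) := by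
  classical
  have hpair (i : ι) (hi : i ∈ s) (t : ι) (ht : t ∈ s) :
      #s * (a i * a t * ⟪z i, z t⟫_ℝ) ≤ (if i = t then #s * a i ^ 2 else 0) + |a i| * |a t| := by
    split_ifs with hit
    · subst hit
      rw [real_inner_self_eq_norm_sq, ← sq]
      refine le_add_of_le_of_nonneg ?_ (by positivity)
      gcongr
      exact mul_le_of_le_one_right (sq_nonneg _) (pow_le_one₀ (norm_nonneg _) (hz i hi))
    · rw [zero_add, ← abs_mul]
      calc #s * (a i * a t * ⟪z i, z t⟫_ℝ) ≤ |#s * (a i * a t * ⟪z i, z t⟫_ℝ)| := le_abs_self _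
        _ = |a i * a t| * (#s * |⟪z i, z t⟫_ℝ|) := by simp only [abs_mul, Nat.abs_cast]; ring
        _ ≤ |a i * a t| := mul_le_of_le_one_right (abs_nonneg _) (hzz i hi t ht hit)
  calc #s * ‖∑ t ∈ s, a t • z t‖ ^ 2 = ∑ i ∈ s, ∑ t ∈ s, #s * (a i * a t * ⟪z i, z t⟫_ℝ) := by
        simp only [← real_inner_self_eq_norm_sq, sum_inner, mul_sum]
        refine sum_congr rfl fun i _ => ?_
        simp only [inner_sum, real_inner_smul_left, real_inner_smul_right, mul_sum, mul_assoc,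
          mul_left_comm (a _) (a i)]
    _ ≤ ∑ i ∈ s, ∑ t ∈ s, ((if i = t then #s * a i ^ 2 else 0) + |a i| * |a t|) :=
        sum_le_sum fun i hi => sum_le_sum fun t ht => hpair i hi t ht
    _ = #s * ∑ t ∈ s, a t ^ 2 + (∑ t ∈ s, |a t|) ^ 2 := by
        simp only [sum_add_distrib, sq (∑ t ∈ s, |a t|), sum_mul_sum]
        rw [mul_sum]
        congr 1
        exact sum_congr rfl fun i hi => by rw [sum_ite_eq, if_pos hi]
    _ ≤ #s * ∑ t ∈ s, a t ^ 2 + #s * ∑ t ∈ s, |a t| ^ 2 := by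
        gcongr; exact sq_sum_le_card_mul_sum_sq
    _ = #s * (2 * ∑ t ∈ s, a t ^ 2) := by simp only [sq_abs]; ring

theorem gramForm_inv_norm_sq_le {s : Finset ι} {u : ι → E}
    (hu : ∀ i ∈ s, ∀ t ∈ s, i ≠ t → #s * |⟪u i, u t⟫_ℝ| ≤ ‖u i‖ * ‖u t‖) (y : E) :
    gramForm s (fun t => (‖u t‖ ^ 2)⁻¹) u y ≤ 2 * ‖y‖ ^ 2 := by
  rcases s.eq_empty_or_nonempty with rfl | hs
  · simp [gramForm]
  set a : ι → ℝ := fun t => ‖u t‖⁻¹ * ⟪u t, y⟫_ℝ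
  have hform : gramForm s (fun t => (‖u t‖ ^ 2)⁻¹) u y = ∑ t ∈ s, a t ^ 2 :=
    sum_congr rfl fun t _ => by simp only [a]; ring
  have hinner : ⟪∑ t ∈ s, a t • ‖u t‖⁻¹ • u t, y⟫_ℝ = ∑ t ∈ s, a t ^ 2 := by
    simp only [a, sum_inner, real_inner_smul_left, sq]
  have hnorm : ‖∑ t ∈ s, a t • ‖u t‖⁻¹ • u t‖ ^ 2 ≤ 2 * ∑ t ∈ s, a t ^ 2 := by
    refine le_of_mul_le_mul_left (card_mul_norm_sq_sum_smul_le (fun i _ => ?_)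
      (fun i hi t ht hit => ?_) a) (Nat.cast_pos.2 hs.card_pos)
    · rw [norm_smul, norm_inv, norm_norm]
      exact inv_mul_le_one
    · rw [real_inner_smul_left, real_inner_smul_right, abs_mul, abs_mul, abs_inv, abs_inv,
        abs_norm, abs_norm]
      calc #s * (‖u i‖⁻¹ * (‖u t‖⁻¹ * |⟪u i, u t⟫_ℝ|)) =
            (‖u i‖ * ‖u t‖)⁻¹ * (#s * |⟪u i, u t⟫_ℝ|) := by rw [mul_inv]; ring
        _ ≤ 1 := inv_mul_le_one_of_le₀ (hu i hi t ht hit) (by positivity)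
  have hcs := sq_real_inner_le (∑ t ∈ s, a t • ‖u t‖⁻¹ • u t) y
  rw [hinner] at hcs
  rw [hform]
  rcases (sum_nonneg fun t _ => sq_nonneg (a t) : 0 ≤ ∑ t ∈ s, a t ^ 2).eq_or_lt' with h0 | h0
  · rw [h0]; positivity
  · refine le_of_mul_le_mul_left ?_ h0
    nlinarith [mul_le_mul_of_nonneg_right hnorm (sq_nonneg ‖y‖)]

end Deflation

section Sketch

open Finset
open scoped InnerProductSpace

variable {ι E : Type*} [NormedAddCommGroup E] [InnerProductSpace ℝ E]

/-- The `L` weighted vectors `v k` are a sketch of a quadratic form `F` of trace `τ`: their form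
lies between `F - D * ‖·‖ ^ 2` and `F`, and the loss `D` is paid for by a loss of `L / 6 * D` in
the trace. -/
structure IsSketch (L : ℕ) (F : E → ℝ) (τ : ℝ) (w : ℕ → ℝ) (v : ℕ → E) : Prop where
  weight_nonneg : ∀ k ∈ range L, 0 ≤ w k
  form_le (y : E) : gramForm (range L) w v y ≤ F y
  exists_loss : ∃ D, 0 ≤ D ∧ (∀ y, F y ≤ gramForm (range L) w v y + D * ‖y‖ ^ 2) ∧
    gramTrace (range L) w v + L / 6 * D ≤ τ

theorem Deflated.inv_norm_sq_mul_norm_sq {η δ : ℝ} {s : Finset ι} {c : ι → ℝ} {v₀ v : ι → E}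
    {j : ℕ} {u : ℕ → E} {e : ℕ → ℝ} (h : Deflated η s c v₀ j v u e) (hδ : 0 ≤ δ)
    (hle : ∀ t < j, δ ≤ 2 * (e t * ‖u t‖ ^ 2)) {t : ℕ} (ht : t < j) :
    δ * ((‖u t‖ ^ 2)⁻¹ * ‖u t‖ ^ 2) = δ ∧ 0 ≤ e t - δ / 2 * (‖u t‖ ^ 2)⁻¹ := by
  have hδt := hle t ht
  rcases eq_or_ne (u t) 0 with h0 | h0
  · rw [h0, norm_zero, zero_pow two_ne_zero, mul_zero, mul_zero] at hδt
    rw [hδt.antisymm hδ, zero_mul, zero_div, zero_mul, sub_zero]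
    exact ⟨rfl, h.coeff_nonneg t ht⟩
  · have hpos : 0 < ‖u t‖ ^ 2 := by positivity
    rw [inv_mul_cancel₀ hpos.ne', mul_one, sub_nonneg, ← div_eq_mul_inv, div_le_iff₀ hpos]
    exact ⟨rfl, by linarith⟩

theorem Deflated.card_mul_abs_inner_le {s : Finset ι} {c : ι → ℝ} {v₀ v : ι → E} {L : ℕ}
    {u : ℕ → E} {e : ℕ → ℝ} (h : Deflated ((L : ℝ) ^ 2) s c v₀ L v u e) {i t : ℕ} (hi : i < L)
    (ht : t < L) (hit : i ≠ t) : L * |⟪u i, u t⟫_ℝ| ≤ ‖u i‖ * ‖u t‖ := by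
  have key {i t : ℕ} (ht : t < L) (hit : i < t) : L * |⟪u i, u t⟫_ℝ| ≤ ‖u i‖ * ‖u t‖ := by
    refine le_of_sq_le_sq ?_ (by positivity)
    simpa only [mul_pow, sq_abs] using h.near t ht i hit
  rcases hit.lt_or_gt with hit | hit
  · exact key ht hit
  · rw [real_inner_comm, mul_comm ‖u i‖]
    exact key hi hit

/-- Lowering the weights is what pays for the loss in the trace. -/
theorem Deflated.isSketch {s : Finset ι} {c : ι → ℝ} {v₀ v : ι → E} {L : ℕ} {u : ℕ → E}
    {e : ℕ → ℝ} (h : Deflated ((L : ℝ) ^ 2) s c v₀ L v u e) (hc : ∀ k ∈ s, 0 ≤ c k) {Z : Set E}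
    {x : E} {num den : ℝ} (hb : IsBest ((L : ℝ) ^ 2) (gramOp s c v) Z x num den)
    (hle : ∀ y, gramForm s c v y * den ≤ 2 * num * ‖y‖ ^ 2) :
    IsSketch L (gramForm s c v₀) (gramTrace s c v₀)
      (fun t => e t - num / den / 2 * (‖u t‖ ^ 2)⁻¹) u := by
  set δ : ℝ := num / den
  have hδ : 0 ≤ δ := div_nonneg hb.num_nonneg hb.den_pos.le
  have hut {t : ℕ} (ht : t ∈ range L) :=
    h.inv_norm_sq_mul_norm_sq hδ (fun t => h.div_le hb) (mem_range.1 ht)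
  have hform (y : E) : gramForm (range L) (fun t => e t - δ / 2 * (‖u t‖ ^ 2)⁻¹) u y =
      gramForm (range L) e u y - δ / 2 * gramForm (range L) (fun t => (‖u t‖ ^ 2)⁻¹) u y := by
    simp only [gramForm, mul_sum, ← sum_sub_distrib]
    exact sum_congr rfl fun t _ => by ring
  have htrace : gramTrace (range L) (fun t => e t - δ / 2 * (‖u t‖ ^ 2)⁻¹) u =
      gramTrace (range L) e u - L * (δ / 2) := by
    simp only [gramTrace, sub_mul, sum_sub_distrib]
    congr 1
    calc _ = ∑ _t ∈ range L, δ / 2 := sum_congr rfl fun t ht => by linarith [(hut ht).1]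
      _ = _ := by rw [sum_const, card_range, nsmul_eq_mul]
  have hbessel (y : E) : gramForm (range L) (fun t => (‖u t‖ ^ 2)⁻¹) u y ≤ 2 * ‖y‖ ^ 2 := by
    refine gramForm_inv_norm_sq_le (fun i hi t ht hit => ?_) y
    rw [card_range]
    exact h.card_mul_abs_inner_le (mem_range.1 hi) (mem_range.1 ht) hit
  refine ⟨fun t ht => (hut ht).2, fun y => ?_, 3 * δ, by positivity, fun y => ?_, ?_⟩
  · have := gramForm_nonneg (s := range L) (c := fun t => (‖u t‖ ^ 2)⁻¹) (v := u)
      (fun t _ => by positivity) y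
    rw [hform, ← h.form y]
    nlinarith [gramForm_nonneg (v := v) hc y]
  · have hleft : gramForm s c v y ≤ 2 * δ * ‖y‖ ^ 2 := by
      rw [show 2 * δ * ‖y‖ ^ 2 = 2 * num * ‖y‖ ^ 2 / den by ring, le_div_iff₀ hb.den_pos]
      exact hle y
    rw [hform, ← h.form y]
    nlinarith [hbessel y]
  · rw [htrace, ← h.trace]
    linarith [gramTrace_nonneg (v := v) hc]

namespace IsSketch

variable {L : ℕ} {F : E → ℝ} {τ : ℝ} {w w' : ℕ → ℝ} {v v' : ℕ → E}

theorem zero {w : ℕ → ℝ} (hw : ∀ k ∈ range L, w k = 0) (v : ℕ → E) :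
    IsSketch L (fun _ : E => 0) 0 w v where
  weight_nonneg k hk := (hw k hk).ge
  form_le y := (sum_eq_zero fun k hk => by rw [hw k hk, zero_mul]).le
  exists_loss := by
    refine ⟨0, le_rfl, fun y => ?_, ?_⟩
    · rw [gramForm, sum_eq_zero fun k hk => by rw [hw k hk, zero_mul]]
      simp
    · rw [gramTrace, sum_eq_zero fun k hk => by rw [hw k hk, zero_mul]]
      simp

theorem congr (h : IsSketch L F τ w v) (hw : ∀ k ∈ range L, w' k = w k)
    (hv : ∀ k ∈ range L, v' k = v k) : IsSketch L F τ w' v' where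
  weight_nonneg k hk := (h.weight_nonneg k hk).trans_eq (hw k hk).symm
  form_le y := (gramForm_congr hw hv y).trans_le (h.form_le y)
  exists_loss := by
    simpa only [gramForm_congr hw hv, gramTrace_congr hw hv] using h.exists_loss

theorem trans {G : E → ℝ} {ρ : ℝ} (h : IsSketch L F τ w v)
    (h' : IsSketch L (fun y => gramForm (range L) w v y + G y) (gramTrace (range L) w v + ρ)
      w' v') :
    IsSketch L (fun y => F y + G y) (τ + ρ) w' v' := by
  obtain ⟨D, hD, hF, hτ⟩ := h.exists_loss
  obtain ⟨D', hD', hF', hτ'⟩ := h'.exists_loss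
  refine ⟨h'.weight_nonneg, fun y => (h'.form_le y).trans ?_, D + D', add_nonneg hD hD',
    fun y => ?_, ?_⟩
  · linarith [h.form_le y]
  · linarith [hF y, hF' y]
  · linarith

theorem le (h : IsSketch L F τ w v) (hL : 0 < L) {b : ℝ}
    (hb : ∀ y, gramForm (range L) w v y ≤ b * ‖y‖ ^ 2) (y : E) :
    F y ≤ (b + 6 * τ / L) * ‖y‖ ^ 2 := by
  obtain ⟨D, -, hF, hτ⟩ := h.exists_loss
  have hL' : (0 : ℝ) < L := Nat.cast_pos.2 hL
  have hD : D ≤ 6 * τ / L := by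
    rw [le_div_iff₀ hL']
    linarith [gramTrace_nonneg (v := v) h.weight_nonneg]
  calc F y ≤ b * ‖y‖ ^ 2 + D * ‖y‖ ^ 2 := (hF y).trans (add_le_add_left (hb y) _)
    _ ≤ b * ‖y‖ ^ 2 + 6 * τ / L * ‖y‖ ^ 2 := by gcongr
    _ = _ := by ring

end IsSketch

/-- The vector `x` maximizes the Rayleigh quotient of the form `F`, with value about `ρ`, up to a
factor `2` and an additive error `δ`. -/
structure IsNearMax {E : Type*} [NormedAddCommGroup E] (F : E → ℝ) (δ ρ : ℝ) (x : E) : Prop where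
  form_le : ∀ y, F y ≤ (2 * ρ + δ) * ‖y‖ ^ 2
  mul_norm_sq_le : ρ * ‖x‖ ^ 2 ≤ F x
  ne_zero : 0 < ρ → x ≠ 0

theorem IsSketch.isNearMax {L : ℕ} {F : E → ℝ} {τ : ℝ} {w : ℕ → ℝ} {v : ℕ → E}
    (h : IsSketch L F τ w v) (hL : 0 < L) {η : ℝ} {Z : Set E} {x : E} {num den : ℝ}
    (hx : IsBest η (gramOp (range L) w v) Z x num den)
    (hle : ∀ y, gramForm (range L) w v y * den ≤ 2 * num * ‖y‖ ^ 2) :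
    IsNearMax F (6 * τ / L) (num / den) x where
  form_le := h.le hL fun y => by
    rw [← mul_div_assoc, div_mul_eq_mul_div, le_div_iff₀ hx.den_pos]
    exact hle y
  mul_norm_sq_le := by
    rw [div_mul_eq_mul_div, hx.num_mul_norm_sq, mul_div_cancel_right₀ _ hx.den_pos.ne',
      inner_gramOp_self]
    exact h.form_le x
  ne_zero hpos := by
    rintro rfl
    rw [hx.num_eq, inner_zero_left, zero_div] at hpos
    exact hpos.false

end Sketch

section SingularValues

open Finset
open scoped InnerProductSpace

variable {E F : Type*} [NormedAddCommGroup E] [InnerProductSpace ℝ E] [FiniteDimensional ℝ E]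
  [NormedAddCommGroup F] [InnerProductSpace ℝ F] [FiniteDimensional ℝ F]

theorem singularValues_le_of_forall_norm_le (T : E →ₗ[ℝ] F) {b : ℝ} (hb : 0 ≤ b)
    (h : ∀ y, ‖T y‖ ≤ b * ‖y‖) (j : ℕ) : T.singularValues j ≤ b := by
  rcases lt_or_ge j (Module.finrank ℝ E) with hj | hj
  · obtain ⟨v, hv⟩ := (T.hasEigenvalue_adjoint_comp_self_sq_singularValues hj).exists_hasEigenvector
    have hT : ‖T v‖ ^ 2 = (T.singularValues j * ‖v‖) ^ 2 := by
      rw [← real_inner_self_eq_norm_sq, ← LinearMap.adjoint_inner_left, ← LinearMap.comp_apply,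
        hv.apply_eq_smul, real_inner_smul_left, real_inner_self_eq_norm_sq, mul_pow]
      rfl
    rw [sq_eq_sq₀ (norm_nonneg _) (mul_nonneg (T.singularValues_nonneg j) (norm_nonneg _))] at hT
    exact le_of_mul_le_mul_right (hT ▸ h v) (norm_pos_iff.2 hv.2)
  · rw [T.singularValues_of_finrank_le hj]
    exact hb

theorem norm_apply_le_singularValues_zero_mul (T : E →ₗ[ℝ] F) (y : E) :
    ‖T y‖ ≤ T.singularValues 0 * ‖y‖ := by
  have hS := T.isSymmetric_adjoint_comp_self
  set b := hS.eigenvectorBasis rfl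
  have hTy : ‖T y‖ ^ 2 = ∑ i, hS.eigenvalues rfl i * ⟪b i, y⟫_ℝ ^ 2 := by
    rw [← real_inner_self_eq_norm_sq, ← LinearMap.adjoint_inner_left, ← LinearMap.comp_apply,
      ← b.sum_inner_mul_inner]
    refine sum_congr rfl fun i _ => ?_
    have hi := hS.eigenvectorBasis_apply_self_apply rfl y i
    rw [b.repr_apply_apply, b.repr_apply_apply] at hi
    rw [real_inner_comm, hi]
    simp only [RCLike.ofReal_real_eq_id, id]
    ring
  have hy : ‖y‖ ^ 2 = ∑ i, ⟪b i, y⟫_ℝ ^ 2 := by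
    rw [← real_inner_self_eq_norm_sq, ← b.sum_inner_mul_inner]
    exact sum_congr rfl fun i _ => by rw [real_inner_comm, sq]
  refine le_of_sq_le_sq ?_ (mul_nonneg (T.singularValues_nonneg 0) (norm_nonneg y))
  rw [mul_pow, hTy, hy, mul_sum]
  refine sum_le_sum fun i _ => mul_le_mul_of_nonneg_right ?_ (sq_nonneg _)
  rw [← T.sq_singularValues_fin rfl i]
  exact pow_le_pow_left₀ (T.singularValues_nonneg _) (T.singularValues_antitone (Nat.zero_le _)) 2

end SingularValues

section Cut

open Finset Matrix
open scoped InnerProductSpace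

variable {ι κ : Type*} [Fintype ι] [Fintype κ]

theorem norm_sum_single_one [DecidableEq ι] (U : Finset ι) :
    ‖∑ i ∈ U, EuclideanSpace.single i (1 : ℝ)‖ = √(#U) := by
  rw [EuclideanSpace.norm_eq]
  simp [Pi.single_apply]

theorem abs_sum_sum_le_singularValues_zero_mul [DecidableEq κ] (A : Matrix ι κ ℝ)
    (S : Finset ι) (T : Finset κ) :
    |∑ i ∈ S, ∑ k ∈ T, A i k| ≤ (toEuclideanLin A).singularValues 0 * (√(#S) * √(#T)) := by
  classical
  have hsum : ∑ i ∈ S, ∑ k ∈ T, A i k = ⟪∑ i ∈ S, EuclideanSpace.single i (1 : ℝ),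
      toEuclideanLin A (∑ k ∈ T, EuclideanSpace.single k 1)⟫_ℝ := by
    simp [sum_inner, EuclideanSpace.inner_single_left]
  rw [hsum]
  refine (abs_real_inner_le_norm _ _).trans ?_
  rw [norm_sum_single_one, mul_left_comm, ← norm_sum_single_one T]
  gcongr
  exact norm_apply_le_singularValues_zero_mul _ _

theorem le_singularValues_zero_of_le_abs_sum {n : ℕ} (hn : 0 < n) {A : Matrix (Fin n) (Fin n) ℝ}
    {S T : Finset (Fin n)} {c : ℝ} (h : c * n ^ 2 ≤ |∑ i ∈ S, ∑ k ∈ T, A i k|) :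
    c * n ≤ (toEuclideanLin A).singularValues 0 := by
  have hn' : (0 : ℝ) < n := Nat.cast_pos.2 hn
  refine le_of_mul_le_mul_right ?_ hn'
  calc c * n * n = c * n ^ 2 := by ring
    _ ≤ (toEuclideanLin A).singularValues 0 * (√(#S) * √(#T)) :=
      h.trans (abs_sum_sum_le_singularValues_zero_mul A S T)
    _ ≤ (toEuclideanLin A).singularValues 0 * (√n * √n) := by
      gcongr
      · exact (toEuclideanLin A).singularValues_nonneg 0
      · exact card_finset_fin_le S
      · exact card_finset_fin_le T
    _ = (toEuclideanLin A).singularValues 0 * n := by rw [Real.mul_self_sqrt hn'.le]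

/-- One of the two sets of indices where `f` is nonnegative and where `f` is negative, chosen such
that it captures at least half of `∑ i, |f i|`. -/
noncomputable def signSet (f : ι → ℝ) : Finset ι := {i | 0 ≤ f i ↔ 0 ≤ ∑ j, f j}

theorem sum_abs_le_two_mul_abs_sum_signSet (f : ι → ℝ) :
    ∑ i, |f i| ≤ 2 * |∑ i ∈ signSet f, f i| := by
  have hneg : ∑ i with ¬0 ≤ f i, |f i| = -∑ i with ¬0 ≤ f i, f i := by
    rw [← sum_neg_distrib]
    exact sum_congr rfl fun i hi => abs_of_neg (not_le.1 (mem_filter.1 hi).2)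
  have hpos : ∑ i with 0 ≤ f i, |f i| = ∑ i with 0 ≤ f i, f i :=
    sum_congr rfl fun i hi => abs_of_nonneg (mem_filter.1 hi).2
  have hsum := sum_filter_add_sum_filter_not univ (fun i => 0 ≤ f i) f
  rw [← sum_filter_add_sum_filter_not univ (fun i => 0 ≤ f i), hpos, hneg]
  by_cases h0 : 0 ≤ ∑ j, f j
  · simp only [signSet, h0, iff_true]
    linarith [le_abs_self (∑ i with 0 ≤ f i, f i)]
  · simp only [signSet, h0, iff_false]
    linarith [neg_le_abs (∑ i with ¬0 ≤ f i, f i)]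

theorem sq_dotProduct_le_of_sq_le {a : ι → ℝ} {B : ℝ} (hB : 0 ≤ B) (ha : ∀ i, a i ^ 2 ≤ B)
    (f : ι → ℝ) : (a ⬝ᵥ f) ^ 2 ≤ B * (4 * (∑ i ∈ signSet f, f i) ^ 2) := by
  have hle : |a ⬝ᵥ f| ≤ √B * (2 * |∑ i ∈ signSet f, f i|) :=
    calc |a ⬝ᵥ f| ≤ ∑ i, |a i * f i| := abs_sum_le_sum_abs _ _
      _ ≤ ∑ i, √B * |f i| := sum_le_sum fun i _ => by
        rw [abs_mul]
        gcongr
        exact Real.abs_le_sqrt (ha i)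
      _ = √B * ∑ i, |f i| := (mul_sum ..).symm
      _ ≤ _ := by gcongr; exact sum_abs_le_two_mul_abs_sum_signSet f
  calc (a ⬝ᵥ f) ^ 2 ≤ (√B * (2 * |∑ i ∈ signSet f, f i|)) ^ 2 := by
        rw [← sq_abs]; gcongr
    _ = B * (4 * (∑ i ∈ signSet f, f i) ^ 2) := by
        rw [mul_pow, mul_pow, Real.sq_sqrt hB, sq_abs]
        norm_num

theorem sq_dotProduct_le (a b : ι → ℝ) : (a ⬝ᵥ b) ^ 2 ≤ (a ⬝ᵥ a) * (b ⬝ᵥ b) := by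
  simpa only [dotProduct, ← sq] using sum_mul_sq_le_sq_mul_sq univ a b

/-- The rows of a large cut found from a vector `x` with large image under `A`. -/
noncomputable def cutRows (A : Matrix ι κ ℝ) (x : κ → ℝ) : Finset ι :=
  signSet (A *ᵥ (Aᵀ *ᵥ (A *ᵥ x)))

/-- The columns of a large cut found from a vector `x` with large image under `A`. -/
noncomputable def cutCols (A : Matrix ι κ ℝ) (x : κ → ℝ) : Finset κ :=
  signSet fun k => ∑ i ∈ cutRows A x, A i k

variable {A : Matrix ι κ ℝ} {R R' : ℝ}

omit [Fintype ι] in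
theorem sq_mulVec_le (hR : ∀ i, A.row i ⬝ᵥ A.row i ≤ R) (x : κ → ℝ) (i : ι) :
    (A *ᵥ x) i ^ 2 ≤ R * (x ⬝ᵥ x) :=
  (sq_dotProduct_le _ _).trans
    (mul_le_mul_of_nonneg_right (hR i) (sum_nonneg fun _ _ => mul_self_nonneg _))

/-- With `y = A x` and `z = Aᵀ y` we have `⟪y, y⟫ = ⟪x, z⟫` and `⟪z, z⟫ = ⟪y, A z⟫`; passing to the
sign set of `A z`, and then to that of the sum of its rows, loses only constant factors, since the
entries of `y` and of `z` are small. -/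
theorem pow_four_mulVec_le (hR0 : 0 ≤ R) (hR : ∀ i, A.row i ⬝ᵥ A.row i ≤ R) (hR0' : 0 ≤ R')
    (hR' : ∀ k, A.col k ⬝ᵥ A.col k ≤ R') (x : κ → ℝ) :
    (A *ᵥ x ⬝ᵥ A *ᵥ x) ^ 4 ≤ 16 * (R * R' * (x ⬝ᵥ x) ^ 3 *
      (∑ i ∈ cutRows A x, ∑ k ∈ cutCols A x, A i k) ^ 2) * (A *ᵥ x ⬝ᵥ A *ᵥ x) := by
  set y := A *ᵥ x
  set z := Aᵀ *ᵥ y with hz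
  set F := ∑ i ∈ cutRows A x, (A *ᵥ z) i
  set D := ∑ i ∈ cutRows A x, ∑ k ∈ cutCols A x, A i k
  have hX : 0 ≤ x ⬝ᵥ x := sum_nonneg fun _ _ => mul_self_nonneg _
  have hY : 0 ≤ y ⬝ᵥ y := sum_nonneg fun _ _ => mul_self_nonneg _
  have hxz : x ⬝ᵥ z = y ⬝ᵥ y := by
    rw [hz, mulVec_transpose, dotProduct_comm, ← dotProduct_mulVec]
  have hyf : y ⬝ᵥ A *ᵥ z = z ⬝ᵥ z := by rw [dotProduct_mulVec, ← mulVec_transpose]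
  have hzg : z ⬝ᵥ (fun k => ∑ i ∈ cutRows A x, A i k) = F := by
    simp only [dotProduct, F, mulVec, mul_comm (z _), sum_mul]
    exact sum_comm
  have hD : ∑ k ∈ cutCols A x, ∑ i ∈ cutRows A x, A i k = D := sum_comm
  have hF : (z ⬝ᵥ z) ^ 2 ≤ R * (x ⬝ᵥ x) * (4 * F ^ 2) := by
    rw [← hyf]
    exact sq_dotProduct_le_of_sq_le (by positivity) (sq_mulVec_le hR x) _
  have hFD : F ^ 2 ≤ R' * (y ⬝ᵥ y) * (4 * D ^ 2) := by
    rw [← hzg, ← hD]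
    exact sq_dotProduct_le_of_sq_le (by positivity) (sq_mulVec_le hR' y) _
  calc (y ⬝ᵥ y) ^ 4 = ((x ⬝ᵥ z) ^ 2) ^ 2 := by rw [hxz]; ring
    _ ≤ ((x ⬝ᵥ x) * (z ⬝ᵥ z)) ^ 2 := by gcongr; exact sq_dotProduct_le x z
    _ = (x ⬝ᵥ x) ^ 2 * (z ⬝ᵥ z) ^ 2 := mul_pow ..
    _ ≤ (x ⬝ᵥ x) ^ 2 * (R * (x ⬝ᵥ x) * (4 * (R' * (y ⬝ᵥ y) * (4 * D ^ 2)))) := by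
      refine mul_le_mul_of_nonneg_left (hF.trans ?_) (sq_nonneg _)
      gcongr
    _ = _ := by ring

theorem le_abs_sum_cut {n : ℕ} (hn : 0 < n) {A : Matrix (Fin n) (Fin n) ℝ}
    (hrow : ∀ i, A.row i ⬝ᵥ A.row i ≤ n) (hcol : ∀ k, A.col k ⬝ᵥ A.col k ≤ n) {ε : ℝ} (hε : 0 < ε)
    {x : Fin n → ℝ} (hx : 0 < x ⬝ᵥ x)
    (hAx : 9 * (ε ^ 2 * n ^ 2 * (x ⬝ᵥ x)) ≤ 20 * (A *ᵥ x ⬝ᵥ A *ᵥ x)) :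
    ε ^ 8 / 100 * n ^ 2 ≤ |∑ i ∈ cutRows A x, ∑ k ∈ cutCols A x, A i k| := by
  have hn' : (0 : ℝ) < n := Nat.cast_pos.2 hn
  have hYX : A *ᵥ x ⬝ᵥ A *ᵥ x ≤ n ^ 2 * (x ⬝ᵥ x) :=
    calc A *ᵥ x ⬝ᵥ A *ᵥ x ≤ ∑ _i : Fin n, n * (x ⬝ᵥ x) :=
          sum_le_sum fun i _ => (sq ((A *ᵥ x) i)).symm.trans_le (sq_mulVec_le hrow x i)
      _ = n ^ 2 * (x ⬝ᵥ x) := by rw [sum_const, card_univ, Fintype.card_fin, nsmul_eq_mul]; ring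
  have hpow := pow_four_mulVec_le hn'.le hrow hn'.le hcol x
  set X := x ⬝ᵥ x
  set Y := A *ᵥ x ⬝ᵥ A *ᵥ x
  set D := ∑ i ∈ cutRows A x, ∑ k ∈ cutCols A x, A i k
  obtain ⟨ρ, hρ⟩ : ∃ ρ, Y = ρ * (n ^ 2 * X) :=
    ⟨Y / (n ^ 2 * X), (div_mul_cancel₀ _ (by positivity)).symm⟩
  have hM : 0 < (n : ℝ) ^ 2 * X := by positivity
  have hρ1 : ρ ≤ 1 := le_of_mul_le_mul_right (by linarith) hM
  have hρε : 9 / 20 * ε ^ 2 ≤ ρ := le_of_mul_le_mul_right (by linarith) hM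
  have hρ0 : 0 < ρ := lt_of_lt_of_le (by positivity) hρε
  have hD : ρ ^ 3 * n ^ 4 ≤ 16 * D ^ 2 := by
    refine le_of_mul_le_mul_right ?_ (show 0 < ρ * n ^ 4 * X ^ 4 by positivity)
    rw [hρ] at hpow
    linarith
  refine (abs_of_pos (show 0 < ε ^ 8 / 100 * n ^ 2 by positivity)).symm.trans_le (sq_le_sq.1 ?_)
  calc (ε ^ 8 / 100 * n ^ 2) ^ 2 ≤ (9 / 20 * ε ^ 2) ^ 8 * n ^ 4 / 16 := by
        rw [mul_pow, mul_pow, div_pow]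
        have : 0 ≤ ε ^ 16 * n ^ 4 := by positivity
        linarith
    _ ≤ ρ ^ 8 * n ^ 4 / 16 := by gcongr
    _ ≤ ρ ^ 3 * n ^ 4 / 16 := by
      have := pow_le_pow_of_le_one hρ0.le hρ1 (show 3 ≤ 8 by norm_num)
      gcongr
    _ ≤ D ^ 2 := by linarith

end Cut

namespace RealRAM

open Finset Matrix
open scoped InnerProductSpace

theorem Store.setWord_word (s : Store) (a i v b j : ℕ) :
    (s.setWord a i v).word b j = if b = a ∧ j = i then v else s.word b j := by
  simp only [Store.setWord, Function.update_apply]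
  split_ifs <;> simp_all

theorem Store.setReal_real (s : Store) (a i : ℕ) (v : ℝ) (b j : ℕ) :
    (s.setReal a i v).real b j = if b = a ∧ j = i then v else s.real b j := by
  simp only [Store.setReal, Function.update_apply]
  split_ifs <;> simp_all

/-- The names of the word arrays that a program may write to. -/
def Prog.words : Prog → List ℕ
  | skip => []
  | setWord a _ _ => [a]
  | setReal _ _ _ => []
  | seq p q => p.words ++ q.words
  | ite _ p q => p.words ++ q.words
  | .while _ p => p.words

/-- The names of the real arrays that a program may write to. -/
def Prog.reals : Prog → List ℕ
  | skip => []
  | setWord _ _ _ => []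
  | setReal a _ _ => [a]
  | seq p q => p.reals ++ q.reals
  | ite _ p q => p.reals ++ q.reals
  | .while _ p => p.reals

/-- The frame condition: the two stores agree outside of the word arrays `ws` and the real
arrays `rs`. -/
structure AgreeOff (ws rs : List ℕ) (s s' : Store) : Prop where
  word : ∀ a, a ∉ ws → s'.word a = s.word a
  real : ∀ a, a ∉ rs → s'.real a = s.real a

namespace AgreeOff

variable {ws rs ws' rs' : List ℕ} {s s' s'' : Store}

theorem refl (ws rs : List ℕ) (s : Store) : AgreeOff ws rs s s := ⟨fun _ _ => rfl, fun _ _ => rfl⟩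

theorem trans (h : AgreeOff ws rs s s') (h' : AgreeOff ws rs s' s'') : AgreeOff ws rs s s'' :=
  ⟨fun a ha => (h'.word a ha).trans (h.word a ha), fun a ha => (h'.real a ha).trans (h.real a ha)⟩

theorem mono (h : AgreeOff ws rs s s') (hw : ws ⊆ ws') (hr : rs ⊆ rs') : AgreeOff ws' rs' s s' :=
  ⟨fun a ha => h.word a fun h' => ha (hw h'), fun a ha => h.real a fun h' => ha (hr h')⟩

theorem setWord (s : Store) {a : ℕ} (i v : ℕ) (h : a ∈ ws) : AgreeOff ws rs s (s.setWord a i v) :=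
  ⟨fun _ hb => Function.update_of_ne (ne_of_mem_of_not_mem h hb).symm _ _, fun _ _ => rfl⟩

theorem setReal (s : Store) {a : ℕ} (i : ℕ) (v : ℝ) (h : a ∈ rs) :
    AgreeOff ws rs s (s.setReal a i v) :=
  ⟨fun _ _ => rfl, fun _ hb => Function.update_of_ne (ne_of_mem_of_not_mem h hb).symm _ _⟩

end AgreeOff

variable {x : Input} {W L : ℕ} {s s' : Store}

theorem Exec.agreeOff {p : Prog} {s' : Store} {t : ℕ} (h : Exec x W p s t s') :
    AgreeOff p.words p.reals s s' := by
  induction h with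
  | skip => exact .refl _ _ _
  | setWord => exact .setWord _ _ _ (List.mem_singleton_self _)
  | setReal => exact .setReal _ _ _ (List.mem_singleton_self _)
  | seq _ _ h₁ h₂ =>
    exact (h₁.mono (List.subset_append_left _ _) (List.subset_append_left _ _)).trans
      (h₂.mono (List.subset_append_right _ _) (List.subset_append_right _ _))
  | iteTrue _ _ _ h => exact h.mono (List.subset_append_left _ _) (List.subset_append_left _ _)
  | iteFalse _ _ _ h => exact h.mono (List.subset_append_right _ _) (List.subset_append_right _ _)
  | whileTrue _ _ _ _ h₁ h₂ => exact h₁.trans h₂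
  | whileFalse => exact .refl _ _ _

/-- The evaluation of the word expression `e` is legal and gives `v`. -/
def WExp.Yields (x : Input) (W : ℕ) (s : Store) (e : WExp) (v : ℕ) : Prop :=
  e.Legal x W s ∧ e.eval x s = v

/-- The evaluation of the real expression `e` is legal and gives `v`. -/
def RExp.Yields (x : Input) (W : ℕ) (s : Store) (e : RExp) (v : ℝ) : Prop :=
  e.Legal x W s ∧ e.eval x s = v

/-- The evaluation of the test `b` is legal, and `b` succeeds if and only if `P` is true. -/
def Test.Decides (x : Input) (W : ℕ) (s : Store) (b : Test) (P : Prop) : Prop :=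
  b.Legal x W s ∧ (b.Holds x s ↔ P)

/-- The word register `a`, that is, the first cell of the word array `a`. -/
abbrev WExp.reg (a : ℕ) : WExp := .cell a (.const 0)

/-- The real register `a`, that is, the first cell of the real array `a`. -/
abbrev RExp.reg (a : ℕ) : RExp := .cell a (.const 0)

namespace WExp.Yields

variable {e f : WExp} {a u v : ℕ}

theorem const (h : u ≤ W) : (WExp.const u).Yields x W s u := ⟨h, rfl⟩

theorem size (h : x.n ≤ W) : WExp.size.Yields x W s x.n := ⟨h, rfl⟩

theorem cell (he : e.Yields x W s u) (hu : s.word a u ≤ W) :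
    (WExp.cell a e).Yields x W s (s.word a u) := by
  obtain ⟨he, rfl⟩ := he
  exact ⟨⟨he, hu⟩, rfl⟩

theorem reg (h : s.word a 0 = v) (hv : v ≤ W) : (WExp.reg a).Yields x W s v :=
  ⟨⟨Nat.zero_le _, h.trans_le hv⟩, h⟩

theorem add (he : e.Yields x W s u) (hf : f.Yields x W s v) (h : u + v ≤ W) :
    (e.add f).Yields x W s (u + v) := by
  obtain ⟨he, rfl⟩ := he
  obtain ⟨hf, rfl⟩ := hf
  exact ⟨⟨he, hf, h⟩, rfl⟩

theorem mul (he : e.Yields x W s u) (hf : f.Yields x W s v) (h : u * v ≤ W) :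
    (e.mul f).Yields x W s (u * v) := by
  obtain ⟨he, rfl⟩ := he
  obtain ⟨hf, rfl⟩ := hf
  exact ⟨⟨he, hf, h⟩, rfl⟩

end WExp.Yields

namespace RExp.Yields

variable {e f : RExp} {i k : WExp} {a l m : ℕ} {u v : ℝ}

theorem cast (h : i.Yields x W s l) : (RExp.cast i).Yields x W s l := ⟨h.1, congrArg _ h.2⟩

theorem entry (hi : i.Yields x W s l) (hk : k.Yields x W s m) (hl : l < x.n) (hm : m < x.n) :
    (RExp.entry i k).Yields x W s (x.entry l m) := by
  obtain ⟨hi, rfl⟩ := hi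
  obtain ⟨hk, rfl⟩ := hk
  exact ⟨⟨hi, hk, hl, hm⟩, rfl⟩

theorem cell (h : i.Yields x W s l) : (RExp.cell a i).Yields x W s (s.real a l) :=
  ⟨h.1, congrArg _ h.2⟩

theorem reg (h : s.real a 0 = v) : (RExp.reg a).Yields x W s v := ⟨Nat.zero_le _, h⟩

theorem bound : RExp.bound.Yields x W s x.C := ⟨trivial, rfl⟩

theorem accuracy : RExp.accuracy.Yields x W s x.ε := ⟨trivial, rfl⟩

theorem add (he : e.Yields x W s u) (hf : f.Yields x W s v) : (e.add f).Yields x W s (u + v) :=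
  ⟨⟨he.1, hf.1⟩, congrArg₂ _ he.2 hf.2⟩

theorem sub (he : e.Yields x W s u) (hf : f.Yields x W s v) : (e.sub f).Yields x W s (u - v) :=
  ⟨⟨he.1, hf.1⟩, congrArg₂ _ he.2 hf.2⟩

theorem mul (he : e.Yields x W s u) (hf : f.Yields x W s v) : (e.mul f).Yields x W s (u * v) :=
  ⟨⟨he.1, hf.1⟩, congrArg₂ _ he.2 hf.2⟩

theorem div (he : e.Yields x W s u) (hf : f.Yields x W s v) (h : v ≠ 0) :
    (e.div f).Yields x W s (u / v) :=
  ⟨⟨he.1, hf.1, hf.2.trans_ne h⟩, congrArg₂ _ he.2 hf.2⟩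

end RExp.Yields

namespace Test.Decides

variable {b c : Test} {P Q : Prop}

theorem wordLE {e f : WExp} {u v : ℕ} (he : e.Yields x W s u) (hf : f.Yields x W s v) :
    (Test.wordLE e f).Decides x W s (u ≤ v) :=
  ⟨⟨he.1, hf.1⟩, by rw [← he.2, ← hf.2]; rfl⟩

theorem realLE {e f : RExp} {u v : ℝ} (he : e.Yields x W s u) (hf : f.Yields x W s v) :
    (Test.realLE e f).Decides x W s (u ≤ v) :=
  ⟨⟨he.1, hf.1⟩, by rw [← he.2, ← hf.2]; rfl⟩

theorem not (hb : b.Decides x W s P) : b.not.Decides x W s (¬ P) := ⟨hb.1, not_congr hb.2⟩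

theorem and (hb : b.Decides x W s P) (hc : c.Decides x W s Q) :
    (b.and c).Decides x W s (P ∧ Q) := ⟨⟨hb.1, hc.1⟩, and_congr hb.2 hc.2⟩

end Test.Decides

/-- The total correctness judgement of a Hoare logic with running times: the program `p`, started
with the memory `s`, halts after at most `c` steps with a memory that satisfies `Q`. -/
def Runs (x : Input) (W : ℕ) (p : Prog) (s : Store) (c : ℕ) (Q : Store → Prop) : Prop :=
  ∃ t s', t ≤ c ∧ Exec x W p s t s' ∧ Q s'

namespace Runs

variable {p q : Prog} {c c' d : ℕ} {Q Q' : Store → Prop}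

theorem le (h : Runs x W p s c Q) (hc : c ≤ c') : Runs x W p s c' Q := by
  obtain ⟨t, s', ht, he, hq⟩ := h
  exact ⟨t, s', ht.trans hc, he, hq⟩

theorem imp (h : Runs x W p s c Q) (hQ : ∀ s', AgreeOff p.words p.reals s s' → Q s' → Q' s') :
    Runs x W p s c Q' := by
  obtain ⟨t, s', ht, he, hq⟩ := h
  exact ⟨t, s', ht, he, hQ s' he.agreeOff hq⟩

theorem seq (h : Runs x W p s c Q)
    (h' : ∀ s', AgreeOff p.words p.reals s s' → Q s' → Runs x W q s' d Q') :
    Runs x W (.seq p q) s (c + d) Q' := by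
  obtain ⟨t, s', ht, he, hq⟩ := h
  obtain ⟨t', s'', ht', he', hq'⟩ := h' s' he.agreeOff hq
  exact ⟨t + t', s'', by lia, he.seq he', hq'⟩

theorem skip (hQ : Q s) : Runs x W .skip s 1 Q := ⟨1, s, le_rfl, .skip s, hQ⟩

theorem ite {b : Test} {P : Prop} (hb : b.Decides x W s P) (h₁ : P → Runs x W p s c Q)
    (h₂ : ¬ P → Runs x W q s c Q) : Runs x W (.ite b p q) s (b.cost + c) Q := by
  by_cases hP : P
  · obtain ⟨t, s', ht, he, hq⟩ := h₁ hP
    exact ⟨_, s', Nat.add_le_add_left ht _, .iteTrue hb.1 (hb.2.2 hP) he, hq⟩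
  · obtain ⟨t, s', ht, he, hq⟩ := h₂ hP
    exact ⟨_, s', Nat.add_le_add_left ht _, .iteFalse hb.1 (mt hb.2.1 hP) he, hq⟩

theorem setWord {a k v : ℕ} {i e : WExp} (hi : i.Yields x W s k) (he : e.Yields x W s v) :
    Runs x W (.setWord a i e) s (i.cost + e.cost + 1) fun s' => s' = s.setWord a k v := by
  obtain ⟨hi, rfl⟩ := hi
  obtain ⟨he, rfl⟩ := he
  exact ⟨_, _, le_rfl, .setWord a i e s hi he, rfl⟩

theorem setReal {a k : ℕ} {v : ℝ} {i : WExp} {e : RExp} (hi : i.Yields x W s k)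
    (he : e.Yields x W s v) :
    Runs x W (.setReal a i e) s (i.cost + e.cost + 1) fun s' =>
      s'.real a k = v ∧ ∀ j ≠ k, s'.real a j = s.real a j := by
  obtain ⟨hi, rfl⟩ := hi
  obtain ⟨he, rfl⟩ := he
  exact ⟨_, _, le_rfl, .setReal a i e s hi he, by simp [Store.setReal_real],
    fun j hj => by simp [Store.setReal_real, hj]⟩

theorem while_countdown {b : Test} (I : ℕ → Store → Prop)
    (h₀ : ∀ s, I 0 s → b.Decides x W s False)
    (hstep : ∀ d s, I (d + 1) s → b.Decides x W s True ∧ Runs x W p s c (I d)) (h : I d s) :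
    Runs x W (.while b p) s (d * (b.cost + c) + b.cost) (I 0) := by
  induction d generalizing s with
  | zero => exact ⟨_, s, by simp, .whileFalse (h₀ s h).1 (h₀ s h).2.1, h⟩
  | succ d ih =>
    obtain ⟨hb, t, s', ht, he, hI⟩ := hstep d s h
    obtain ⟨t', s'', ht', he', hI'⟩ := ih hI
    exact ⟨_, s'', by lia, .whileTrue hb.1 (hb.2.2 trivial) he he', hI'⟩

end Runs

/-- The word expression `e` yields `v`, even after changes to the word arrays `ws`. -/
def WExp.Persists (x : Input) (W : ℕ) (s : Store) (ws : List ℕ) (e : WExp) (v : ℕ) : Prop :=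
  ∀ s' : Store, (∀ a ∉ ws, s'.word a = s.word a) → e.Yields x W s' v

theorem WExp.Persists.const {ws : List ℕ} {v : ℕ} (h : v ≤ W) :
    (WExp.const v).Persists x W s ws v := fun _ _ => .const h

theorem WExp.Persists.size {ws : List ℕ} (h : x.n ≤ W) : WExp.size.Persists x W s ws x.n :=
  fun _ _ => .size h

theorem WExp.Persists.reg {ws : List ℕ} {a v : ℕ} (ha : a ∉ ws) (h : s.word a 0 = v) (hv : v ≤ W) :
    (WExp.reg a).Persists x W s ws v := fun _ hs => .reg (by rw [hs a ha, h]) hv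

/-- Increment the register `i`. -/
def incr (i : ℕ) : Prog := .setWord i (.const 0) (.add (.reg i) (.const 1))

theorem runs_incr {i k : ℕ} (h : s.word i 0 = k) (hW : k < W) :
    Runs x W (incr i) s 6 fun s' => s' = s.setWord i 0 (k + 1) :=
  .setWord (.const (Nat.zero_le _)) (.add (.reg h hW.le) (.const (by lia)) hW)

/-- Run `p` for the values `0, 1, …` smaller than `b` of the counter `i`. -/
def forLoop (i : ℕ) (b : WExp) (p : Prog) : Prog :=
  .seq (.setWord i (.const 0) (.const 0))
    (.while (.wordLE (.add (.reg i) (.const 1)) b) (.seq p (incr i)))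

theorem runs_forLoop {i N c : ℕ} {b : WExp} {p : Prog} (I : ℕ → Store → Prop) (hi : i ∉ p.words)
    (hb : b.Persists x W s (i :: p.words) N) (hbc : b.cost ≤ 10) (hN : 0 < N) (hNW : N < W)
    (hI : ∀ k s' v, I k s' → I k (s'.setWord i 0 v)) (h₀ : I 0 s)
    (hstep : ∀ k < N, ∀ s', AgreeOff (i :: p.words) p.reals s s' → s'.word i 0 = k → I k s' →
      Runs x W p s' c (I (k + 1))) :
    Runs x W (forLoop i b p) s (N * (c + 40)) (I N) := by
  let J (d : ℕ) (s' : Store) : Prop :=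
    AgreeOff (i :: p.words) p.reals s s' ∧ ∃ k, k + d = N ∧ s'.word i 0 = k ∧ I k s'
  have hcond {s' : Store} {k : ℕ} (hs : AgreeOff (i :: p.words) p.reals s s')
      (hk : s'.word i 0 = k) (hkN : k ≤ N) :
      (Test.wordLE (.add (.reg i) (.const 1)) b).Decides x W s' (k + 1 ≤ N) :=
    .wordLE (.add (.reg hk (by lia)) (.const (by lia)) (by lia)) (hb s' hs.word)
  have hend (s' : Store) (h : J 0 s') : I N s' := by
    obtain ⟨-, k, rfl, -, h⟩ := h
    exact h
  have hbody (d : ℕ) (s' : Store) (h : J (d + 1) s') :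
      Runs x W (.seq p (incr i)) s' (c + 6) (J d) := by
    obtain ⟨hs, k, hkd, hk, hIk⟩ := h
    refine .seq (hstep k (by lia) s' hs hk hIk) fun s₁ hs₁ hI₁ => ?_
    have hk₁ : s₁.word i 0 = k := by rw [hs₁.word i hi, hk]
    refine (runs_incr hk₁ (by lia)).imp ?_
    rintro _ - rfl
    refine ⟨(hs.trans (hs₁.mono (List.subset_cons_self _ _) (List.Subset.refl _))).trans
      (.setWord _ _ _ List.mem_cons_self), k + 1, by lia, ?_, hI _ _ _ hI₁⟩
    simp only [Store.setWord_word, and_self, if_true]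
  refine .le (c := 3 + (N * (b.cost + 5 + (c + 6)) + (b.cost + 5))) (.seq
    (.setWord (.const (Nat.zero_le _)) (.const (Nat.zero_le _))) fun s₁ _ hs₁ => .imp (Q := J 0) ?_
      fun s' _ => hend s') ?_
  · subst hs₁
    have hcost : (Test.wordLE (.add (.reg i) (.const 1)) b).cost = b.cost + 5 := by
      simp only [Test.cost, WExp.cost]; lia
    rw [← hcost]
    refine Runs.while_countdown J (fun s' h => ?_) (fun d s' h => ⟨?_, hbody d s' h⟩)
      ⟨.setWord _ _ _ List.mem_cons_self, 0, by lia, ?_, hI _ _ _ h₀⟩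
    · obtain ⟨hs, k, hkd, hk, -⟩ := h
      simpa [← hkd] using hcond hs hk (by lia)
    · obtain ⟨hs, k, hkd, hk, -⟩ := h
      simpa [← hkd] using hcond hs hk (by lia)
    · simp only [Store.setWord_word, and_self, if_true]
  · nlinarith

-- The numbers of the word arrays, of which the first three are prescribed by the output format, and
-- then of the real arrays. A register is the first cell of an array.
abbrev flag : ℕ := 0
abbrev rowMarks : ℕ := 1
abbrev colMarks : ℕ := 2
abbrev sketchLen : ℕ := 3
abbrev rowIdx : ℕ := 4
abbrev roundIdx : ℕ := 5
abbrev vecIdx : ℕ := 6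
abbrev powIdx : ℕ := 7
abbrev termIdx : ℕ := 8
abbrev coordIdx : ℕ := 9

abbrev vecs : ℕ := 0
abbrev weights : ℕ := 1
abbrev cur : ℕ := 2
abbrev image : ℕ := 3
abbrev best : ℕ := 4
abbrev bestNum : ℕ := 5
abbrev bestDen : ℕ := 6
abbrev coeff : ℕ := 7
abbrev curNum : ℕ := 8
abbrev curDen : ℕ := 9
abbrev imageSq : ℕ := 10
abbrev dirs : ℕ := 11
abbrev dirWeights : ℕ := 12
abbrev recip : ℕ := 13
abbrev cutY : ℕ := 14
abbrev cutZ : ℕ := 15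
abbrev rowSums : ℕ := 16
abbrev colSums : ℕ := 17
abbrev total : ℕ := 18

/-- The vector number `k` of the real array `a`, which holds one vector after the other. -/
noncomputable def Store.row (s : Store) (n a k : ℕ) : EuclideanSpace ℝ (Fin n) :=
  WithLp.toLp 2 fun c => s.real a (k * n + c)

@[simp] theorem Store.row_apply (n a k : ℕ) (c : Fin n) : s.row n a k c = s.real a (k * n + c) :=
  rfl

theorem AgreeOff.row {ws rs : List ℕ} {a : ℕ} (h : AgreeOff ws rs s s') (ha : a ∉ rs) (n k : ℕ) :
    s'.row n a k = s.row n a k := by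
  simp only [Store.row, h.real a ha]

/-- The coordinate, with its index in the register `coordIdx`, of the vector number `k` of the real
array `a`. -/
abbrev RExp.coord (a : ℕ) (k : WExp) : RExp := .cell a (.add (.mul k .size) (.reg coordIdx))

theorem RExp.Yields.coord {b m : ℕ} {k : WExp} {c : Fin x.n} (hk : k.Yields x W s m)
    (hc : s.word coordIdx 0 = c) (hW : m * x.n + x.n < W) :
    (RExp.coord b k).Yields x W s (s.row x.n b m c) :=
  .cell (.add (.mul hk (.size (by lia)) (by lia)) (.reg hc (by lia)) (by lia))

/-- Compute the coordinates of the vector number `k` of the real array `a` by the expression `e`,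
in which the register `coordIdx` holds the index of the coordinate. -/
def fill (a : ℕ) (k : WExp) (e : RExp) : Prog :=
  forLoop coordIdx .size (.setReal a (.add (.mul k .size) (.reg coordIdx)) e)

theorem runs_fill {a m : ℕ} {k : WExp} {e : RExp} {v : EuclideanSpace ℝ (Fin x.n)} (hn : 0 < x.n)
    (hW : m * x.n + x.n < W) (hk : k.Persists x W s [coordIdx] m) (hkc : k.cost ≤ 2)
    (hec : e.cost ≤ 32)
    (he : ∀ (c : Fin x.n) s', AgreeOff [coordIdx] [a] s s' → s'.word coordIdx 0 = c →
      s'.row x.n a m c = s.row x.n a m c → e.Yields x W s' (v c)) :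
    Runs x W (fill a k e) s (80 * x.n) fun s' =>
      s'.row x.n a m = v ∧ ∀ l ≠ m, s'.row x.n a l = s.row x.n a l := by
  have hcell {l : ℕ} (hl : l ≠ m) (c d : Fin x.n) : l * x.n + c ≠ m * x.n + d := fun h => by
    have := congrArg (· / x.n) h
    simp only [Nat.mul_comm _ x.n, Nat.mul_add_div hn, Nat.div_eq_of_lt (Fin.is_lt _)] at this
    lia
  refine .le (Runs.imp (runs_forLoop (c := 40) (fun d s' =>
    (∀ c : Fin x.n, c < d → s'.row x.n a m c = v c) ∧
    (∀ c : Fin x.n, d ≤ c → s'.row x.n a m c = s.row x.n a m c) ∧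
    ∀ l ≠ m, s'.row x.n a l = s.row x.n a l) (by simp [Prog.words]) (.size (by lia)) (by decide) hn
    (by lia) (fun _ _ _ h => h) ⟨by simp, by simp, by simp⟩ ?_) ?_) (by lia)
  · rintro d hd s₁ hs₁ hds₁ ⟨hlt, hge, hne⟩
    have hek := he ⟨d, hd⟩ s₁ hs₁ hds₁ (hge ⟨d, hd⟩ le_rfl)
    refine .le (.imp (.setReal (.add (.mul (hk s₁ hs₁.word) (.size (by lia)) (by lia))
      (.reg hds₁ (by lia)) (by lia)) hek) fun s₂ _ h => ⟨fun c hc => ?_, fun c hc => ?_,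
        fun l hl => ?_⟩) (by simp only [WExp.cost]; lia)
    · obtain hc | hc := Nat.lt_succ_iff_lt_or_eq.1 hc
      · rw [← hlt c hc]
        exact h.2 _ (by lia)
      · obtain rfl : c = ⟨d, hd⟩ := Fin.ext hc
        exact h.1
    · rw [← hge c (by lia)]
      exact h.2 _ (by lia)
    · rw [← hne l hl]
      ext c
      exact h.2 _ (hcell hl c ⟨d, hd⟩)
  · rintro s₁ - ⟨h, -, hne⟩
    exact ⟨PiLp.ext fun c => h c c.2, hne⟩

/-- Set the vector number `0` of the real array `a` to zero. -/
def clear (a : ℕ) : Prog := fill a (.const 0) (.cast (.const 0))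

theorem runs_clear {a : ℕ} (hn : 0 < x.n) (hW : x.n < W) :
    Runs x W (clear a) s (80 * x.n) fun s' => s'.row x.n a 0 = 0 :=
  (runs_fill (v := 0) hn (by lia) (.const (Nat.zero_le _)) (by decide) (by decide)
    fun c s₁ _ _ _ => by simpa using RExp.Yields.cast (.const (Nat.zero_le _))).imp
    fun _ _ h => h.1

/-- Copy the vector number `l` of the real array `b` to the vector number `k` of the real
array `a`. -/
def copy (a : ℕ) (k : WExp) (b : ℕ) (l : WExp) : Prog := fill a k (.coord b l)

theorem runs_copy {a b i j : ℕ} {k l : WExp} (hn : 0 < x.n) (hab : b ≠ a)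
    (hi : i * x.n + x.n < W) (hj : j * x.n + x.n < W) (hk : k.Persists x W s [coordIdx] i)
    (hl : l.Persists x W s [coordIdx] j) (hkc : k.cost ≤ 2) (hlc : l.cost ≤ 2) :
    Runs x W (copy a k b l) s (80 * x.n) fun s' =>
      s'.row x.n a i = s.row x.n b j ∧ ∀ l ≠ i, s'.row x.n a l = s.row x.n a l :=
  runs_fill hn hi hk hkc (by simp only [RExp.cost, WExp.cost]; lia) fun c s₁ hs₁ hc _ => by
    rw [← hs₁.row (List.mem_singleton.not.2 hab)]
    exact .coord (hl s₁ hs₁.word) hc hj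

/-- Add `r` times the vector number `l` of the real array `b` to the vector number `k` of the real
array `a`. -/
def addMul (a : ℕ) (k : WExp) (r : RExp) (b : ℕ) (l : WExp) : Prog :=
  fill a k (.add (.coord a k) (.mul r (.coord b l)))

theorem runs_addMul {a b i j : ℕ} {k l : WExp} {r : RExp} {t : ℝ} (hn : 0 < x.n) (hab : b ≠ a)
    (hi : i * x.n + x.n < W) (hj : j * x.n + x.n < W) (hk : k.Persists x W s [coordIdx] i)
    (hl : l.Persists x W s [coordIdx] j) (hkc : k.cost ≤ 2) (hlc : l.cost ≤ 2) (hrc : r.cost ≤ 14)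
    (hr : ∀ s', AgreeOff [coordIdx] [a] s s' → r.Yields x W s' t) :
    Runs x W (addMul a k r b l) s (80 * x.n) fun s' =>
      s'.row x.n a i = s.row x.n a i + t • s.row x.n b j ∧
      ∀ l ≠ i, s'.row x.n a l = s.row x.n a l :=
  runs_fill hn hi hk hkc (by simp only [RExp.cost, WExp.cost]; lia) fun c s₁ hs₁ hc h => by
    rw [PiLp.add_apply, PiLp.smul_apply, smul_eq_mul, ← hs₁.row (List.mem_singleton.not.2 hab), ← h]
    exact .add (.coord (hk s₁ hs₁.word) hc hi) (.mul (hr s₁ hs₁) (.coord (hl s₁ hs₁.word) hc hj))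

/-- Assign `e` to the real register `a`. -/
abbrev setReg (a : ℕ) (e : RExp) : Prog := .setReal a (.const 0) e

theorem runs_setReg {a : ℕ} {e : RExp} {v : ℝ} (he : e.Yields x W s v) :
    Runs x W (setReg a e) s (e.cost + 2) fun s' => s'.real a 0 = v :=
  .le (.imp (.setReal (.const (Nat.zero_le _)) he) fun _ _ h => h.1) (by simp only [WExp.cost]; lia)

/-- Store the sum of the values of `e` for the values `0, 1, …` smaller than `n` of the
counter `i` in the real register `r`. -/
def sumLoop (i r : ℕ) (e : RExp) : Prog :=
  .seq (setReg r (.cast (.const 0))) (forLoop i .size (setReg r (.add (.reg r) e)))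

theorem runs_sumLoop {i r : ℕ} {e : RExp} (g : Fin x.n → ℝ) (hn : 0 < x.n) (hW : x.n < W)
    (hec : e.cost ≤ 30)
    (he : ∀ (c : Fin x.n) s', AgreeOff [i] [r] s s' → s'.word i 0 = c → e.Yields x W s' (g c)) :
    Runs x W (sumLoop i r e) s (80 * x.n) fun s' => s'.real r 0 = ∑ c, g c := by
  let f (c : ℕ) : ℝ := if h : c < x.n then g ⟨c, h⟩ else 0
  have hf (c : Fin x.n) : f c = g c := dif_pos c.2
  simp only [← hf]
  rw [Fin.sum_univ_eq_sum_range f]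
  refine .le (c := 4 + x.n * (35 + 40)) (.seq (runs_setReg (.cast (.const (Nat.zero_le _))))
    fun s₁ hs₁ h₁ => ?_) (by lia)
  refine runs_forLoop (fun k s' => s'.real r 0 = ∑ c ∈ range k, f c) (by simp [Prog.words])
    (.size hW.le) (by decide) hn hW (fun _ _ _ h => h) (by simpa using h₁)
    fun k hk s₂ hs₂ hks₂ h₂ => ?_
  rw [sum_range_succ, hf ⟨k, hk⟩]
  have hs : AgreeOff [i] [r] s s₂ := (hs₁.mono (List.nil_subset _) (List.Subset.refl _)).trans hs₂
  exact .le (runs_setReg (.add (.reg h₂) (he ⟨k, hk⟩ s₂ hs hks₂)))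
    (by simp only [RExp.cost, WExp.cost]; lia)

/-- Store the inner product of the vector number `k` of the real array `a` and the vector
number `l` of the real array `b` in the real register `r`. -/
def dot (r a : ℕ) (k : WExp) (b : ℕ) (l : WExp) : Prog :=
  sumLoop coordIdx r (.mul (.coord a k) (.coord b l))

theorem runs_dot {r a b i j : ℕ} {k l : WExp} (hn : 0 < x.n) (ha : a ≠ r) (hb : b ≠ r)
    (hi : i * x.n + x.n < W) (hj : j * x.n + x.n < W) (hk : k.Persists x W s [coordIdx] i)
    (hl : l.Persists x W s [coordIdx] j) (hkc : k.cost ≤ 2) (hlc : l.cost ≤ 2) :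
    Runs x W (dot r a k b l) s (80 * x.n) fun s' =>
      s'.real r 0 = ⟪s.row x.n a i, s.row x.n b j⟫_ℝ := by
  have hsum : ⟪s.row x.n a i, s.row x.n b j⟫_ℝ = ∑ c, s.row x.n a i c * s.row x.n b j c := by
    simp only [PiLp.inner_apply, RCLike.inner_apply, conj_trivial, mul_comm]
  rw [hsum]
  refine runs_sumLoop _ hn (by lia) (by simp only [RExp.cost, WExp.cost]; lia)
    fun c s₁ hs₁ hcs₁ => ?_
  rw [← hs₁.row (List.mem_singleton.not.2 ha), ← hs₁.row (List.mem_singleton.not.2 hb)]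
  exact .mul (.coord (hk s₁ hs₁.word) hcs₁ hi) (.coord (hl s₁ hs₁.word) hcs₁ hj)

/-- The word bound `W` leaves room for `L + 1` vectors and for the loops of the algorithm with
sketches of length `L`. -/
structure Fits (x : Input) (W L : ℕ) : Prop where
  n_pos : 0 < x.n
  L_pos : 0 < L
  room : (L + 2) * (x.n + 2) + 2 * L ^ 2 + 100 ≤ W

namespace Fits

theorem row_lt (h : Fits x W L) {k : ℕ} (hk : k ≤ L) : k * x.n + x.n < W := by
  nlinarith [h.room, Nat.mul_le_mul_right x.n hk]

theorem n_lt (h : Fits x W L) : x.n + 100 < W := by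
  nlinarith [h.room]

theorem L_lt (h : Fits x W L) : L + 100 < W := by
  nlinarith [h.room, h.n_pos]

theorem sq_lt (h : Fits x W L) : 2 * (L * L) + 100 < W := by
  nlinarith [h.room]

end Fits

/-- The operator `∑ k ≤ L, w k • ⟪v k, ·⟫ v k` of the stored vectors `v k` and weights `w k`. -/
noncomputable def Store.op (s : Store) (n L : ℕ) :
    EuclideanSpace ℝ (Fin n) →ₗ[ℝ] EuclideanSpace ℝ (Fin n) :=
  gramOp (range (L + 1)) (s.real weights) (s.row n vecs)

theorem AgreeOff.op {ws rs : List ℕ} (h : AgreeOff ws rs s s') (hw : weights ∉ rs)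
    (hv : vecs ∉ rs) (n L : ℕ) : s'.op n L = s.op n L := by
  rw [Store.op, Store.op, h.real _ hw, funext (h.row hv n)]

/-- Store the image of the vector `cur` under the operator in the vector `image`. -/
def applyOp : Prog :=
  .seq (clear image) <|
  forLoop termIdx (.add (.reg sketchLen) (.const 1)) <|
  .seq (dot coeff vecs (.reg termIdx) cur (.const 0)) <|
  addMul image (.const 0) (.mul (.cell weights (.reg termIdx)) (.reg coeff)) vecs (.reg termIdx)

theorem runs_applyOp (hF : Fits x W L) (hL : s.word sketchLen 0 = L) :
    Runs x W applyOp s (300 * (L + 1) * x.n) fun s' =>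
      s'.row x.n image 0 = s.op x.n L (s.row x.n cur 0) := by
  have hn := hF.n_pos
  have hnW := hF.n_lt
  have hLW := hF.L_lt
  refine .le (c := 80 * x.n + (L + 1) * (80 * x.n + 80 * x.n + 40))
    (.seq (runs_clear hn (by lia)) fun s₁ hs₁ h₁ => ?_) (by nlinarith)
  refine runs_forLoop (fun k s' => s'.row x.n image 0 =
      gramOp (range k) (s.real weights) (s.row x.n vecs) (s.row x.n cur 0)) (by decide)
    (fun s₂ hs₂ => .add (.reg ?_ (by lia)) (.const (by lia)) (by lia)) (by decide) (by lia)
    (by lia) (fun _ _ _ h => h) (by simp [h₁, gramOp_apply]) fun k hk s₂ hs₂ hks₂ h₂ => ?_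
  · rw [hs₂ _ (by decide), hs₁.word _ (by decide), hL]
  have hkW := hF.row_lt (Nat.lt_succ_iff.1 hk)
  refine .seq (runs_dot hn (by decide) (by decide) hkW (by lia) (.reg (by decide) hks₂ (by lia))
    (.const (by lia)) (by decide) (by decide)) fun s₃ hs₃ h₃ => ?_
  have hks₃ : s₃.word termIdx 0 = k := by rw [hs₃.word _ (by decide), hks₂]
  refine (runs_addMul (t := s.real weights k * ⟪s.row x.n vecs k, s.row x.n cur 0⟫_ℝ) hn (by decide)
    (by lia) hkW (.const (by lia)) (.reg (by decide) hks₃ (by lia)) (by decide) (by decide)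
    (by decide) fun s₄ hs₄ => ?_).imp fun _ _ h₄ => ?_
  · have hw : s₄.real weights = s.real weights := by
      rw [hs₄.real _ (by decide), hs₃.real _ (by decide), hs₂.real _ (by decide),
        hs₁.real _ (by decide)]
    rw [← hw]
    refine .mul (.cell (.reg (by rw [hs₄.word _ (by decide), hks₃]) (by lia))) (.reg ?_)
    rw [hs₄.real _ (by decide), h₃, hs₂.row (by decide), hs₂.row (by decide), hs₁.row (by decide),
      hs₁.row (by decide)]
  · rw [h₄.1, hs₃.row (by decide), h₂, gramOp_apply, gramOp_apply, sum_range_succ,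
      hs₃.row (by decide) _ k, hs₂.row (by decide) _ k, hs₁.row (by decide) _ k]

/-- The vector `best` and the registers `bestNum` and `bestDen` hold a best vector among `Z`. -/
def Store.HoldsBest (s : Store) {n : ℕ} (L : ℕ)
    (T : EuclideanSpace ℝ (Fin n) →ₗ[ℝ] EuclideanSpace ℝ (Fin n))
    (Z : Set (EuclideanSpace ℝ (Fin n))) : Prop :=
  IsBest ((L : ℝ) ^ 2) T Z (s.row n best 0) (s.real bestNum 0) (s.real bestDen 0)

section

variable {T : EuclideanSpace ℝ (Fin x.n) →ₗ[ℝ] EuclideanSpace ℝ (Fin x.n)}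
  {Z : Set (EuclideanSpace ℝ (Fin x.n))}

theorem AgreeOff.holdsBest {ws rs : List ℕ} (h : AgreeOff ws rs s s') (hb : s.HoldsBest L T Z)
    (h₁ : best ∉ rs) (h₂ : bestNum ∉ rs) (h₃ : bestDen ∉ rs) : s'.HoldsBest L T Z := by
  rwa [Store.HoldsBest, h.row h₁, h.real _ h₂, h.real _ h₃]

/-- The test whether the vector `cur` is aligned and has a larger Rayleigh quotient than `best`. -/
def improves : Test :=
  .and (.not (.realLE (.mul (.reg curNum) (.reg bestDen)) (.mul (.reg bestNum) (.reg curDen))))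
    (.realLE (.mul (.cast (.mul (.reg sketchLen) (.reg sketchLen)))
        (.mul (.reg imageSq) (.reg curDen)))
      (.mul (.cast (.add (.mul (.reg sketchLen) (.reg sketchLen)) (.const 1)))
        (.mul (.reg curNum) (.reg curNum))))

theorem decides_improves {z : EuclideanSpace ℝ (Fin x.n)} (hF : Fits x W L)
    (hL : s.word sketchLen 0 = L) (hnum : s.real curNum 0 = ⟪z, T z⟫_ℝ)
    (hden : s.real curDen 0 = ‖z‖ ^ 2) (hsq : s.real imageSq 0 = ‖T z‖ ^ 2) :
    improves.Decides x W s (s.real bestNum 0 * ‖z‖ ^ 2 < ⟪z, T z⟫_ℝ * s.real bestDen 0 ∧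
      Aligned ((L : ℝ) ^ 2) T z) := by
  have hLW := hF.L_lt
  have hL2 := hF.sq_lt
  have hsL : (WExp.mul (.reg sketchLen) (.reg sketchLen)).Yields x W s (L * L) :=
    .mul (.reg hL (by lia)) (.reg hL (by lia)) (by lia)
  have h := Test.Decides.and
    (.not (.realLE (.mul (.reg hnum) (.reg (a := bestDen) rfl))
      (.mul (.reg (a := bestNum) rfl) (.reg hden))))
    (.realLE (.mul (.cast hsL) (.mul (.reg hsq) (.reg hden)))
      (.mul (.cast (.add hsL (.const (u := 1) (by lia)) (by lia))) (.mul (.reg hnum) (.reg hnum))))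
  simpa only [improves, Aligned, not_le, Nat.cast_add, Nat.cast_mul, Nat.cast_one, sq (L : ℝ),
    sq ⟪z, T z⟫_ℝ] using h

/-- Replace the vector `best` by the vector `cur` if this is an improvement. -/
def improve : Prog :=
  .seq (dot curNum cur (.const 0) image (.const 0)) <|
  .seq (dot curDen cur (.const 0) cur (.const 0)) <|
  .seq (dot imageSq image (.const 0) image (.const 0)) <|
  .ite improves
    (.seq (copy best (.const 0) cur (.const 0)) <|
      .seq (setReg bestNum (.reg curNum)) (setReg bestDen (.reg curDen)))
    .skip

theorem runs_improve (hF : Fits x W L) (hL : s.word sketchLen 0 = L)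
    (hT : s.row x.n image 0 = T (s.row x.n cur 0)) (hb : s.HoldsBest L T Z) :
    Runs x W improve s (400 * x.n) fun s' => s'.HoldsBest L T (insert (s.row x.n cur 0) Z) := by
  have hn := hF.n_pos
  have hnW := hF.n_lt
  have hdot {t : Store} {r a b : ℕ} (ha : a ≠ r) (hb : b ≠ r) :
      Runs x W (dot r a (.const 0) b (.const 0)) t (80 * x.n) fun t' =>
        t'.real r 0 = ⟪t.row x.n a 0, t.row x.n b 0⟫_ℝ :=
    runs_dot hn ha hb (by lia) (by lia) (.const (Nat.zero_le _)) (.const (Nat.zero_le _))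
      (by decide) (by decide)
  refine .le (c := 80 * x.n + (80 * x.n + (80 * x.n + (40 + (80 * x.n + (4 + 4))))))
    (.seq (hdot (by decide) (by decide)) fun s₁ hs₁ h₁ => .seq (hdot (by decide) (by decide))
      fun s₂ hs₂ h₂ => .seq (hdot (by decide) (by decide)) fun s₃ hs₃ h₃ => ?_) (by lia)
  have hnum : s₃.real curNum 0 = ⟪s.row x.n cur 0, T (s.row x.n cur 0)⟫_ℝ := by
    rw [hs₃.real _ (by decide), hs₂.real _ (by decide), h₁, hT]
  have hden : s₃.real curDen 0 = ‖s.row x.n cur 0‖ ^ 2 := by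
    rw [hs₃.real _ (by decide), h₂, hs₁.row (by decide), real_inner_self_eq_norm_sq]
  have hsq : s₃.real imageSq 0 = ‖T (s.row x.n cur 0)‖ ^ 2 := by
    rw [h₃, hs₂.row (by decide), hs₁.row (by decide), hT, real_inner_self_eq_norm_sq]
  have hb₃ : s₃.HoldsBest L T Z := hs₃.holdsBest (hs₂.holdsBest (hs₁.holdsBest hb (by decide)
    (by decide) (by decide)) (by decide) (by decide) (by decide)) (by decide) (by decide)
    (by decide)
  have hL₃ : s₃.word sketchLen 0 = L := by
    rw [hs₃.word _ (by decide), hs₂.word _ (by decide), hs₁.word _ (by decide), hL]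
  refine .ite (decides_improves hF hL₃ hnum hden hsq) (fun ⟨hlt, hal⟩ => ?_) fun h => ?_
  · refine .seq (runs_copy hn (by decide) (by lia) (by lia) (.const (Nat.zero_le _))
      (.const (Nat.zero_le _)) (by decide) (by decide)) fun s₄ hs₄ h₄ => .seq
      (runs_setReg (.reg rfl)) fun s₅ hs₅ h₅ => (runs_setReg (.reg rfl)).imp fun s₆ hs₆ h₆ => ?_
    have hbest : s₆.row x.n best 0 = s.row x.n cur 0 := by
      rw [hs₆.row (by decide), hs₅.row (by decide), h₄.1, hs₃.row (by decide), hs₂.row (by decide),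
        hs₁.row (by decide)]
    rw [Store.HoldsBest, hbest, hs₆.real bestNum (by decide), h₅, hs₄.real _ (by decide), hnum, h₆,
      hs₅.real _ (by decide), hs₄.real _ (by decide), hden]
    exact hb₃.insert_of_lt hal hlt
  · exact .le (.skip (hb₃.insert_of_not_lt fun hal => not_lt.1 fun hlt => h ⟨hlt, hal⟩)) (by lia)

end

/-- Let the vector `cur` compete for `best`, and replace it by its image under the operator. -/
def iterate : Prog := .seq applyOp <| .seq improve <| copy cur (.const 0) image (.const 0)

theorem runs_iterate (hF : Fits x W L) (hL : s.word sketchLen 0 = L)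
    {Z : Set (EuclideanSpace ℝ (Fin x.n))} (hb : s.HoldsBest L (s.op x.n L) Z) :
    Runs x W iterate s (800 * (L + 1) * x.n) fun s' =>
      s'.row x.n cur 0 = s.op x.n L (s.row x.n cur 0) ∧
      s'.HoldsBest L (s.op x.n L) (insert (s.row x.n cur 0) Z) := by
  have hn := hF.n_pos
  have hnW := hF.n_lt
  refine .le (c := 300 * (L + 1) * x.n + (400 * x.n + 80 * x.n)) (.seq (runs_applyOp hF hL)
    fun s₁ hs₁ h₁ => .seq (runs_improve hF ?_ ?_ (hs₁.holdsBest hb (by decide) (by decide)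
    (by decide))) fun s₂ hs₂ h₂ => .imp (runs_copy hn (by decide) (by lia) (by lia)
    (.const (Nat.zero_le _)) (.const (Nat.zero_le _)) (by decide) (by decide)) fun s₃ hs₃ h₃ =>
    ⟨?_, ?_⟩) (by nlinarith)
  · rw [hs₁.word _ (by decide), hL]
  · rw [h₁, hs₁.row (by decide)]
  · rw [h₃.1, hs₂.row (by decide), h₁]
  · rw [← hs₁.row (by decide)]
    exact hs₃.holdsBest h₂ (by decide) (by decide) (by decide)

/-- Let the iterates `T ^ q` of the vector `cur`, with `q < 2 * L ^ 2`, compete for `best`. -/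
def searchOrbit : Prog :=
  forLoop powIdx (.mul (.const 2) (.mul (.reg sketchLen) (.reg sketchLen))) iterate

theorem runs_searchOrbit (hF : Fits x W L) (hL : s.word sketchLen 0 = L)
    {Z : Set (EuclideanSpace ℝ (Fin x.n))} (hb : s.HoldsBest L (s.op x.n L) Z) :
    Runs x W searchOrbit s (1700 * L ^ 2 * (L + 1) * x.n) fun s' =>
      s'.HoldsBest L (s.op x.n L) (iterates (s.op x.n L) {s.row x.n cur 0} (2 * L ^ 2) ∪ Z) := by
  have hn := hF.n_pos
  have hLpos := hF.L_pos
  have hLW := hF.L_lt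
  have hL2 := hF.sq_lt
  set T := s.op x.n L
  set y := s.row x.n cur 0
  have hcost : 2 * (L * L) * (800 * (L + 1) * x.n + 40) ≤ 1700 * L ^ 2 * (L + 1) * x.n := by
    have : 1 ≤ (L + 1) * x.n := Nat.mul_pos (by lia) hn
    nlinarith [Nat.mul_le_mul_left (L ^ 2) this]
  refine .le (.imp (runs_forLoop (fun k s' => s'.row x.n cur 0 = (T ^ k) y ∧
    s'.HoldsBest L T (iterates T {y} k ∪ Z)) (by decide) (fun s₁ hs₁ => .mul (.const (by lia))
    (.mul (.reg ?_ (by lia)) (.reg ?_ (by lia)) (by lia)) (by lia)) (by decide)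
    (by positivity) (by lia) (fun _ _ _ h => h) ⟨rfl, by simpa [iterates_zero] using hb⟩
    fun k _ s₁ hs₁ _ h₁ => ?_) fun s₁ _ h₁ => ?_) hcost
  · rw [hs₁ _ (by decide), hL]
  · rw [hs₁ _ (by decide), hL]
  · have hT : s₁.op x.n L = T := hs₁.op (by decide) (by decide) _ _
    refine (runs_iterate hF ?_ ((congrArg (s₁.HoldsBest L · _) hT).mpr h₁.2)).imp
      fun s₂ _ h₂ => ?_
    · rw [hs₁.word _ (by decide), hL]
    rw [hT, h₁.1] at h₂
    rw [pow_succ', iterates_singleton_succ, Set.insert_union]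
    exact h₂
  · rw [sq]
    exact h₁.2

/-- Let zero, with the Rayleigh quotient `0 / 1`, be the best vector. -/
def resetBest : Prog :=
  .seq (clear best) <|
  .seq (setReg bestNum (.cast (.const 0))) (setReg bestDen (.cast (.const 1)))

theorem runs_resetBest (hn : 0 < x.n) (hW : x.n < W)
    (T : EuclideanSpace ℝ (Fin x.n) →ₗ[ℝ] EuclideanSpace ℝ (Fin x.n)) :
    Runs x W resetBest s (90 * x.n) fun s' => s'.HoldsBest L T ∅ := by
  refine .le (.seq (runs_clear hn hW) fun s₁ _ h₁ => .seq (runs_setReg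
    (.cast (.const (Nat.zero_le _)))) fun s₂ hs₂ h₂ => (runs_setReg
    (.cast (.const (by lia)))).imp fun s₃ hs₃ h₃ => ?_) (c := 80 * x.n + (4 + 4)) (by lia)
  rw [Store.HoldsBest, hs₃.row (by decide), hs₂.row (by decide), h₁, hs₃.real bestNum (by decide),
    h₂, h₃, Nat.cast_zero, Nat.cast_one]
  exact .empty _ _

/-- Find a best vector among the iterates of the stored vectors. -/
def findBest : Prog :=
  .seq resetBest <|
  forLoop vecIdx (.add (.reg sketchLen) (.const 1)) <|
  .seq (copy cur (.const 0) vecs (.reg vecIdx)) searchOrbit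

theorem runs_findBest (hF : Fits x W L) (hL : s.word sketchLen 0 = L) :
    Runs x W findBest s (2000 * L ^ 2 * (L + 1) ^ 2 * x.n) fun s' =>
      s'.HoldsBest L (s.op x.n L)
        (iterates (s.op x.n L) (s.row x.n vecs '' (range (L + 1) : Set ℕ)) (2 * L ^ 2)) := by
  have hn := hF.n_pos
  have hLpos := hF.L_pos
  have hnW := hF.n_lt
  have hLW := hF.L_lt
  set T := s.op x.n L
  set v := s.row x.n vecs
  have hcost : 90 * x.n + (L + 1) * (80 * x.n + 1700 * L ^ 2 * (L + 1) * x.n + 40) ≤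
      2000 * L ^ 2 * (L + 1) ^ 2 * x.n := by
    have h : 1 ≤ (L + 1) * x.n := Nat.mul_pos (by lia) hn
    have h' : 1 * ((L + 1) * x.n) ≤ (L ^ 2 * (L + 1)) * ((L + 1) * x.n) :=
      Nat.mul_le_mul_right _ (Nat.mul_pos (by positivity) (by lia))
    have h'' : (L + 1) * 1 ≤ L ^ 2 * (L + 1) * ((L + 1) * x.n) :=
      Nat.mul_le_mul (Nat.le_mul_of_pos_left _ (by positivity)) h
    nlinarith
  refine .le (.seq (runs_resetBest (L := L) hn (by lia) T) fun s₁ hs₁ h₁ => ?_) hcost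
  refine runs_forLoop (fun k s' => s'.HoldsBest L T (iterates T (v '' (range k : Set ℕ))
    (2 * L ^ 2))) (by decide) (fun s₂ hs₂ => .add (.reg ?_ (by lia)) (.const (by lia)) (by lia))
    (by decide) (by lia) (by lia) (fun _ _ _ h => h) (by simpa [iterates] using h₁)
    fun k hk s₂ hs₂ hk₂ h₂ => ?_
  · rw [hs₂ _ (by decide), hs₁.word _ (by decide), hL]
  have hkW := hF.row_lt (Nat.lt_succ_iff.1 hk)
  refine .seq (runs_copy hn (by decide) (by lia) hkW (.const (by lia))
    (.reg (by decide) hk₂ (by lia)) (by decide) (by decide)) fun s₃ hs₃ h₃ => ?_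
  have hT₃ : s₃.op x.n L = T := by
    rw [hs₃.op (by decide) (by decide), hs₂.op (by decide) (by decide),
      hs₁.op (by decide) (by decide)]
  have hL₃ : s₃.word sketchLen 0 = L := by
    rw [hs₃.word _ (by decide), hs₂.word _ (by decide), hs₁.word _ (by decide), hL]
  have hv₂ : s₂.row x.n vecs k = v k := by rw [hs₂.row (by decide), hs₁.row (by decide)]
  have hb₃ := hs₃.holdsBest h₂ (by decide) (by decide) (by decide)
  have h := runs_searchOrbit hF hL₃ ((congrArg (s₃.HoldsBest L · _) hT₃).mpr hb₃)
  rwa [hT₃, h₃.1, hv₂, ← iterates_insert, ← Set.image_insert_eq, ← coe_insert,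
    ← range_add_one] at h

theorem Store.HoldsBest.gramForm_le {n : ℕ} (hL : 0 < L)
    (hw : ∀ k ∈ range (L + 1), 0 ≤ s.real weights k)
    (h : s'.HoldsBest L (s.op n L)
      (iterates (s.op n L) (s.row n vecs '' (range (L + 1) : Set ℕ)) (2 * L ^ 2)))
    (y : EuclideanSpace ℝ (Fin n)) :
    gramForm (range (L + 1)) (s.real weights) (s.row n vecs) y * s'.real bestDen 0 ≤
      2 * s'.real bestNum 0 * ‖y‖ ^ 2 := by
  have hpow := two_le_one_add_one_div_pow (N := L ^ 2) (by positivity)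
  rw [Nat.cast_pow] at hpow
  refine IsBest.gramForm_le hw (by positivity) hpow ?_ h y
  calc #(range (L + 1)) = L + 1 := card_range _
    _ ≤ 2 ^ L := Nat.lt_two_pow_self
    _ ≤ 2 ^ (2 * L ^ 2 + 1) := Nat.pow_le_pow_right two_pos (by nlinarith)

/-- Store the inverse of the nonnegative register `b` in the register `r`; the inverse of zero is
zero. -/
def invert (r b : ℕ) : Prog :=
  .ite (.realLE (.reg b) (.cast (.const 0))) (setReg r (.cast (.const 0)))
    (setReg r (.div (.cast (.const 1)) (.reg b)))

theorem runs_invert {r b : ℕ} (hW : 1 ≤ W) (hb : 0 ≤ s.real b 0) :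
    Runs x W (invert r b) s 13 fun s' => s'.real r 0 = (s.real b 0)⁻¹ := by
  refine .le (c := 5 + 7) (.ite (.realLE (.reg (a := b) rfl) (.cast (.const (Nat.zero_le _))))
    (fun h => ?_) fun h => ?_) (by decide)
  · rw [hb.antisymm' (by simpa using h), _root_.inv_zero]
    exact .le (by simpa using runs_setReg (.cast (.const (Nat.zero_le _)))) (by decide)
  · exact (runs_setReg (.div (.cast (.const hW)) (.reg rfl) fun h0 => h (by simp [h0]))).imp
      fun _ _ h => by simpa using h

/-- Subtract from the current vector its component in the direction of the vector `best`, whose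
image under the operator is the vector `image`, where the register `recip` holds the inverse of the
value of the form at `best`. -/
def deflateVec : Prog :=
  .seq (dot coeff vecs (.reg vecIdx) best (.const 0)) <|
  addMul vecs (.reg vecIdx) (.mul (.sub (.cast (.const 0)) (.reg coeff)) (.reg recip))
    image (.const 0)

theorem runs_deflateVec {k : ℕ} (hn : 0 < x.n) (hW : k * x.n + x.n < W) (hkW : k ≤ W)
    (hk : s.word vecIdx 0 = k) {T : EuclideanSpace ℝ (Fin x.n) →ₗ[ℝ] EuclideanSpace ℝ (Fin x.n)}
    (hT : s.row x.n image 0 = T (s.row x.n best 0))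
    (hr : s.real recip 0 = (⟪s.row x.n best 0, T (s.row x.n best 0)⟫_ℝ)⁻¹) :
    Runs x W deflateVec s (160 * x.n) fun s' =>
      s'.row x.n vecs k = _root_.deflate T (s.row x.n best 0) (s.row x.n vecs k) ∧
      ∀ l ≠ k, s'.row x.n vecs l = s.row x.n vecs l := by
  set b := s.row x.n best 0
  refine .le (.seq (runs_dot hn (by decide) (by decide) hW (by lia)
    (.reg (by decide) hk hkW) (.const (Nat.zero_le _)) (by decide) (by decide))
    fun s₁ hs₁ h₁ => .imp (runs_addMul (t := (0 - ⟪s.row x.n vecs k, b⟫_ℝ) * (⟪b, T b⟫_ℝ)⁻¹) hn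
      (by decide) hW (by lia) (.reg (by decide) (by rw [hs₁.word _ (by decide), hk]) hkW)
      (.const (Nat.zero_le _)) (by decide) (by decide) (by decide) fun s₂ hs₂ => ?_)
    fun s₂ _ h₂ => ⟨?_, fun l hl => ?_⟩) (by lia)
  · have hc : s₂.real coeff 0 = ⟪s.row x.n vecs k, b⟫_ℝ := by rw [hs₂.real _ (by decide), h₁]
    have hr₂ : s₂.real recip 0 = (⟪b, T b⟫_ℝ)⁻¹ := by
      rw [hs₂.real _ (by decide), hs₁.real _ (by decide), hr]
    simpa using RExp.Yields.mul (.sub (.cast (.const (Nat.zero_le _))) (.reg hc)) (.reg hr₂)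
  · rw [h₂.1, hs₁.row (by decide), hs₁.row (by decide), hT, _root_.deflate, zero_sub, neg_mul,
      neg_smul, sub_eq_add_neg]
  · rw [h₂.2 l hl, hs₁.row (by decide)]

/-- Subtract from all stored vectors their components in the direction of the vector `best`. -/
def deflateVecs : Prog := forLoop vecIdx (.add (.reg sketchLen) (.const 1)) deflateVec

theorem runs_deflateVecs (hF : Fits x W L) (hL : s.word sketchLen 0 = L)
    {T : EuclideanSpace ℝ (Fin x.n) →ₗ[ℝ] EuclideanSpace ℝ (Fin x.n)}
    (hT : s.row x.n image 0 = T (s.row x.n best 0))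
    (hr : s.real recip 0 = (⟪s.row x.n best 0, T (s.row x.n best 0)⟫_ℝ)⁻¹) :
    Runs x W deflateVecs s (300 * (L + 1) * x.n) fun s' => ∀ k ∈ range (L + 1),
      s'.row x.n vecs k = _root_.deflate T (s.row x.n best 0) (s.row x.n vecs k) := by
  have hn := hF.n_pos
  have hLW := hF.L_lt
  set b := s.row x.n best 0
  refine .le (.imp (runs_forLoop (c := 160 * x.n) (fun k s' =>
    (∀ l < k, s'.row x.n vecs l = _root_.deflate T b (s.row x.n vecs l)) ∧
    ∀ l ≥ k, s'.row x.n vecs l = s.row x.n vecs l) (by decide)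
    (fun s₁ hs₁ => .add (.reg ?_ (by lia)) (.const (by lia)) (by lia)) (by decide) (by lia)
    (by lia) (fun _ _ _ h => h) ⟨fun _ h => absurd h (Nat.not_lt_zero _), fun _ _ => rfl⟩
    fun k hk s₁ hs₁ hk₁ ⟨hlt, hge⟩ => ?_) fun s₁ _ h₁ k hk => h₁.1 k (mem_range.1 hk))
    (by nlinarith)
  · rw [hs₁ _ (by decide), hL]
  have hb₁ : s₁.row x.n best 0 = b := hs₁.row (by decide) _ _
  refine (runs_deflateVec (T := T) hn (hF.row_lt (Nat.lt_succ_iff.1 hk)) (by lia) hk₁ ?_ ?_).imp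
    fun s₂ _ h₂ => ⟨fun l hl => ?_, fun l hl => ?_⟩
  · rw [hs₁.row (by decide), hb₁, hT]
  · rw [hs₁.real _ (by decide), hb₁, hr]
  · obtain hl | rfl := Nat.lt_succ_iff_lt_or_eq.1 hl
    · rw [h₂.2 l hl.ne, hlt l hl]
    · rw [h₂.1, hb₁, hge l le_rfl]
  · rw [h₂.2 l (by lia), hge l (by lia)]

/-- Store the image of the vector `best` under the operator as a new direction, with the inverse of
`bestNum` as its weight. -/
def recordDirection : Prog :=
  .seq (copy cur (.const 0) best (.const 0)) <|
  .seq applyOp <|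
  .seq (copy dirs (.reg roundIdx) image (.const 0)) <|
  .seq (invert recip bestNum) <|
  .setReal dirWeights (.reg roundIdx) (.reg recip)

theorem runs_recordDirection (hF : Fits x W L) (hL : s.word sketchLen 0 = L) {j : ℕ} (hj : j < L)
    (hjs : s.word roundIdx 0 = j) (hb : 0 ≤ s.real bestNum 0) :
    Runs x W recordDirection s (500 * (L + 1) * x.n) fun s' =>
      s'.row x.n image 0 = s.op x.n L (s.row x.n best 0) ∧
      s'.real recip 0 = (s.real bestNum 0)⁻¹ ∧
      (s'.row x.n dirs j = s.op x.n L (s.row x.n best 0) ∧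
        ∀ t ≠ j, s'.row x.n dirs t = s.row x.n dirs t) ∧
      (s'.real dirWeights j = (s.real bestNum 0)⁻¹ ∧
        ∀ t ≠ j, s'.real dirWeights t = s.real dirWeights t) := by
  have hn := hF.n_pos
  have hLW := hF.L_lt
  have hjW := hF.row_lt hj.le
  refine .le (c := 80 * x.n + (300 * (L + 1) * x.n + (80 * x.n + (13 + 5))))
    (.seq (runs_copy hn (by decide) (by lia) (by lia) (.const (Nat.zero_le _))
      (.const (Nat.zero_le _)) (by decide) (by decide)) fun s₁ hs₁ h₁ =>
    .seq (runs_applyOp hF (by rw [hs₁.word _ (by decide), hL])) fun s₂ hs₂ h₂ =>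
    .seq (runs_copy hn (by decide) hjW (by lia)
      (.reg (by decide) (by rw [hs₂.word _ (by decide), hs₁.word _ (by decide), hjs]) (by lia))
      (.const (Nat.zero_le _)) (by decide) (by decide)) fun s₃ hs₃ h₃ =>
    .seq (runs_invert (by lia) ?_) fun s₄ hs₄ h₄ =>
    .imp (.setReal (.reg (v := j) ?_ (by lia)) (.reg h₄)) fun s₅ hs₅ h₅ => ?_) (by nlinarith)
  · rwa [hs₃.real _ (by decide), hs₂.real _ (by decide), hs₁.real _ (by decide)]
  · rw [hs₄.word _ (by decide), hs₃.word _ (by decide), hs₂.word _ (by decide),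
      hs₁.word _ (by decide), hjs]
  have himage : s₂.row x.n image 0 = s.op x.n L (s.row x.n best 0) := by
    rw [h₂, hs₁.op (by decide) (by decide), h₁.1]
  have hnum : s₃.real bestNum 0 = s.real bestNum 0 := by
    rw [hs₃.real _ (by decide), hs₂.real _ (by decide), hs₁.real _ (by decide)]
  rw [hnum] at h₄ h₅
  refine ⟨?_, ?_, ⟨?_, fun t ht => ?_⟩, h₅.1, fun t ht => ?_⟩
  · rw [hs₅.row (by decide), hs₄.row (by decide), hs₃.row (by decide), himage]
  · rw [hs₅.real _ (by decide), h₄]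
  · rw [hs₅.row (by decide), hs₄.row (by decide), h₃.1, himage]
  · rw [hs₅.row (by decide), hs₄.row (by decide), h₃.2 t ht, hs₂.row (by decide),
      hs₁.row (by decide)]
  · rw [h₅.2 t ht, hs₄.real _ (by decide), hs₃.real _ (by decide), hs₂.real _ (by decide),
      hs₁.real _ (by decide)]

/-- The stored vectors arise from the vectors `v₀` by `j` rounds of deflation, in which the stored
directions were split off. -/
def Store.HoldsDeflated (s : Store) {n : ℕ} (L : ℕ) (v₀ : ℕ → EuclideanSpace ℝ (Fin n)) (j : ℕ) :
    Prop :=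
  Deflated ((L : ℝ) ^ 2) (range (L + 1)) (s.real weights) v₀ j (s.row n vecs) (s.row n dirs)
    (s.real dirWeights)

/-- Find a best vector, record it as a new direction, and deflate the stored vectors. -/
def deflateRound : Prog := .seq findBest <| .seq recordDirection deflateVecs

theorem runs_deflateRound (hF : Fits x W L) (hL : s.word sketchLen 0 = L) {j : ℕ} (hj : j < L)
    (hjs : s.word roundIdx 0 = j) (hw : ∀ k ∈ range (L + 1), 0 ≤ s.real weights k)
    {v₀ : ℕ → EuclideanSpace ℝ (Fin x.n)} (h : s.HoldsDeflated L v₀ j) :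
    Runs x W deflateRound s (3000 * L ^ 2 * (L + 1) ^ 2 * x.n) fun s' =>
      s'.HoldsDeflated L v₀ (j + 1) := by
  have hcost : 2000 * L ^ 2 * (L + 1) ^ 2 * x.n + (500 * (L + 1) * x.n + 300 * (L + 1) * x.n) ≤
      3000 * L ^ 2 * (L + 1) ^ 2 * x.n := by
    have : 1 * ((L + 1) * x.n) ≤ (L ^ 2 * (L + 1)) * ((L + 1) * x.n) :=
      Nat.mul_le_mul_right _ (Nat.mul_pos (pow_pos hF.L_pos _) (by lia))
    nlinarith
  set T := s.op x.n L with hTs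
  refine .le (.seq (runs_findBest hF hL) fun s₁ hs₁ h₁ => .seq
    (runs_recordDirection hF (by rw [hs₁.word _ (by decide), hL]) hj
      (by rw [hs₁.word _ (by decide), hjs]) h₁.num_nonneg)
    fun s₂ hs₂ ⟨himage, hrecip, hdirs, hdirWeights⟩ => ?_) hcost
  set b := s₁.row x.n best 0
  have hT₁ : s₁.op x.n L = T := hs₁.op (by decide) (by decide) _ _
  rw [hT₁] at himage hdirs
  have hb₂ : s₂.row x.n best 0 = b := hs₂.row (by decide) _ _
  rw [← hb₂] at himage
  refine .imp (runs_deflateVecs hF (by rw [hs₂.word _ (by decide), hs₁.word _ (by decide), hL])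
    himage (by rw [hrecip, h₁.num_eq, hb₂])) fun s₃ hs₃ h₃ => ?_
  have hsucc := (h.congr (fun _ _ => rfl) (u' := s₃.row x.n dirs) (e' := s₃.real dirWeights)
    (fun t ht => ?_) fun t ht => ?_).succ (by positivity) h₁ (h₁.gramForm_le hF.L_pos hw) ?_ ?_
  · rw [Store.HoldsDeflated, hs₃.real weights (by decide), hs₂.real weights (by decide),
      hs₁.real weights (by decide)]
    refine hsucc.congr (fun k hk => ?_) (fun _ _ => rfl) fun _ _ => rfl
    rw [h₃ k hk, hb₂, hs₂.row (by decide), hs₁.row (by decide), hTs, Store.op]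
  · rw [hs₃.row (by decide), hdirs.2 t ht.ne, hs₁.row (by decide)]
  · rw [hs₃.real _ (by decide), hdirWeights.2 t ht.ne, hs₁.real _ (by decide)]
  · rw [hs₃.row (by decide), hdirs.1, hTs, Store.op]
  · rw [hs₃.real _ (by decide), hdirWeights.1]

/-- Perform `L` rounds of deflation. -/
def deflateRounds : Prog := forLoop roundIdx (.reg sketchLen) deflateRound

theorem runs_deflateRounds (hF : Fits x W L) (hL : s.word sketchLen 0 = L)
    (hw : ∀ k ∈ range (L + 1), 0 ≤ s.real weights k) :
    Runs x W deflateRounds s (3100 * L ^ 3 * (L + 1) ^ 2 * x.n) fun s' =>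
      s'.HoldsDeflated L (s.row x.n vecs) L := by
  have hLW := hF.L_lt
  have hcost : L * (3000 * L ^ 2 * (L + 1) ^ 2 * x.n + 40) ≤
      3100 * L ^ 3 * (L + 1) ^ 2 * x.n := by
    have : L * 1 ≤ L * (L ^ 2 * (L + 1) ^ 2 * x.n) := Nat.mul_le_mul_left L
      (Nat.mul_pos (Nat.mul_pos (pow_pos hF.L_pos _) (by positivity)) hF.n_pos)
    nlinarith
  refine .le (runs_forLoop (fun k s' => s'.HoldsDeflated L (s.row x.n vecs) k) (by decide)
    (.reg (by decide) hL (by lia)) (by decide) hF.L_pos (by lia) (fun _ _ _ h => h)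
    (.zero _ _ _ _ _ _) fun k hk s₁ hs₁ hks₁ h₁ => runs_deflateRound hF ?_ hk hks₁ ?_ h₁) hcost
  · rw [hs₁.word _ (by decide), hL]
  · rwa [hs₁.real _ (by decide)]

/-- Replace the current vector by the current direction, whose weight is reduced by half of the
largest Rayleigh quotient found. -/
def storeDirection : Prog :=
  .seq (dot imageSq dirs (.reg roundIdx) dirs (.reg roundIdx)) <|
  .seq (invert recip imageSq) <|
  .seq (.setReal weights (.reg roundIdx) (.sub (.cell dirWeights (.reg roundIdx))
    (.mul (.div (.div (.reg bestNum) (.reg bestDen)) (.cast (.const 2))) (.reg recip)))) <|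
  copy vecs (.reg roundIdx) dirs (.reg roundIdx)

theorem runs_storeDirection {j : ℕ} (hn : 0 < x.n) (hW : j * x.n + x.n < W) (hjW : j ≤ W)
    (hW₂ : 2 ≤ W) (hj : s.word roundIdx 0 = j) (hb : s.real bestDen 0 ≠ 0) :
    Runs x W storeDirection s (200 * x.n) fun s' =>
      (s'.real weights j = s.real dirWeights j -
          s.real bestNum 0 / s.real bestDen 0 / 2 * (‖s.row x.n dirs j‖ ^ 2)⁻¹ ∧
        ∀ k ≠ j, s'.real weights k = s.real weights k) ∧
      (s'.row x.n vecs j = s.row x.n dirs j ∧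
        ∀ k ≠ j, s'.row x.n vecs k = s.row x.n vecs k) := by
  refine .le (c := 80 * x.n + (13 + (18 + 80 * x.n))) (.seq (runs_dot hn (by decide) (by decide) hW
    hW (.reg (by decide) hj hjW) (.reg (by decide) hj hjW) (by decide) (by decide))
    fun s₁ hs₁ h₁ => ?_) (by lia)
  rw [real_inner_self_eq_norm_sq] at h₁
  refine .seq (runs_invert (by lia) (by rw [h₁]; positivity)) fun s₂ hs₂ h₂ => ?_
  rw [h₁] at h₂
  have hs : AgreeOff [coordIdx] [imageSq, recip] s s₂ :=
    (hs₁.mono (by decide) (by decide)).trans (hs₂.mono (by decide) (by decide))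
  have hj₂ : s₂.word roundIdx 0 = j := by rw [hs.word _ (by decide), hj]
  refine .seq (.setReal (.reg hj₂ hjW) (.sub (.cell (.reg hj₂ hjW)) (.mul (.div
    (.div (.reg (congrFun (hs.real _ (by decide)) _)) (.reg (congrFun (hs.real _ (by decide)) _))
    hb) (.cast (.const hW₂)) (by norm_num)) (.reg h₂)))) fun s₃ hs₃ h₃ => ?_
  have hj₃ : s₃.word roundIdx 0 = j := by rw [hs₃.word _ (by decide), hj₂]
  refine .imp (runs_copy hn (by decide) hW hW (.reg (by decide) hj₃ hjW)
    (.reg (by decide) hj₃ hjW) (by decide) (by decide)) fun s₄ hs₄ h₄ =>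
    ⟨⟨?_, fun k hk => ?_⟩, ?_, fun k hk => ?_⟩
  · rw [hs₄.real weights (by decide), h₃.1, hs.real dirWeights (by decide), Nat.cast_ofNat]
  · rw [hs₄.real weights (by decide), h₃.2 k hk, hs.real weights (by decide)]
  · rw [h₄.1, hs₃.row (by decide), hs.row (by decide)]
  · rw [h₄.2 k hk, hs₃.row (by decide), hs.row (by decide)]

/-- Replace the stored vectors by the directions that were split off, with reduced weights. -/
def compress : Prog := forLoop roundIdx (.reg sketchLen) storeDirection

theorem runs_compress (hF : Fits x W L) (hL : s.word sketchLen 0 = L)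
    (hb : s.real bestDen 0 ≠ 0) :
    Runs x W compress s (300 * L * x.n) fun s' => ∀ k ∈ range L,
      s'.real weights k = s.real dirWeights k -
        s.real bestNum 0 / s.real bestDen 0 / 2 * (‖s.row x.n dirs k‖ ^ 2)⁻¹ ∧
      s'.row x.n vecs k = s.row x.n dirs k := by
  have hn := hF.n_pos
  have hLW := hF.L_lt
  refine .le (.imp (runs_forLoop (c := 200 * x.n) (fun j s' => ∀ k < j,
      s'.real weights k = s.real dirWeights k -
        s.real bestNum 0 / s.real bestDen 0 / 2 * (‖s.row x.n dirs k‖ ^ 2)⁻¹ ∧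
      s'.row x.n vecs k = s.row x.n dirs k)
    (by decide) (.reg (by decide) hL (by lia)) (by decide) hF.L_pos (by lia) (fun _ _ _ h => h)
    (fun k hk => absurd hk (Nat.not_lt_zero _)) fun j hj s₁ hs₁ hj₁ h₁ => ?_) fun s₁ _ h₁ k hk =>
    h₁ k (mem_range.1 hk)) (by nlinarith [Nat.mul_le_mul_left L hn])
  have hden : s₁.real bestDen = s.real bestDen := hs₁.real _ (by decide)
  refine (runs_storeDirection hn (hF.row_lt hj.le) (by lia) (by lia) hj₁ (by rwa [hden])).imp
    fun s₂ _ ⟨hw, hv⟩ k hk => ?_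
  obtain hk | rfl := Nat.lt_succ_iff_lt_or_eq.1 hk
  · rw [hw.2 k hk.ne, hv.2 k hk.ne]
    exact h₁ k hk
  · rw [hw.1, hv.1, hden, hs₁.real dirWeights (by decide), hs₁.real bestNum (by decide),
      hs₁.row (by decide)]
    exact ⟨rfl, rfl⟩

/-- The row number `i` of the input matrix, as a vector. -/
noncomputable def Input.row (x : Input) (i : ℕ) : EuclideanSpace ℝ (Fin x.n) :=
  WithLp.toLp 2 fun k => x.entry i k

/-- The stored vectors and weights form a sketch of length `L` of the form `F` with trace at most
`τ`. -/
def Store.HoldsSketch (s : Store) {n : ℕ} (L : ℕ) (F : EuclideanSpace ℝ (Fin n) → ℝ) (τ : ℝ) :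
    Prop :=
  IsSketch L F τ (s.real weights) (s.row n vecs)

/-- Append the current row of the matrix, with weight one, to the stored vectors. -/
def appendRow : Prog :=
  .seq (fill vecs (.reg sketchLen) (.entry (.reg rowIdx) (.reg coordIdx)))
    (.setReal weights (.reg sketchLen) (.cast (.const 1)))

theorem runs_appendRow (hF : Fits x W L) (hL : s.word sketchLen 0 = L) {i : ℕ} (hi : i < x.n)
    (his : s.word rowIdx 0 = i) :
    Runs x W appendRow s (100 * x.n) fun s' =>
      (s'.real weights L = 1 ∧ ∀ k ∈ range L, s'.real weights k = s.real weights k) ∧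
      (s'.row x.n vecs L = x.row i ∧ ∀ k ∈ range L, s'.row x.n vecs k = s.row x.n vecs k) := by
  have hn := hF.n_pos
  have hnW := hF.n_lt
  have hLW := hF.L_lt
  refine .le (.seq (runs_fill (v := x.row i) hn (hF.row_lt le_rfl)
    (.reg (by decide) hL (by lia)) (by decide) (by decide) fun c s₁ hs₁ hc _ =>
      .entry (l := i) (.reg ?_ (by lia)) (.reg hc (by lia)) hi c.2)
    fun s₁ hs₁ h₁ => .imp (.setReal (.reg (v := L) ?_ (by lia)) (.cast (.const (by lia))))
    fun s₂ hs₂ h₂ => ?_) (c := 80 * x.n + 5) (by lia)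
  · rw [hs₁.word _ (by decide), his]
  · rw [hs₁.word _ (by decide), hL]
  · rw [h₂.1, Nat.cast_one, hs₂.row (by decide), h₁.1]
    refine ⟨⟨rfl, fun k hk => ?_⟩, rfl, fun k hk => ?_⟩
    · rw [h₂.2 k (mem_range.1 hk).ne, hs₁.real _ (by decide)]
    · rw [hs₂.row (by decide), h₁.2 k (mem_range.1 hk).ne]

/-- Turn the `L + 1` stored vectors into a sketch of length `L`. -/
def shrink : Prog := .seq deflateRounds <| .seq findBest compress

theorem runs_shrink (hF : Fits x W L) (hL : s.word sketchLen 0 = L)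
    (hw : ∀ k ∈ range (L + 1), 0 ≤ s.real weights k) :
    Runs x W shrink s (5500 * L ^ 3 * (L + 1) ^ 2 * x.n) fun s' =>
      s'.HoldsSketch L (gramForm (range (L + 1)) (s.real weights) (s.row x.n vecs))
        (gramTrace (range (L + 1)) (s.real weights) (s.row x.n vecs)) := by
  have hcost : 3100 * L ^ 3 * (L + 1) ^ 2 * x.n + (2000 * L ^ 2 * (L + 1) ^ 2 * x.n +
      300 * L * x.n) ≤ 5500 * L ^ 3 * (L + 1) ^ 2 * x.n := by
    have h₁ : 1 * (L ^ 2 * (L + 1) ^ 2 * x.n) ≤ L * (L ^ 2 * (L + 1) ^ 2 * x.n) :=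
      Nat.mul_le_mul_right _ hF.L_pos
    have h₂ : 1 * (L * x.n) ≤ (L ^ 2 * (L + 1) ^ 2) * (L * x.n) :=
      Nat.mul_le_mul_right _ (Nat.mul_pos (pow_pos hF.L_pos _) (by positivity))
    nlinarith
  refine .le (.seq (runs_deflateRounds hF hL hw) fun s₁ hs₁ h₁ => .seq (runs_findBest hF
    (by rw [hs₁.word _ (by decide), hL])) fun s₂ hs₂ h₂ => .imp (runs_compress hF
    (by rw [hs₂.word _ (by decide), hs₁.word _ (by decide), hL]) h₂.den_pos.ne')
    fun s₃ _ h₃ => ?_) hcost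
  have hw₁ : s₁.real weights = s.real weights := hs₁.real _ (by decide)
  have h := h₁.isSketch (hw₁ ▸ hw) h₂ (h₂.gramForm_le hF.L_pos (hw₁ ▸ hw))
  rw [hw₁] at h
  refine h.congr (fun k hk => ?_) fun k hk => ?_
  · rw [(h₃ k hk).1, hs₂.real dirWeights (by decide), hs₂.row (by decide)]
  · rw [(h₃ k hk).2, hs₂.row (by decide)]

/-- Add the current row of the matrix to the sketch. -/
def insertRow : Prog := .seq appendRow shrink

theorem runs_insertRow (hF : Fits x W L) (hL : s.word sketchLen 0 = L) {i : ℕ} (hi : i < x.n)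
    (his : s.word rowIdx 0 = i) {F : EuclideanSpace ℝ (Fin x.n) → ℝ} {τ : ℝ}
    (h : s.HoldsSketch L F τ) :
    Runs x W insertRow s (5600 * L ^ 3 * (L + 1) ^ 2 * x.n) fun s' =>
      s'.HoldsSketch L (fun y => F y + ⟪x.row i, y⟫_ℝ ^ 2) (τ + ‖x.row i‖ ^ 2) := by
  have hcost : 100 * x.n + 5500 * L ^ 3 * (L + 1) ^ 2 * x.n ≤
      5600 * L ^ 3 * (L + 1) ^ 2 * x.n := by
    have : 1 * x.n ≤ (L ^ 3 * (L + 1) ^ 2) * x.n :=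
      Nat.mul_le_mul_right _ (Nat.mul_pos (pow_pos hF.L_pos _) (by positivity))
    nlinarith
  refine .le (.seq (runs_appendRow hF hL hi his) fun s₁ hs₁ ⟨hw, hv⟩ => .imp (runs_shrink hF
    (by rw [hs₁.word _ (by decide), hL]) fun k hk => ?_) fun s₂ _ h₂ => h.trans ?_) hcost
  · obtain hk | rfl := Nat.lt_succ_iff_lt_or_eq.1 (mem_range.1 hk)
    · rw [hw.2 k (mem_range.2 hk)]
      exact h.weight_nonneg k (mem_range.2 hk)
    · rw [hw.1]
      exact zero_le_one
  · have hform (y : EuclideanSpace ℝ (Fin x.n)) :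
        gramForm (range (L + 1)) (s₁.real weights) (s₁.row x.n vecs) y =
          gramForm (range L) (s.real weights) (s.row x.n vecs) y + ⟪x.row i, y⟫_ℝ ^ 2 := by
      rw [← gramForm_congr hw.2 hv.2, gramForm, sum_range_succ, hw.1, hv.1, one_mul, gramForm]
    have htrace : gramTrace (range (L + 1)) (s₁.real weights) (s₁.row x.n vecs) =
        gramTrace (range L) (s.real weights) (s.row x.n vecs) + ‖x.row i‖ ^ 2 := by
      rw [← gramTrace_congr hw.2 hv.2, gramTrace, sum_range_succ, hw.1, hv.1, one_mul, gramTrace]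
    rw [← funext hform, ← htrace]
    exact h₂

/-- Compute a sketch of the rows of the matrix. -/
def sketchRows : Prog := forLoop rowIdx .size insertRow

theorem runs_sketchRows (hF : Fits x W L) (hL : s.word sketchLen 0 = L)
    (hw : s.real weights = 0) :
    Runs x W sketchRows s (5700 * L ^ 3 * (L + 1) ^ 2 * x.n ^ 2) fun s' =>
      s'.HoldsSketch L (fun y => ∑ i ∈ range x.n, ⟪x.row i, y⟫_ℝ ^ 2)
        (∑ i ∈ range x.n, ‖x.row i‖ ^ 2) := by
  have hn := hF.n_pos
  have hnW := hF.n_lt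
  have hcost : x.n * (5600 * L ^ 3 * (L + 1) ^ 2 * x.n + 40) ≤
      5700 * L ^ 3 * (L + 1) ^ 2 * x.n ^ 2 := by
    have : x.n * 1 ≤ x.n * (L ^ 3 * (L + 1) ^ 2 * x.n) := Nat.mul_le_mul_left _
      (Nat.mul_pos (Nat.mul_pos (pow_pos hF.L_pos _) (by positivity)) hn)
    nlinarith
  refine .le (runs_forLoop (fun j s' => s'.HoldsSketch L
    (fun y => ∑ i ∈ range j, ⟪x.row i, y⟫_ℝ ^ 2) (∑ i ∈ range j, ‖x.row i‖ ^ 2)) (by decide)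
    (.size (by lia)) (by decide) hn (by lia) (fun _ _ _ h => h) ?_ fun j hj s₁ hs₁ hj₁ h₁ => ?_)
    hcost
  · simp only [range_zero, sum_empty]
    exact IsSketch.zero (fun k _ => congrFun hw k) _
  · simp only [sum_range_succ]
    exact runs_insertRow hF (by rw [hs₁.word _ (by decide), hL]) hj hj₁ h₁

/-- The form whose value at a vector is the squared norm of the image under the matrix. -/
noncomputable def Input.form (x : Input) (y : EuclideanSpace ℝ (Fin x.n)) : ℝ :=
  x.A *ᵥ y ⬝ᵥ x.A *ᵥ y

theorem Input.sum_sq_inner_row (x : Input) (y : EuclideanSpace ℝ (Fin x.n)) :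
    ∑ i ∈ range x.n, ⟪x.row i, y⟫_ℝ ^ 2 = x.form y := by
  rw [← Fin.sum_univ_eq_sum_range (fun i => ⟪x.row i, y⟫_ℝ ^ 2)]
  refine sum_congr rfl fun i _ => ?_
  have h : ⟪x.row i, y⟫_ℝ = (x.A *ᵥ y) i := by
    simp [PiLp.inner_apply, Input.row, Input.entry, mulVec, dotProduct, mul_comm]
  rw [h, sq]

theorem Input.sum_norm_sq_row_le (x : Input) (hC : ∀ i k, |x.A i k| ≤ x.C) :
    ∑ i ∈ range x.n, ‖x.row i‖ ^ 2 ≤ x.n ^ 2 * x.C ^ 2 := by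
  have hrow (i : ℕ) (hi : i ∈ range x.n) : ‖x.row i‖ ^ 2 ≤ x.n * x.C ^ 2 := by
    rw [EuclideanSpace.norm_sq_eq, ← nsmul_eq_mul]
    refine (sum_le_card_nsmul _ _ (x.C ^ 2) fun k _ => ?_).trans_eq (by simp)
    have hik : x.row i k = x.A ⟨i, mem_range.1 hi⟩ k := dif_pos ⟨mem_range.1 hi, k.2⟩
    rw [hik, Real.norm_eq_abs]
    exact pow_le_pow_left₀ (abs_nonneg _) (hC _ _) 2
  refine (sum_le_card_nsmul _ _ _ hrow).trans_eq ?_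
  rw [card_range, nsmul_eq_mul]
  ring

theorem Store.HoldsSketch.isNearMax {n : ℕ} {F : EuclideanSpace ℝ (Fin n) → ℝ} {τ : ℝ}
    (h : s.HoldsSketch L F τ) (hL : 0 < L) (hw₀ : s.real weights L = 0)
    (hb : s'.HoldsBest L (s.op n L)
      (iterates (s.op n L) (s.row n vecs '' (range (L + 1) : Set ℕ)) (2 * L ^ 2))) :
    IsNearMax F (6 * τ / L) (s'.real bestNum 0 / s'.real bestDen 0) (s'.row n best 0) := by
  have hop : s.op n L = gramOp (range L) (s.real weights) (s.row n vecs) := by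
    ext1 y
    simp only [Store.op, gramOp_apply, sum_range_succ, hw₀, zero_mul, zero_smul, add_zero]
  have hform (y : EuclideanSpace ℝ (Fin n)) :
      gramForm (range (L + 1)) (s.real weights) (s.row n vecs) y =
        gramForm (range L) (s.real weights) (s.row n vecs) y := by
    simp only [gramForm, sum_range_succ, hw₀, zero_mul, add_zero]
  have hw (k : ℕ) (hk : k ∈ range (L + 1)) : 0 ≤ s.real weights k := by
    obtain hk | rfl := Nat.lt_succ_iff_lt_or_eq.1 (mem_range.1 hk)
    · exact h.weight_nonneg k (mem_range.2 hk)
    · exact hw₀.ge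
  refine IsSketch.isNearMax h hL (hop ▸ hb) fun y => ?_
  rw [← hform]
  exact hb.gramForm_le hL hw y

/-- Find a vector with almost maximal image under the matrix, among a sketch of its rows. -/
def measure : Prog :=
  .seq sketchRows <|
  .seq (.setReal weights (.reg sketchLen) (.cast (.const 0))) findBest

theorem runs_measure (hF : Fits x W L) (hL : s.word sketchLen 0 = L) (hw : s.real weights = 0) :
    Runs x W measure s (7800 * L ^ 3 * (L + 1) ^ 2 * x.n ^ 2) fun s' => s'.real bestDen 0 ≠ 0 ∧
      IsNearMax x.form (6 * (∑ i ∈ range x.n, ‖x.row i‖ ^ 2) / L)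
        (s'.real bestNum 0 / s'.real bestDen 0) (s'.row x.n best 0) := by
  have hLpos := hF.L_pos
  have hLW := hF.L_lt
  have hcost : 5700 * L ^ 3 * (L + 1) ^ 2 * x.n ^ 2 + (5 + 2000 * L ^ 2 * (L + 1) ^ 2 * x.n) ≤
      7800 * L ^ 3 * (L + 1) ^ 2 * x.n ^ 2 := by
    have hn := hF.n_pos
    have h₁ : 1 * (L ^ 2 * (L + 1) ^ 2 * x.n) ≤ (L * x.n) * (L ^ 2 * (L + 1) ^ 2 * x.n) :=
      Nat.mul_le_mul_right _ (Nat.mul_pos hLpos hn)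
    have h₂ : 0 < L ^ 2 * (L + 1) ^ 2 * x.n := by positivity
    nlinarith
  refine .le (.seq (runs_sketchRows hF hL hw) fun s₁ hs₁ h₁ => .seq (.setReal (.reg (v := L) ?_
    (by lia)) (.cast (.const (Nat.zero_le _)))) fun s₂ hs₂ ⟨hw₀, hw₂⟩ => .imp (runs_findBest hF ?_)
    fun s₃ hs₃ h₃ => ?_) hcost
  · rw [hs₁.word _ (by decide), hL]
  · rw [hs₂.word _ (by decide), hs₁.word _ (by decide), hL]
  rw [Nat.cast_zero] at hw₀
  have hsk : s₂.HoldsSketch L x.form (∑ i ∈ range x.n, ‖x.row i‖ ^ 2) := by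
    rw [← funext x.sum_sq_inner_row]
    exact h₁.congr (fun k hk => hw₂ k (mem_range.1 hk).ne) fun k _ => hs₂.row (by decide) _ k
  exact ⟨h₃.den_pos.ne', hsk.isNearMax hLpos hw₀ h₃⟩

/-- For the values `0, 1, …` smaller than `n` of the counter `termIdx`, store the sum of the values
of `e` over the counter `coordIdx` in the corresponding cell of the real array `a`. -/
def sums (a : ℕ) (e : RExp) : Prog :=
  forLoop termIdx .size (.seq (sumLoop coordIdx total e) (.setReal a (.reg termIdx) (.reg total)))

theorem runs_sums {a : ℕ} {e : RExp} (g : Fin x.n → Fin x.n → ℝ) (hn : 0 < x.n) (hW : x.n < W)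
    (ha : a ≠ total) (hec : e.cost ≤ 30)
    (he : ∀ (i k : Fin x.n) s', AgreeOff [termIdx, coordIdx] [total, a] s s' →
      s'.word termIdx 0 = i → s'.word coordIdx 0 = k → e.Yields x W s' (g i k)) :
    Runs x W (sums a e) s (130 * x.n ^ 2) fun s' =>
      s'.row x.n a 0 = WithLp.toLp 2 fun i => ∑ k, g i k := by
  have hsub : [termIdx, coordIdx, coordIdx] ⊆ [termIdx, coordIdx] := by decide
  have hwords : termIdx ∉ [coordIdx, coordIdx] := by decide
  refine .le (c := x.n * (80 * x.n + 5 + 40)) (.imp (runs_forLoop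
    (fun d s' => ∀ i : Fin x.n, i < d → s'.real a i = ∑ k, g i k) hwords (.size hW.le)
    (by decide) hn hW (fun _ _ _ h => h) (fun i hi => absurd hi i.1.not_lt_zero)
    fun d hd s₁ hs₁ hd₁ h₁ => .seq (runs_sumLoop (g ⟨d, hd⟩) hn hW hec
      fun k s₂ hs₂ hk₂ => he ⟨d, hd⟩ k s₂ ?_ ?_ hk₂)
    fun s₂ hs₂ h₂ => .imp (.setReal (.reg (v := d) ?_ (by lia)) (.reg h₂))
    fun s₃ _ h₃ i hi => ?_) fun s₁ _ h₁ => ?_) (by nlinarith)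
  · exact (hs₁.mono hsub (by simp [Prog.reals, sumLoop, forLoop, incr])).trans
      (hs₂.mono (by simp) (by simp))
  · rw [hs₂.word _ (by decide), hd₁]
  · rw [hs₂.word _ hwords, hd₁]
  · obtain hi | rfl := Nat.lt_succ_iff_lt_or_eq.1 hi
    · rw [h₃.2 i hi.ne, ← h₁ i hi,
        hs₂.real a (by simpa [Prog.reals, sumLoop, forLoop, incr] using ha)]
    · exact h₃.1
  · ext i
    rw [Store.row_apply, zero_mul, zero_add, h₁ i i.2]

/-- Store the product of the matrix with entries `e` and the vector `b` in the vector `a`. -/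
def mulVector (a : ℕ) (e : RExp) (b : ℕ) : Prog := sums a (.mul e (.coord b (.const 0)))

theorem runs_mulVector {a b : ℕ} {e : RExp} (B : Matrix (Fin x.n) (Fin x.n) ℝ) (hn : 0 < x.n)
    (hW : x.n < W) (ha : a ≠ total) (hb : b ∉ [total, a]) (hec : e.cost ≤ 20)
    (he : ∀ (i k : Fin x.n) (s' : Store), s'.word termIdx 0 = i → s'.word coordIdx 0 = k →
      e.Yields x W s' (B i k)) :
    Runs x W (mulVector a e b) s (130 * x.n ^ 2) fun s' =>
      s'.row x.n a 0 = WithLp.toLp 2 (B *ᵥ s.row x.n b 0) :=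
  runs_sums _ hn hW ha (by simp only [RExp.cost, WExp.cost]; lia) fun i k s₁ hs₁ hi₁ hk₁ => by
    rw [← hs₁.row hb]
    exact .mul (he i k s₁ hi₁ hk₁) (.coord (.const (Nat.zero_le _)) hk₁ (by lia))

/-- The test whether `b` and `c` give the same result. -/
def Test.iff (b c : Test) : Test := .and (.not (.and b (.not c))) (.not (.and c (.not b)))

theorem Test.Decides.iff {b c : Test} {P Q : Prop} (hb : b.Decides x W s P)
    (hc : c.Decides x W s Q) : (b.iff c).Decides x W s (P ↔ Q) := by
  rw [iff_iff_implies_and_implies, ← not_and_not_right, ← not_and_not_right]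
  exact (hb.and hc.not).not.and (hc.and hb.not).not

/-- Write the indicator function of the set of those values of the counter `coordIdx` for which the
test `b` succeeds to the word array `d`. -/
def markIf (d : ℕ) (b : Test) : Prog :=
  forLoop coordIdx .size <|
  .ite b (.setWord d (.reg coordIdx) (.const 1)) (.setWord d (.reg coordIdx) (.const 0))

theorem runs_markIf {d : ℕ} {b : Test} (U : Finset (Fin x.n)) (hn : 0 < x.n) (hW : x.n < W)
    (hd : coordIdx ∉ [d, d]) (hbc : b.cost ≤ 40)
    (hb : ∀ (k : Fin x.n) s', AgreeOff [coordIdx, d, d] [] s s' → s'.word coordIdx 0 = k →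
      b.Decides x W s' (k ∈ U)) :
    Runs x W (markIf d b) s (100 * x.n) fun s' =>
      ∀ i : Fin x.n, s'.word d i = if i ∈ U then 1 else 0 := by
  have hne : d ≠ coordIdx := fun h => hd (h ▸ List.mem_cons_self)
  refine .le (c := x.n * (b.cost + 4 + 40)) (.imp (runs_forLoop
    (fun k s' => ∀ i : Fin x.n, i < k → s'.word d i = if i ∈ U then 1 else 0) hd (.size hW.le)
    (by decide) hn hW (fun k s' v h i hi => ?_) (fun i hi => absurd hi i.1.not_lt_zero)
    fun k hk s₁ hs₁ hk₁ h₁ => ?_) fun s' _ h' i => h' i i.2) (by nlinarith)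
  · rw [Store.setWord_word, if_neg fun h => hne h.1, h i hi]
  · have hset {v : ℕ} (hv : v ≤ 1) (hvk : v = if ⟨k, hk⟩ ∈ U then 1 else 0) :
        Runs x W (.setWord d (.reg coordIdx) (.const v)) s₁ 4 fun s' =>
          ∀ i : Fin x.n, i < k + 1 → s'.word d i = if i ∈ U then 1 else 0 := by
      refine (Runs.setWord (.reg hk₁ (by lia)) (.const (by lia))).imp fun s₂ _ h₂ i hi => ?_
      rw [h₂, Store.setWord_word]
      obtain hi | rfl := Nat.lt_succ_iff_lt_or_eq.1 hi
      · rw [if_neg fun h => hi.ne h.2, h₁ i hi]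
      · rw [if_pos ⟨rfl, rfl⟩, hvk]
    exact .ite (hb ⟨k, hk⟩ s₁ hs₁ hk₁) (fun h => hset le_rfl (if_pos h).symm)
      fun h => hset zero_le_one (if_neg h).symm

/-- Mark the sign set of the vector `a` in the word array `d`. -/
def markSignSet (d a : ℕ) : Prog :=
  .seq (sumLoop coordIdx total (.coord a (.const 0))) <|
  markIf d <| .iff (.realLE (.cast (.const 0)) (.coord a (.const 0)))
    (.realLE (.cast (.const 0)) (.reg total))

theorem runs_markSignSet {d a : ℕ} (hn : 0 < x.n) (hW : x.n < W) (hd : coordIdx ∉ [d, d])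
    (ha : a ≠ total) :
    Runs x W (markSignSet d a) s (180 * x.n) fun s' =>
      ∀ i : Fin x.n, s'.word d i = if i ∈ signSet (s.row x.n a 0) then 1 else 0 := by
  have ha' : a ∉ [total, total] := by simpa using ha
  have hcoord {t : Store} {k : Fin x.n} (hk : t.word coordIdx 0 = k) :
      (RExp.coord a (.const 0)).Yields x W t (t.row x.n a 0 k) :=
    .coord (.const (Nat.zero_le _)) hk (by lia)
  refine .le (.seq (runs_sumLoop (s.row x.n a 0) hn hW
    (by simp only [RExp.cost, WExp.cost]; lia) fun k s₁ hs₁ hk₁ => ?_)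
    fun s₁ hs₁ h₁ => runs_markIf _ hn hW hd
      (by simp only [Test.iff, Test.cost, RExp.cost, WExp.cost]; lia) fun k s₂ hs₂ hk₂ => ?_)
    (by lia)
  · rw [← hs₁.row (List.mem_singleton.not.2 ha)]
    exact hcoord hk₁
  have hrow : s₂.row x.n a 0 = s.row x.n a 0 :=
    (hs₂.row List.not_mem_nil x.n 0).trans (hs₁.row ha' x.n 0)
  have htotal : s₂.real total 0 = ∑ i, s.row x.n a 0 i := by
    rw [hs₂.real total List.not_mem_nil, h₁]
  have hzero : (RExp.cast (.const 0)).Yields x W s₂ 0 := by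
    simpa using RExp.Yields.cast (.const (Nat.zero_le W))
  simpa only [signSet, mem_filter, mem_univ, true_and] using
    Test.Decides.iff (.realLE hzero (hrow ▸ hcoord hk₂)) (.realLE hzero (.reg htotal))

theorem Store.outputSet_eq {n a : ℕ} {U : Finset (Fin n)}
    (h : ∀ i : Fin n, s.word a i = if i ∈ U then 1 else 0) : s.outputSet a n = U := by
  ext i
  simp [Store.outputSet, h i]

theorem Input.yields_entry {e f : WExp} {i k : Fin x.n} (he : e.Yields x W s i)
    (hf : f.Yields x W s k) : (RExp.entry e f).Yields x W s (x.A i k) := by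
  have h : x.entry i k = x.A i k := dif_pos ⟨i.2, k.2⟩
  exact h ▸ .entry he hf i.2 k.2

/-- Mark the cut found from the vector `best`. -/
def cut : Prog :=
  .seq (mulVector cutY (.entry (.reg termIdx) (.reg coordIdx)) best) <|
  .seq (mulVector cutZ (.entry (.reg coordIdx) (.reg termIdx)) cutY) <|
  .seq (mulVector rowSums (.entry (.reg termIdx) (.reg coordIdx)) cutZ) <|
  .seq (markSignSet rowMarks rowSums) <|
  .seq (sums colSums (.mul (.cast (.cell rowMarks (.reg coordIdx)))
    (.entry (.reg coordIdx) (.reg termIdx)))) <|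
  markSignSet colMarks colSums

theorem runs_cut (hn : 0 < x.n) (hW : x.n < W) :
    Runs x W cut s (880 * x.n ^ 2) fun s' =>
      s'.outputSet rowMarks x.n = cutRows x.A (s.row x.n best 0) ∧
      s'.outputSet colMarks x.n = cutCols x.A (s.row x.n best 0) := by
  have hA (i k : Fin x.n) (s' : Store) (hi : s'.word termIdx 0 = i) (hk : s'.word coordIdx 0 = k) :
      (RExp.entry (.reg termIdx) (.reg coordIdx)).Yields x W s' (x.A i k) :=
    Input.yields_entry (.reg hi (by lia)) (.reg hk (by lia))
  have hAt (k i : Fin x.n) (s' : Store) (hk : s'.word termIdx 0 = k) (hi : s'.word coordIdx 0 = i) :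
      (RExp.entry (.reg coordIdx) (.reg termIdx)).Yields x W s' (x.Aᵀ k i) :=
    Input.yields_entry (.reg hi (by lia)) (.reg hk (by lia))
  refine .le (c := 130 * x.n ^ 2 + (130 * x.n ^ 2 + (130 * x.n ^ 2 + (180 * x.n +
      (130 * x.n ^ 2 + 180 * x.n))))) (.seq
    (runs_mulVector x.A hn hW (by decide) (by decide) (by decide) hA) fun s₁ _ h₁ => .seq
    (runs_mulVector x.Aᵀ hn hW (by decide) (by decide) (by decide) hAt) fun s₂ _ h₂ => .seq
    (runs_mulVector x.A hn hW (by decide) (by decide) (by decide) hA) fun s₃ _ h₃ => .seq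
    (runs_markSignSet hn hW (by decide) (by decide)) fun s₄ _ h₄ => ?_) (by nlinarith)
  rw [h₃, h₂, h₁] at h₄
  change ∀ i : Fin x.n, _ = if i ∈ cutRows x.A (s.row x.n best 0) then 1 else 0 at h₄
  refine .seq (runs_sums (fun k i => if i ∈ cutRows x.A (s.row x.n best 0) then x.Aᵀ k i else 0)
    hn hW (by decide) (by decide) fun k i s' hs' hk hi => ?_) fun s₅ hs₅ h₅ =>
    .imp (runs_markSignSet hn hW (by decide) (by decide)) fun s₆ hs₆ h₆ => ⟨?_, ?_⟩
  · have hmark : (WExp.cell rowMarks (.reg coordIdx)).Yields x W s'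
        (if i ∈ cutRows x.A (s.row x.n best 0) then 1 else 0) := by
      rw [← h₄, ← hs'.word _ (by decide)]
      refine .cell (.reg hi (by lia)) ?_
      rw [hs'.word _ (by decide), h₄]
      split_ifs <;> lia
    simpa only [Nat.cast_ite, Nat.cast_one, Nat.cast_zero, ite_mul, one_mul, zero_mul] using
      RExp.Yields.mul (.cast hmark) (hAt k i s' hk hi)
  · exact Store.outputSet_eq fun i => by rw [hs₆.word _ (by decide), hs₅.word _ (by decide), h₄]
  · rw [h₅] at h₆
    simp only [sum_ite_mem, univ_inter] at h₆
    exact Store.outputSet_eq h₆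

/-- The length of the sketch for the input `x`: large enough to make the error of the sketch
negligible. -/
noncomputable def Input.len (x : Input) : ℕ := max 1 ⌈60 * (x.C / x.ε) ^ 2⌉₊

theorem Input.len_pos (x : Input) : 0 < x.len := Nat.succ_le_iff.1 (le_max_left _ _)

theorem Input.len_le_iff (hε : 0 < x.ε) {l : ℕ} (hl : 0 < l) :
    x.len ≤ l ↔ 60 * (x.C * x.C) ≤ x.ε * x.ε * l := by
  rw [Input.len, max_le_iff, Nat.ceil_le, and_iff_right (Nat.succ_le_iff.2 hl), div_pow,
    ← mul_div_assoc, div_le_iff₀ (pow_pos hε 2), sq, sq, mul_comm (l : ℝ)]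

theorem Input.len_le (hC : 0 ≤ x.C) (hε : 0 < x.ε) : (x.len : ℝ) ≤ 61 * max 1 (x.C / x.ε) ^ 2 := by
  have hmax : 1 ≤ max 1 (x.C / x.ε) ^ 2 := one_le_pow₀ (le_max_left _ _)
  have hsq : (x.C / x.ε) ^ 2 ≤ max 1 (x.C / x.ε) ^ 2 :=
    pow_le_pow_left₀ (div_nonneg hC hε.le) (le_max_right _ _) 2
  rw [Input.len, Nat.cast_max, max_le_iff]
  refine ⟨by push_cast; linarith, ?_⟩
  linarith [Nat.ceil_lt_add_one (show 0 ≤ 60 * (x.C / x.ε) ^ 2 by positivity)]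

/-- Compute the length of the sketch. -/
def chooseLen : Prog :=
  .seq (.setWord sketchLen (.const 0) (.const 1)) <|
  .while (.not (.realLE (.mul (.cast (.const 60)) (.mul .bound .bound))
      (.mul (.mul .accuracy .accuracy) (.cast (.reg sketchLen)))))
    (incr sketchLen)

theorem runs_chooseLen (hε : 0 < x.ε) (hW : x.len + 100 < W) :
    Runs x W chooseLen s (30 * x.len) fun s' => s'.word sketchLen 0 = x.len := by
  let b : Test := .realLE (.mul (.cast (.const 60)) (.mul .bound .bound))
    (.mul (.mul .accuracy .accuracy) (.cast (.reg sketchLen)))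
  have htest {s' : Store} {l : ℕ} (h : s'.word sketchLen 0 = l) (hl₀ : 0 < l) (hl : l ≤ x.len) :
      b.not.Decides x W s' (¬ x.len ≤ l) := by
    rw [Input.len_le_iff hε hl₀]
    exact .not (.realLE (.mul (.cast (.const (by lia))) (.mul .bound .bound))
      (.mul (.mul .accuracy .accuracy) (.cast (.reg h (by lia)))))
  let I (d : ℕ) (s' : Store) : Prop := ∃ l, 0 < l ∧ l + d = x.len ∧ s'.word sketchLen 0 = l
  have hlen := x.len_pos
  refine .le (.seq (.setWord (.const (Nat.zero_le _)) (.const (by lia))) fun s₁ _ h₁ => .imp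
    (.while_countdown (c := 6) (d := x.len - 1) I ?_ ?_ ⟨1, one_pos, by lia, ?_⟩) ?_)
    (c := 3 + ((x.len - 1) * (15 + 6) + 15)) (by lia)
  · rintro s' ⟨l, hl₀, hld, hl⟩
    exact eq_false (not_not.2 hld.ge) ▸ htest hl hl₀ (by lia)
  · rintro d s' ⟨l, hl₀, hld, hl⟩
    refine ⟨eq_true (show ¬ x.len ≤ l by lia) ▸ htest hl hl₀ (by lia),
      (runs_incr hl (by lia)).imp fun s₂ _ h₂ => ⟨l + 1, by lia, by lia, ?_⟩⟩
    simp only [h₂, Store.setWord_word, and_self, if_true]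
  · simp only [h₁, Store.setWord_word, and_self, if_true]
  · rintro s' - ⟨l, -, hld, hl⟩
    exact hl.trans hld

variable {δ ρ : ℝ} {v : EuclideanSpace ℝ (Fin x.n)}

theorem Input.norm_sq_toEuclideanLin (x : Input) (y : EuclideanSpace ℝ (Fin x.n)) :
    ‖toEuclideanLin x.A y‖ ^ 2 = x.form y := by
  rw [EuclideanSpace.real_norm_sq_eq]
  simp [Input.form, dotProduct, sq]

theorem Input.six_mul_div_len_le (hε : 0 < x.ε) (hC : ∀ i k, |x.A i k| ≤ x.C) :
    6 * (∑ i ∈ range x.n, ‖x.row i‖ ^ 2) / x.len ≤ (x.ε * x.n) ^ 2 / 10 := by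
  have hlen : (0 : ℝ) < x.len := Nat.cast_pos.2 x.len_pos
  have hle := (Input.len_le_iff hε x.len_pos).1 le_rfl
  rw [div_le_iff₀ hlen]
  calc 6 * ∑ i ∈ range x.n, ‖x.row i‖ ^ 2 ≤ 6 * (x.n ^ 2 * x.C ^ 2) := by
        gcongr
        exact x.sum_norm_sq_row_le hC
    _ = 60 * (x.C * x.C) * (x.n ^ 2 / 10) := by ring
    _ ≤ x.ε * x.ε * x.len * (x.n ^ 2 / 10) := by gcongr
    _ = (x.ε * x.n) ^ 2 / 10 * x.len := by ring

theorem _root_.IsNearMax.singularValues_le (h : IsNearMax x.form δ ρ v) (hε : 0 < x.ε)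
    (hδ : δ ≤ (x.ε * x.n) ^ 2 / 10) (hρ : ¬ 9 * (x.ε * x.n) ^ 2 ≤ 20 * ρ) (j : ℕ) :
    (toEuclideanLin x.A).singularValues j ≤ x.ε * x.n := by
  refine singularValues_le_of_forall_norm_le _ (by positivity) (fun y => ?_) j
  refine le_of_sq_le_sq ?_ (by positivity)
  rw [mul_pow, x.norm_sq_toEuclideanLin]
  refine (h.form_le y).trans ?_
  gcongr
  linarith

theorem _root_.IsNearMax.le_abs_sum_cut (h : IsNearMax x.form δ ρ v) (hn : 0 < x.n)
    (hε : 0 < x.ε) (hrow : ∀ i, ∑ k, x.A i k ^ 2 ≤ (x.n : ℝ))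
    (hcol : ∀ k, ∑ i, x.A i k ^ 2 ≤ (x.n : ℝ)) (hρ : 9 * (x.ε * x.n) ^ 2 ≤ 20 * ρ) :
    x.ε ^ 8 / 100 * x.n ^ 2 ≤ |∑ i ∈ cutRows x.A v, ∑ k ∈ cutCols x.A v, x.A i k| := by
  have hρ₀ : 0 < ρ := by
    have : 0 < 9 * (x.ε * x.n) ^ 2 := by positivity
    linarith
  have hv : v ⬝ᵥ v = ‖v‖ ^ 2 := by
    rw [EuclideanSpace.real_norm_sq_eq]
    simp only [dotProduct, sq]
  refine _root_.le_abs_sum_cut hn (by simpa only [dotProduct, ← sq, row_apply] using hrow)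
    (by simpa only [dotProduct, ← sq, col_apply] using hcol) hε ?_ ?_
  · rw [hv]
    exact pow_pos (norm_pos_iff.2 (h.ne_zero hρ₀)) 2
  · rw [hv]
    calc 9 * (x.ε ^ 2 * x.n ^ 2 * ‖v‖ ^ 2) = 9 * (x.ε * x.n) ^ 2 * ‖v‖ ^ 2 := by ring
      _ ≤ 20 * ρ * ‖v‖ ^ 2 := by gcongr
      _ = 20 * (ρ * ‖v‖ ^ 2) := by ring
      _ ≤ 20 * x.form v := by gcongr; exact h.mul_norm_sq_le

/-- The output of the algorithm claims that the singular values are small, or provides a large cut,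
and this is correct. -/
def Input.IsSolved (x : Input) (s : Store) : Prop :=
  s.Certifies ∧ (∀ j, (toEuclideanLin x.A).singularValues j ≤ x.ε * x.n) ∨
  ¬ s.Certifies ∧ x.ε ^ 8 / 100 * x.n ^ 2 ≤
    |∑ i ∈ s.outputSet rowMarks x.n, ∑ k ∈ s.outputSet colMarks x.n, x.A i k|

/-- The algorithm: compute a vector with almost maximal image under the matrix, and use it to find
a large cut, unless its image is too small for that. -/
def algorithm : Prog :=
  .seq chooseLen <|
  .seq measure <|
  .ite (.realLE
      (.mul (.cast (.const 9)) (.mul (.mul .accuracy (.cast .size)) (.mul .accuracy (.cast .size))))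
      (.mul (.cast (.const 20)) (.div (.reg bestNum) (.reg bestDen))))
    cut (.setWord flag (.const 0) (.const 1))

/-- A bound for the running time on the input `x`, which is also used as the word bound. -/
noncomputable def Input.budget (x : Input) : ℕ := 9000 * (x.len ^ 3 * (x.len + 1) ^ 2 * x.n ^ 2)

theorem Input.fits_budget (hn : 0 < x.n) : Fits x x.budget x.len := by
  have hlen := x.len_pos
  refine ⟨hn, hlen, ?_⟩
  have hsq : x.len ^ 2 * 1 ≤ x.len ^ 2 * (x.len * (x.len + 1) ^ 2 * x.n ^ 2) :=
    Nat.mul_le_mul_left _ (Nat.succ_le_iff.2 (by positivity))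
  have hmul : x.len * x.n * 1 ≤ x.len * x.n * (x.len ^ 2 * (x.len + 1) ^ 2 * x.n) :=
    Nat.mul_le_mul_left _ (Nat.succ_le_iff.2 (by positivity))
  have hl : x.len ≤ x.len * x.n := Nat.le_mul_of_pos_right _ hn
  have hn' : x.n ≤ x.len * x.n := Nat.le_mul_of_pos_left _ hlen
  rw [Input.budget]
  nlinarith

theorem Input.budget_le (hC : 0 ≤ x.C) (hε : 0 < x.ε) {K : ℕ} (hK : 36000 * 61 ^ 5 ≤ K) :
    (x.budget : ℝ) ≤ K * max 1 (x.C / x.ε) ^ K * x.n ^ 2 := by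
  have hlen : (1 : ℝ) ≤ x.len := Nat.one_le_cast.2 x.len_pos
  have hmax : 1 ≤ max 1 (x.C / x.ε) := le_max_left _ _
  calc (x.budget : ℝ) = 9000 * (x.len ^ 3 * (x.len + 1) ^ 2 * x.n ^ 2) := by
        rw [Input.budget]; push_cast; rfl
    _ ≤ 9000 * (x.len ^ 3 * (2 * x.len) ^ 2 * x.n ^ 2) := by gcongr; linarith
    _ = 36000 * x.len ^ 5 * x.n ^ 2 := by ring
    _ ≤ 36000 * (61 * max 1 (x.C / x.ε) ^ 2) ^ 5 * x.n ^ 2 := by gcongr; exact Input.len_le hC hε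
    _ = (36000 * 61 ^ 5 : ℕ) * max 1 (x.C / x.ε) ^ 10 * x.n ^ 2 := by push_cast; ring
    _ ≤ K * max 1 (x.C / x.ε) ^ K * x.n ^ 2 := by gcongr; lia

theorem runs_algorithm (hF : Fits x W x.len) (hε : 0 < x.ε) (hC : ∀ i k, |x.A i k| ≤ x.C)
    (hrow : ∀ i, ∑ k, x.A i k ^ 2 ≤ (x.n : ℝ)) (hcol : ∀ k, ∑ i, x.A i k ^ 2 ≤ (x.n : ℝ)) :
    Runs x W algorithm .init x.budget x.IsSolved := by
  have hn := hF.n_pos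
  have hlen := hF.L_pos
  have hnW := hF.n_lt
  have hcost : 30 * x.len + (7800 * x.len ^ 3 * (x.len + 1) ^ 2 * x.n ^ 2 + (21 + 880 * x.n ^ 2)) ≤
      x.budget := by
    rw [Input.budget]
    have hnB : x.n ^ 2 ≤ x.len ^ 3 * (x.len + 1) ^ 2 * x.n ^ 2 :=
      Nat.le_mul_of_pos_left _ (by positivity)
    have hlenB : x.len * 1 ≤ x.len * (x.len ^ 2 * (x.len + 1) ^ 2 * x.n ^ 2) :=
      Nat.mul_le_mul_left _ (Nat.succ_le_iff.2 (by positivity))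
    nlinarith
  refine .le (.seq (runs_chooseLen hε hF.L_lt) fun s₁ hs₁ h₁ => .seq (runs_measure hF h₁
    (hs₁.real _ (by decide))) fun s₂ hs₂ ⟨hden, hmax⟩ => .ite (.realLE
    (.mul (.cast (.const (by lia))) (.mul (.mul .accuracy (.cast (.size (by lia))))
      (.mul .accuracy (.cast (.size (by lia))))))
    (.mul (.cast (.const (by lia))) (.div (.reg rfl) (.reg rfl) hden))) (fun h => ?_) fun h => ?_)
    hcost
  · rw [← sq] at h
    refine (runs_cut hn (by lia)).imp fun s₃ hs₃ ⟨hS, hT⟩ => .inr ⟨?_, ?_⟩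
    · rw [Store.Certifies, hs₃.word _ (by decide), hs₂.word _ (by decide), hs₁.word _ (by decide)]
      exact zero_ne_one
    · rw [hS, hT]
      exact hmax.le_abs_sum_cut hn hε hrow hcol h
  · rw [← sq] at h
    refine .le (.imp (.setWord (.const (Nat.zero_le _)) (.const (by lia))) fun s₃ _ h₃ => .inl
      ⟨?_, hmax.singularValues_le hε (Input.six_mul_div_len_le hε hC) h⟩) ?_
    · simp only [h₃, Store.Certifies, Store.setWord_word, and_self, if_true]
    · simp only [WExp.cost]
      nlinarith

end RealRAM

theorem theorem2p2 :
    ∃ (p : RealRAM.Prog) (K : ℕ), ∀ (n : ℕ) (A : Matrix (Fin n) (Fin n) ℝ) (C ε : ℝ),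
      1 ≤ n → 0 < ε →
      (∀ i k, |A i k| ≤ C) →
      (∀ i, ∑ k, A i k ^ 2 ≤ (n : ℝ)) →
      (∀ k, ∑ i, A i k ^ 2 ≤ (n : ℝ)) →
      ∃ s : RealRAM.Store,
        RealRAM.HaltsWithin p ⟨n, A, C, ε⟩ (K * max 1 (C / ε) ^ K * (n : ℝ) ^ 2) s ∧
        (s.Certifies ∧
            (∀ j : Fin n, (Matrix.toEuclideanLin A).singularValues j ≤ ε * n) ∨
          ¬ s.Certifies ∧
            ε ^ 8 / 100 * (n : ℝ) ^ 2 ≤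
              |∑ i ∈ s.outputSet 1 n, ∑ k ∈ s.outputSet 2 n, A i k| ∧
            ∃ j : Fin n, ε ^ 8 / 100 * (n : ℝ) ≤
              (Matrix.toEuclideanLin A).singularValues j) := by
  refine ⟨RealRAM.algorithm, 36000 * 61 ^ 5, fun n A C ε hn hε hC hrow hcol => ?_⟩
  let x : RealRAM.Input := ⟨n, A, C, ε⟩
  have hC₀ : 0 ≤ x.C := (abs_nonneg _).trans (hC ⟨0, hn⟩ ⟨0, hn⟩)
  have hbudget := x.budget_le hC₀ hε le_rfl
  obtain ⟨t, s, ht, hexec, hs⟩ :=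
    RealRAM.runs_algorithm (RealRAM.Input.fits_budget (x := x) hn) hε hC hrow hcol
  refine ⟨s, ⟨x.budget, t, hbudget, (Nat.cast_le.2 ht).trans hbudget, hexec⟩, ?_⟩
  rcases hs with ⟨hcert, hle⟩ | ⟨hcert, hcut⟩
  · exact .inl ⟨hcert, fun j => hle j⟩
  · exact .inr ⟨hcert, hcut, ⟨0, hn⟩, le_singularValues_zero_of_le_abs_sum hn hcut⟩
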